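/- Let $K$ be a number field with ring of integers $\mathcal{O}_K$ and class number $h$. Let $C_K$ be a smooth, proper, geometrically connected curve over $K$, and let $\mathbf{C}$ be a regular proper model of $C_K$ over $\mathcal{O}_K$, i.e. a regular scheme, proper and flat over $\mathcal{O}_K$, with generic fibre identified with $C_K$. Let $\mathbf{C}^{\mathrm{sm}} \subset \mathbf{C}$ be the smooth locus of $\mathbf{C} \to \operatorname{Spec} \mathcal{O}_K$, and let $\mathfrak{n}$ be the product of the nonzero prime ideals of $\mathcal{O}_K$ above which $\mathbf{C}$ is not smooth over $\mathcal{O}_K$. Let $\mathbf{U} \subset \mathbf{C}^{\mathrm{sm}}$ be an open subscheme obtained by removing, for every prime $\mathfrak{q} \mid \mathfrak{n}$, all but one irreducible component of the fibre $\mathbf{C}^{\mathrm{sm}}_{\mathbb{F}_\mathfrak{q}} = \mathbf{C}^{\mathrm{sm}} \times_{\operatorname{Spec} \mathcal{O}_K} \operatorname{Spec} \mathbb{F}_\mathfrak{q}$ ($\mathbb{F}_\mathfrak{q} = \mathcal{O}_K/\mathfrak{q}$), where the remaining component is geometrically irreducible over $\mathbb{F}_\mathfrak{q}$. Then $\mathcal{O}_{\mathbf{U}}(\mathbf{U})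 = \mathcal{O}_K$, that is, the canonical ring homomorphism $\mathcal{O}_K \to \mathcal{O}_{\mathbf{U}}(\mathbf{U})$ is an isomorphism. Moreover the inclusion $C_K \to \mathbf{C}$ of the generic fibre factors through $\mathbf{U}$, and the kernel of the restriction $\operatorname{Pic}(\mathbf{U}) \to \operatorname{Pic}(C_K)$ is $h$-torsion: if $L$ is a line bundle on $\mathbf{U}$ whose pull-back to $C_K$ is trivial, then $L^{\otimes h}$ is trivial on $\mathbf{U}$. -/

import Mathlib

open CategoryTheory CategoryTheory.Limits AlgebraicGeometry
open scoped NumberField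

universe u

noncomputable section

namespace PicU

/-! ### Line bundles on a scheme -/

section LineBundles

variable {X : Scheme.{u}}

/-- The structure sheaf `𝒪_X`, as a sheaf of `𝒪_X`-modules. -/
def structureSheaf (X : Scheme.{u}) : X.Modules := SheafOfModules.unit X.ringCatSheaf

/-- The tensor product over `𝒪_X`: the sheafification of `V ↦ M(V) ⊗ N(V)` (tensor product over
`𝒪_X(V)`). -/
def tensorObj (M N : X.Modules) : X.Modules :=
  (PresheafOfModules.sheafification (𝟙 X.ringCatSheaf.obj)).obj
    (PresheafOfModules.Monoidal.tensorObj (R := X.presheaf)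
      ((Scheme.Modules.toPresheafOfModules X).obj M) ((Scheme.Modules.toPresheafOfModules X).obj N))

/-- The tensor power `M^{⊗ n}`. -/
def tensorPow (M : X.Modules) : ℕ → X.Modules
  | 0 => structureSheaf X
  | n + 1 => tensorObj (tensorPow M n) M

/-- A line bundle: an `𝒪_X`-module which is locally isomorphic to `𝒪_X`. -/
def IsLineBundle (L : X.Modules) : Prop :=
  ∀ x : X, ∃ V : X.Opens, x ∈ V ∧ Nonempty (L.restrict V.ι ≅ structureSheaf V)

/-- `M` is trivial, i.e. isomorphic to `𝒪_X`. For a line bundle, this says that its class in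
`Pic X` is the neutral element. -/
def IsTrivial (M : X.Modules) : Prop := Nonempty (M ≅ structureSheaf X)

end LineBundles

/-! ### Curves over a number field and their regular proper models -/

section Models

variable {K : Type u} [Field K] [NumberField K]

/-- A smooth, proper, geometrically connected curve over `K`. -/
structure IsCurve {CK : Scheme.{u}} (p : CK ⟶ Spec (.of K)) : Prop where
  smooth : SmoothOfRelativeDimension 1 p
  proper : IsProper p
  geometricallyConnected : GeometricallyConnected p

/-- `f : C ⟶ Spec 𝓞 K` together with `i : CK ⟶ C` is a regular proper model of `CK` over `𝓞 K`:
`C` is regular, `f` is proper and flat, and `i` identifies `CK` with the generic fibre of `f`. -/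
structure IsRegularProperModel {CK C : Scheme.{u}} (p : CK ⟶ Spec (.of K))
    (f : C ⟶ Spec (.of (𝓞 K))) (i : CK ⟶ C) : Prop where
  regular : ∀ x : C, IsRegularLocalRing (C.presheaf.stalk x)
  proper : IsProper f
  flat : Flat f
  genericFibre : IsPullback i p f (Spec.map (CommRingCat.ofHom (algebraMap (𝓞 K) K)))

instance locallyOfFinitePresentation_of_isProper {C : Scheme.{u}} (f : C ⟶ Spec (.of (𝓞 K)))
    [IsProper f] : LocallyOfFinitePresentation f :=
  LocallyOfFinitePresentation.iff_locallyOfFiniteType.mpr inferInstance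

variable {C : Scheme.{u}} (f : C ⟶ Spec (.of (𝓞 K))) [LocallyOfFinitePresentation f]

/-- The closed point of `Spec 𝓞 K` given by a maximal ideal. -/
def point (q : IsDedekindDomain.HeightOneSpectrum (𝓞 K)) : (Spec (.of (𝓞 K)) : Scheme.{u}) :=
  (⟨q.asIdeal, q.isPrime⟩ : PrimeSpectrum (𝓞 K))

/-- `C` fails to be smooth over `𝓞 K` at some point above `q`. These are the prime factors of the
ideal `𝔫`, the product of the primes away from which `C` is smooth. -/
def IsBad (q : IsDedekindDomain.HeightOneSpectrum (𝓞 K)) : Prop :=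
  ∃ x : C, f x = point q ∧ x ∉ f.smoothLocus

/-- The structure morphism of the smooth locus `C^sm`. -/
abbrev smoothPart : (f.smoothLocus : Scheme.{u}) ⟶ Spec (.of (𝓞 K)) := f.smoothLocus.ι ≫ f

/-- The fibre `C^sm ×_{𝓞 K} Spec κ(q)` of the smooth locus. -/
abbrev smoothFibre (q : IsDedekindDomain.HeightOneSpectrum (𝓞 K)) : Scheme.{u} :=
  (smoothPart f).fiber (point q)

/-- The canonical map from the fibre of the smooth locus at `q` to `C`. -/
abbrev smoothFibreι (q : IsDedekindDomain.HeightOneSpectrum (𝓞 K)) : smoothFibre f q ⟶ C :=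
  (smoothPart f).fiberι (point q) ≫ f.smoothLocus.ι

/-- A closed subset `Z` of a scheme `X` over `S`, with its reduced structure, is geometrically
irreducible over `S`. -/
def IsGeometricallyIrreducibleClosed {X S : Scheme.{u}} (g : X ⟶ S) (Z : Set X) : Prop :=
  ∃ hZ : IsClosed Z,
    GeometricallyIrreducible ((Scheme.IdealSheafData.vanishingIdeal ⟨Z, hZ⟩).subschemeι ≫ g)

/-- `U` is obtained from the smooth locus `C^sm` by removing, for every bad prime `q`, all but one
irreducible component `Z q` of the fibre of `C^sm` at `q`, where `Z q` is geometrically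
irreducible. -/
def IsAdmissibleOpen (U : C.Opens) : Prop :=
  ∃ Z : (q : IsDedekindDomain.HeightOneSpectrum (𝓞 K)) → Set (smoothFibre f q),
    (∀ q, IsBad f q → Z q ∈ irreducibleComponents (smoothFibre f q) ∧
      IsGeometricallyIrreducibleClosed ((smoothPart f).fiberToSpecResidueField (point q)) (Z q)) ∧
    (U : Set C) = (f.smoothLocus : Set C) \
      ⋃ (q) (_ : IsBad f q), ⋃ W ∈ irreducibleComponents (smoothFibre f q) \ {Z q},
        smoothFibreι f q '' W

/-- The canonical ring homomorphism `𝓞 K → 𝒪_U(U)`. -/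
def toGlobalFunctions (U : C.Opens) : 𝓞 K →+* Γ((U : Scheme.{u}), ⊤) :=
  ((Scheme.ΓSpecIso (.of (𝓞 K))).inv ≫ (U.ι ≫ f).appTop).hom

end Models

end PicU

end

/-! Everything rests on two facts about `U`. Locally `U` is étale over the affine line over the
base, so at a point `x` over a prime `q` the extension `q 𝒪_x` is again a prime ideal
(`IsLocalLine.isPrime_map`). And every closed fibre of `U` is nonempty and irreducible
(`IsAdmissibleOpen.exists_generic`).

Functions: a global function on `U` restricts to a constant `r / m` in `K` on the generic fibre
(`bijective_globalFunctions`). Every prime `q` has a point of `U` above it, whose local ring is flat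
over the base, so `m` divides `r` locally at `q`; hence `m` divides `r`. Restriction to the generic
fibre is injective.

Torsion: a trivialization of `L` on the generic fibre turns local frames `e_i` into units `u_i`
there. After clearing denominators they become equations `α_i` of an effective divisor supported in
finitely many fibres (`exists_app_eq_mul`, `isUnit_toFun`). Fibres being irreducible, this divisor
is a sum of multiples `n_q` of whole fibres. Since `q ^ h` is principal with generator `c_q`, its
`h`-th multiple is the divisor of `c = ∏ c_q ^ n_q`; so `α_i ^ h = c b_i` with `b_i` a unit, and the
sections `b_i⁻¹ e_i ^ h` glue to a frame of `L ^ h`.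

Irreducible fibres: at a bad prime this is the construction of `U`. At a good prime it is a
connectedness theorem, proved here with function fields instead of cohomology. Let `c`, `c'` be
generic points of the fibre. The local ring `R` at `c` is a discrete valuation ring, and the base
change of the model to `R` is smooth and proper, integral by geometric connectedness, and has a
tautological section through a point above `c`. By `specializes_section` every generic point of its
special fibre specializes to the closed point of that section; so `c'` specializes to `c`, and they
are equal.

For `specializes_section`, suppose a component of the special fibre with generic point `ξ` misses
the section. Take a function `h` whose only pole on the generic fibre is the section
(`exists_notMem_forall_mem`). An element of `K[h]` regular at `ξ` is then regular along the whole
component, which is proper, so its residue is algebraic over the residue field of the base. As the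
function field is algebraic over `K(h)`, the residue field of `ξ` would be algebraic too, although
it has transcendence degree one. -/

noncomputable section

namespace PicU

/-! ### Local rings of smooth curves -/

section LocalAlgebra

open IsLocalRing Polynomial

/-- In a Noetherian local ring with principal maximal ideal `(t)`, every nonzero element is a unit
times a power of `t`. -/
theorem exists_eq_unit_mul_pow {O : Type*} [CommRing O] [IsLocalRing O] [IsNoetherianRing O]
    {t : O} (ht : maximalIdeal O = Ideal.span {t}) {a : O} (ha : a ≠ 0) :
    ∃ (n : ℕ) (v : O), IsUnit v ∧ a = v * t ^ n := by
  have hinf : ⨅ i : ℕ, maximalIdeal O ^ i = ⊥ :=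
    Ideal.iInf_pow_eq_bot_of_isLocalRing _ (maximalIdeal.isMaximal O).ne_top
  have hex : ∃ n : ℕ, a ∉ maximalIdeal O ^ n := by
    by_contra! h
    exact ha (by simpa [hinf] using (Ideal.mem_iInf.mpr h : a ∈ ⨅ i : ℕ, maximalIdeal O ^ i))
  classical
  obtain ⟨n, hn⟩ : ∃ n, Nat.find hex = n + 1 :=
    Nat.exists_eq_succ_of_ne_zero fun h ↦ by simpa [h] using Nat.find_spec hex
  have h1 : a ∈ maximalIdeal O ^ n := by
    by_contra h
    exact Nat.find_min hex (by omega : n < Nat.find hex) h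
  have h2 : a ∉ maximalIdeal O ^ (n + 1) := hn ▸ Nat.find_spec hex
  rw [ht, Ideal.span_singleton_pow, Ideal.mem_span_singleton'] at h1
  obtain ⟨v, rfl⟩ := h1
  refine ⟨n, v, ?_, rfl⟩
  by_contra hv
  apply h2
  have hv' : v ∈ Ideal.span {t} := ht ▸ (mem_maximalIdeal v).mpr hv
  obtain ⟨w, rfl⟩ := Ideal.mem_span_singleton'.mp hv'
  rw [ht, Ideal.span_singleton_pow, Ideal.mem_span_singleton]
  exact ⟨w, by ring⟩

/-- A Noetherian local ring whose maximal ideal is generated by one element, which is zero or a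
non-zero-divisor, is a domain. -/
theorem isDomain_of_maximalIdeal_eq_span {O : Type*} [CommRing O] [IsLocalRing O]
    [IsNoetherianRing O] {t : O} (ht : maximalIdeal O = Ideal.span {t})
    (ht' : t = 0 ∨ ∀ a, t * a = 0 → a = 0) : IsDomain O := by
  have : NoZeroDivisors O := by
    refine ⟨fun {a b} hab ↦ ?_⟩
    by_contra! h
    obtain ⟨n, v, hv, rfl⟩ := exists_eq_unit_mul_pow ht h.1
    obtain ⟨m, w, hw, rfl⟩ := exists_eq_unit_mul_pow ht h.2
    have h0 : t ^ (n + m) = 0 := by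
      have : (v * w) * t ^ (n + m) = 0 := by rw [← hab]; ring
      exact (hv.mul hw).mul_right_eq_zero.mp this
    rcases ht' with rfl | ht'
    · rcases n with _ | n
      · rcases m with _ | m
        · simp at h0
        · exact h.2 (by simp)
      · exact h.1 (by simp)
    · have key : ∀ k : ℕ, t ^ k ≠ 0 := by
        intro k
        induction k with
        | zero => simp
        | succ k ih => exact fun h ↦ ih (ht' _ (by rw [← pow_succ', h]))
      exact key _ h0
  exact NoZeroDivisors.to_isDomain O

/-- A Noetherian local domain with principal maximal ideal is a valuation ring. -/
theorem valuationRing_of_maximalIdeal_eq_span {O : Type*} [CommRing O] [IsLocalRing O] [IsDomain O]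
    [IsNoetherianRing O] {t : O} (ht : maximalIdeal O = Ideal.span {t}) : ValuationRing O := by
  refine ValuationRing.iff_dvd_total.mpr ⟨fun a b ↦ ?_⟩
  rcases eq_or_ne a 0 with rfl | ha
  · exact Or.inr (dvd_zero b)
  rcases eq_or_ne b 0 with rfl | hb
  · exact Or.inl (dvd_zero a)
  obtain ⟨n, v, hv, rfl⟩ := exists_eq_unit_mul_pow ht ha
  obtain ⟨m, w, hw, rfl⟩ := exists_eq_unit_mul_pow ht hb
  rcases le_total n m with h | h
  · left; rw [hv.mul_left_dvd]; exact (pow_dvd_pow t h).mul_left w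
  · right; rw [hw.mul_left_dvd]; exact (pow_dvd_pow t h).mul_left v

/-- The local structure of a smooth curve: a ring `O` over `R` is *locally a smooth line* if it is
a Noetherian local ring, flat over `R[X]`, whose maximal ideal is extended from `R[X]`. -/
structure IsLocalLine {R O : Type*} [CommRing R] [CommRing O] [IsLocalRing O] (ψ : R →+* O)
    (φ : R[X] →+* O) : Prop where
  noeth : IsNoetherianRing O
  comp_C : φ.comp C = ψ
  flat : φ.Flat
  map_comap : ((maximalIdeal O).comap φ).map φ = maximalIdeal O

/-- Multiplication by `t` is injective on `D ⧸ I`, and it stays so after tensoring with the flat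
algebra `O`, which gives `O ⧸ I O`. -/
theorem mem_map_of_flat_of_mul_mem {D O : Type*} [CommRing D] [CommRing O] {φ : D →+* O}
    (hφ : φ.Flat) {I : Ideal D} {t : D} (ht : ∀ a, t * a ∈ I → a ∈ I) {a : O}
    (ha : φ t * a ∈ I.map φ) : a ∈ I.map φ := by
  algebraize [φ]
  let f : (D ⧸ I) →ₗ[D] (D ⧸ I) := LinearMap.lsmul D _ t
  have hf : Function.Injective f := by
    rw [← LinearMap.ker_eq_bot, LinearMap.ker_eq_bot']
    intro m hm
    obtain ⟨m, rfl⟩ := Ideal.Quotient.mk_surjective m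
    have : Ideal.Quotient.mk I (t * m) = 0 := by simpa [f, Algebra.smul_def] using hm
    rw [Ideal.Quotient.eq_zero_iff_mem] at this ⊢
    exact ht _ this
  have hg : Function.Injective (f.lTensor O) := Module.Flat.lTensor_preserves_injective_linearMap f hf
  let e := TensorProduct.tensorQuotEquivQuotSMul O I
  have h1 : f.lTensor O (e.symm (Submodule.Quotient.mk a)) = 0 := by
    have : e.symm (Submodule.Quotient.mk a) = a ⊗ₜ[D] (1 : D ⧸ I) :=
      TensorProduct.tensorQuotEquivQuotSMul_symm_mk I a
    rw [this, LinearMap.lTensor_tmul]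
    have h2 : f 1 = t • 1 := rfl
    rw [h2, ← TensorProduct.smul_tmul, ← TensorProduct.tensorQuotEquivQuotSMul_symm_mk I (t • a)]
    rw [LinearEquiv.map_eq_zero_iff, Submodule.Quotient.mk_eq_zero]
    rw [Ideal.smul_top_eq_map, Submodule.restrictScalars_mem, Algebra.smul_def]
    exact ha
  have h3 : Submodule.Quotient.mk a = (0 : O ⧸ (I • ⊤ : Submodule D O)) := by
    rw [← LinearEquiv.map_eq_zero_iff e.symm]
    exact hg (by rw [h1, map_zero])
  rw [Submodule.Quotient.mk_eq_zero, Ideal.smul_top_eq_map, Submodule.restrictScalars_mem] at h3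
  exact h3

/-- Modulo `q` the polynomial ring is `(R ⧸ q)[X]`, a principal ideal ring. -/
theorem exists_comap_eq_sup_span {R : Type*} [CommRing R] (q : Ideal R) [q.IsMaximal]
    (p : Ideal R[X]) (hp : q.map C ≤ p) : ∃ t : R[X], p = q.map C ⊔ Ideal.span {t} := by
  let := Ideal.Quotient.field q
  let π : R[X] →+* (R ⧸ q)[X] := mapRingHom (Ideal.Quotient.mk q)
  have hπ : Function.Surjective π := map_surjective _ Ideal.Quotient.mk_surjective
  obtain ⟨s, hs⟩ := (IsPrincipalIdealRing.principal (p.map π)).principal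
  obtain ⟨t, rfl⟩ := hπ s
  have hker : RingHom.ker π = q.map C := by
    rw [Polynomial.ker_mapRingHom, Ideal.mk_ker]
  refine ⟨t, ?_⟩
  have h1 : (p.map π).comap π = p := by
    rw [Ideal.comap_map_of_surjective π hπ, ← RingHom.ker_eq_comap_bot, hker, sup_eq_left.mpr hp]
  have h2 : ((Ideal.span {t}).map π).comap π = Ideal.span {t} ⊔ q.map C := by
    rw [Ideal.comap_map_of_surjective π hπ, ← RingHom.ker_eq_comap_bot, hker]
  rw [← h1, sup_comm, ← h2, Ideal.map_span, Set.image_singleton, hs]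

namespace IsLocalLine

variable {R O : Type*} [CommRing R] [CommRing O] [IsLocalRing O] {ψ : R →+* O}
    {φ : R[X] →+* O}

/-- At a point over a maximal ideal `q`, the maximal ideal modulo `q` is generated by one element,
which is a non-zero-divisor modulo `q` unless it vanishes. -/
theorem exists_maximalIdeal_eq (h : IsLocalLine ψ φ) (q : Ideal R) [q.IsMaximal]
    (hq : (maximalIdeal O).comap ψ = q) : ∃ t : R[X], maximalIdeal O = q.map ψ ⊔ Ideal.span {φ t} ∧
      (t ∈ q.map C ∨ ∀ a, φ t * a ∈ q.map ψ → a ∈ q.map ψ) := by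
  have hle : q.map C ≤ (maximalIdeal O).comap φ := by
    rw [Ideal.map_le_iff_le_comap, Ideal.comap_comap, h.comp_C, hq]
  have hm : (q.map C).map φ = q.map ψ := by rw [Ideal.map_map, h.comp_C]
  obtain ⟨t, ht⟩ := exists_comap_eq_sup_span q _ hle
  refine ⟨t, ?_, ?_⟩
  · conv_lhs => rw [← h.map_comap, ht, Ideal.map_sup, hm, Ideal.map_span, Set.image_singleton]
  · by_cases hmem : t ∈ q.map C
    · exact Or.inl hmem
    · refine Or.inr fun a ha ↦ ?_
      have : (q.map (C : R →+* R[X])).IsPrime := Ideal.isPrime_map_C_of_isPrime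
      rw [← hm] at ha ⊢
      exact mem_map_of_flat_of_mul_mem h.flat (fun b hb ↦ (this.mem_or_mem hb).resolve_left hmem) ha

/-- The quotient by `q O`, the local ring of the fibre, is Noetherian local, and its maximal ideal
is generated by one element that is zero or a non-zero-divisor; such a ring is a domain. -/
theorem isPrime_map (h : IsLocalLine ψ φ) (q : Ideal R) [q.IsMaximal]
    (hq : (maximalIdeal O).comap ψ = q) : (q.map ψ).IsPrime := by
  obtain ⟨t, ht, ht'⟩ := h.exists_maximalIdeal_eq q hq
  have := h.noeth
  have hle : q.map ψ ≤ maximalIdeal O := ht ▸ le_sup_left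
  have hne : q.map ψ ≠ ⊤ := ne_top_of_le_ne_top (maximalIdeal.isMaximal O).ne_top hle
  have : Nontrivial (O ⧸ q.map ψ) := Ideal.Quotient.nontrivial_iff.mpr hne
  have : IsLocalRing (O ⧸ q.map ψ) := .of_surjective' _ Ideal.Quotient.mk_surjective
  have hmax : maximalIdeal (O ⧸ q.map ψ) = Ideal.span {Ideal.Quotient.mk _ (φ t)} := by
    rw [← map_maximalIdeal_of_surjective (Ideal.Quotient.mk (q.map ψ)) Ideal.Quotient.mk_surjective, ht,
      Ideal.map_sup, Ideal.map_quotient_self, bot_sup_eq, Ideal.map_span, Set.image_singleton]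
  rw [← Ideal.Quotient.isDomain_iff_prime]
  refine isDomain_of_maximalIdeal_eq_span hmax (ht'.imp (fun h0 ↦ ?_) fun h0 a ha ↦ ?_)
  · rw [Ideal.Quotient.eq_zero_iff_mem, ← h.comp_C, ← Ideal.map_map]
    exact Ideal.mem_map_of_mem _ h0
  · obtain ⟨a, rfl⟩ := Ideal.Quotient.mk_surjective a
    rw [← map_mul, Ideal.Quotient.eq_zero_iff_mem] at ha
    rw [Ideal.Quotient.eq_zero_iff_mem]
    exact h0 a ha

end IsLocalLine

/-- The local rings of a smooth curve over a field are valuation rings. -/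
theorem IsLocalLine.isDomain_and_valuationRing {k O : Type*} [Field k] [CommRing O] [IsLocalRing O]
    {ψ : k →+* O} {φ : k[X] →+* O} (h : IsLocalLine ψ φ) :
    ∃ _ : IsDomain O, ValuationRing O := by
  have hq : (maximalIdeal O).comap ψ = ⊥ :=
    (eq_bot_or_eq_top _).resolve_right (Ideal.comap_ne_top _ (maximalIdeal.isMaximal O).ne_top)
  have := h.noeth
  have : (⊥ : Ideal k).IsMaximal := Ideal.bot_isMaximal
  have hd : IsDomain O := by
    have := h.isPrime_map ⊥ hq
    rw [Ideal.map_bot] at this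
    exact (IsDomain.of_bot_isPrime O)
  obtain ⟨t, ht, -⟩ := h.exists_maximalIdeal_eq ⊥ hq
  rw [Ideal.map_bot, bot_sup_eq] at ht
  exact ⟨hd, valuationRing_of_maximalIdeal_eq_span ht⟩

/-- At a generic point of a fibre over a maximal ideal, the residue field is transcendental. -/
theorem IsLocalLine.exists_not_isIntegral {R O : Type*} [CommRing R] [CommRing O] [IsLocalRing O]
    {ψ : R →+* O} {φ : R[X] →+* O} (h : IsLocalLine ψ φ) (q : Ideal R) [q.IsMaximal]
    (hq : maximalIdeal O = q.map ψ) (hq' : (maximalIdeal O).comap ψ = q) :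
    ∃ t : O, ¬ ((residue O).comp ψ).IsIntegralElem (residue O t) := by
  -- The coordinate of the line is the transcendental element. If a monic `f` kills its residue,
  -- then `f` maps into `q O`; by flatness `f` has all coefficients in `q`, which its leading
  -- coefficient forbids.
  refine ⟨φ X, fun ⟨f, hf, hf'⟩ ↦ ?_⟩
  have h1 : residue O (φ f) = 0 := by
    rw [← hf', ← h.comp_C]
    have : ((residue O).comp φ) f = (((residue O).comp (φ.comp C)).comp (RingHom.id R) |> fun g ↦
        eval₂ g (residue O (φ X)) f) := by
      conv_lhs => rw [← Polynomial.eval₂_C_X (p := f), Polynomial.hom_eval₂]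
      rfl
    exact this
  obtain ⟨t, ht, -⟩ := h.exists_maximalIdeal_eq q hq'
  have hprime : (q.map (C : R →+* R[X])).IsPrime := Ideal.isPrime_map_C_of_isPrime
  rw [residue_eq_zero_iff, hq, ← h.comp_C, ← Ideal.map_map] at h1
  have hmem : f ∈ q.map C := by
    by_contra hn
    have h2 : (1 : O) ∈ (q.map C).map φ :=
      mem_map_of_flat_of_mul_mem h.flat (t := f)
        (fun b hb ↦ (hprime.mem_or_mem hb).resolve_left hn) (by simpa using h1)
    rw [Ideal.map_map, h.comp_C, ← hq] at h2
    exact (maximalIdeal.isMaximal O).ne_top ((Ideal.eq_top_iff_one _).mpr h2)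
  rw [Ideal.mem_map_C_iff] at hmem
  have := hmem f.natDegree
  rw [hf.coeff_natDegree] at this
  exact (inferInstance : q.IsMaximal).ne_top ((Ideal.eq_top_iff_one _).mpr this)

end LocalAlgebra

/-! ### Étale charts, and local rings over an affine base -/

section StalkOfBase

/-- The ring homomorphism from the base ring to the local ring at a point. -/
def baseToStalk {R : CommRingCat.{u}} {X : Scheme.{u}} (g : X ⟶ Spec R) (x : X) :
    R →+* X.presheaf.stalk x :=
  ((Scheme.ΓSpecIso R).inv ≫ g.appTop ≫ X.presheaf.germ ⊤ x (TopologicalSpace.Opens.mem_top x)).hom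

open IsLocalRing Polynomial

/-- `O` is étale over `R[X]` up to localization. Flatness and Noetherianity are inherited; being
unramified over the localization `D` of `R[X]` at the contracted prime makes the maximal ideal of
`D` generate that of `O`. -/
theorem isLocalLine_of_etale {R A O : Type u} [CommRing R] [CommRing A] [CommRing O] [IsLocalRing O]
    [IsNoetherianRing R] (M : Submonoid A) [Algebra A O] [IsLocalization M O]
    (φ : R[X] →+* A) (hφ : φ.Etale) :
    IsLocalLine ((algebraMap A O).comp (φ.comp C)) ((algebraMap A O).comp φ) := by
  algebraize [φ, (algebraMap A O).comp φ]
  have : IsScalarTower R[X] A O := .of_algebraMap_eq' rfl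
  have : Algebra.EssFiniteType A O := .of_isLocalization O M
  have : Algebra.EssFiniteType R[X] O := .comp R[X] A O
  have hN : IsNoetherianRing O := Algebra.EssFiniteType.isNoetherianRing R[X] O
  have : Algebra.FormallyEtale A O := .of_isLocalization M
  have : Algebra.FormallyEtale R[X] O := .comp R[X] A O
  have : Module.Flat A O := IsLocalization.flat O M
  have hF : Module.Flat R[X] O := .trans R[X] A O
  refine ⟨hN, rfl, ?_, ?_⟩
  · exact hF
  · let p := (maximalIdeal O).comap (algebraMap R[X] O)
    have hp : p.IsPrime := inferInstance
    let D := Localization.AtPrime p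
    let e : D →+* O := IsLocalization.lift (M := p.primeCompl) (g := algebraMap R[X] O)
      (fun y ↦ by
        by_contra hy
        exact y.2 ((mem_maximalIdeal _).mpr hy))
    algebraize [e]
    have : IsScalarTower R[X] D O := .of_algebraMap_eq' (IsLocalization.lift_comp _).symm
    have : IsLocalHom (algebraMap D O) := by
      refine ((local_hom_TFAE (algebraMap D O)).out 0 2).mpr ?_
      rw [← Localization.AtPrime.map_eq_maximalIdeal, Ideal.map_map, ← IsScalarTower.algebraMap_eq]
      exact Ideal.map_comap_le
    have : Algebra.EssFiniteType D O := .of_comp R[X] D O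
    have : Algebra.FormallyUnramified D O := .of_restrictScalars R[X] D O
    have h := Algebra.FormallyUnramified.map_maximalIdeal (R := D) (S := O)
    rw [← Localization.AtPrime.map_eq_maximalIdeal, Ideal.map_map, ← IsScalarTower.algebraMap_eq] at h
    exact h

theorem exists_isStandardSmooth_appLE {R : CommRingCat.{u}} {X : Scheme.{u}} (g : X ⟶ Spec R) (n : ℕ)
    [hg : SmoothOfRelativeDimension n g] (x : X) :
    ∃ (V : X.Opens) (_ : IsAffineOpen V) (_ : x ∈ V),
      (g.appLE ⊤ V le_top).hom.IsStandardSmoothOfRelativeDimension n := by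
  obtain ⟨V, hV, hx, -⟩ := TopologicalSpace.Opens.isBasis_iff_nbhd.mp X.isBasis_affineOpens
      (TopologicalSpace.Opens.mem_top x)
  have := HasRingHomProperty.appLE (@SmoothOfRelativeDimension n) g hg
    ⟨⊤, isAffineOpen_top _⟩ ⟨V, hV⟩ le_top
  rw [RingHom.locally_iff_isLocalization
    RingHom.isStandardSmoothOfRelativeDimension_respectsIso] at this
  obtain ⟨s, hs, hfs⟩ := this
  apply iSup_basicOpen_of_span_eq_top at hs
  have : x ∈ (⨆ i ∈ s, X.basicOpen i) := hs.symm ▸ hx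
  obtain ⟨r, hr, hrs⟩ : ∃ r ∈ s, x ∈ X.basicOpen r := by simpa using this
  refine ⟨X.basicOpen r, hV.basicOpen r, hrs, ?_⟩
  rw [← g.appLE_map le_top (homOfLE (X.basicOpen_le r)).op]
  have : IsLocalization.Away r Γ(X, X.basicOpen r) := hV.isLocalization_basicOpen r
  exact hfs r hr _

theorem exists_etale_polynomial {R : CommRingCat.{u}} {X : Scheme.{u}}
    (g : X ⟶ Spec R) [SmoothOfRelativeDimension 1 g] (x : X) :
    ∃ (V : X.Opens) (_ : IsAffineOpen V) (hx : x ∈ V) (φ : R[X] →+* Γ(X, V)), φ.Etale ∧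
      (X.presheaf.germ V x hx).hom.comp (φ.comp C) = baseToStalk g x := by
  obtain ⟨V, hV, hx, h⟩ := exists_isStandardSmooth_appLE g 1 x
  obtain ⟨φ, hφ, hφ'⟩ := h.exists_etale_mvPolynomial
  let e : R[X] ≃+* MvPolynomial (Fin 1) Γ(Spec R, ⊤) :=
    (mapEquiv (Scheme.ΓSpecIso R).symm.commRingCatIsoToRingEquiv).trans
      (MvPolynomial.uniqueAlgEquiv _ (Fin 1)).symm.toRingEquiv
  refine ⟨V, hV, hx, φ.comp e.toRingHom,
    RingHom.Etale.stableUnderComposition _ _ (RingHom.Etale.of_bijective e.bijective) hφ', ?_⟩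
  have h1 : e.toRingHom.comp C =
      MvPolynomial.C.comp (Scheme.ΓSpecIso R).inv.hom := by
    ext r
    simp [e, MvPolynomial.uniqueAlgEquiv]
  have h3 : φ.comp (MvPolynomial.C.comp (Scheme.ΓSpecIso R).inv.hom) =
      (g.appLE ⊤ V le_top).hom.comp (Scheme.ΓSpecIso R).inv.hom := by
    rw [← hφ]; rfl
  rw [RingHom.comp_assoc, h1, h3]
  have h2 : g.appTop ≫ X.presheaf.germ ⊤ x (TopologicalSpace.Opens.mem_top x) =
      g.appLE ⊤ V le_top ≫ X.presheaf.germ V x hx := by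
    change _ = (g.app ⊤ ≫ X.presheaf.map (homOfLE _).op) ≫ _
    rw [Category.assoc, TopCat.Presheaf.germ_res]
    rfl
  rw [baseToStalk, h2]
  rfl

theorem exists_isLocalLine {R : CommRingCat.{u}} [IsNoetherianRing R] {X : Scheme.{u}}
    (g : X ⟶ Spec R) [SmoothOfRelativeDimension 1 g] (x : X) :
    ∃ φ, IsLocalLine (baseToStalk g x) φ := by
  obtain ⟨V, hV, hx, φ, hφ, h⟩ := exists_etale_polynomial g x
  let := TopCat.Presheaf.algebra_section_stalk X.presheaf ⟨x, hx⟩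
  have := hV.isLocalization_stalk ⟨x, hx⟩
  have key := isLocalLine_of_etale (O := X.presheaf.stalk x)
    (hV.primeIdealOf ⟨x, hx⟩).asIdeal.primeCompl φ hφ
  exact ⟨(algebraMap Γ(X, V) (X.presheaf.stalk x)).comp φ, h ▸ key⟩

theorem IsLocalLine.flat_base {R O : Type*} [CommRing R] [CommRing O] [IsLocalRing O] {ψ : R →+* O}
    {φ : R[X] →+* O} (h : IsLocalLine ψ φ) : ψ.Flat := by
  rw [← h.comp_C]
  refine RingHom.Flat.comp ?_ h.flat
  rw [← Polynomial.algebraMap_eq, RingHom.flat_algebraMap_iff]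
  infer_instance

variable {R : CommRingCat.{u}} {X : Scheme.{u}} (g : X ⟶ Spec R)

theorem fromSpecStalk_comp (x : X) :
    X.fromSpecStalk x ≫ g = Spec.map (CommRingCat.ofHom (baseToStalk g x)) := by
  have h : (X.fromSpecStalk x ≫ g) ≫ (Spec R).toSpecΓ =
      Spec.map (g.appTop ≫ X.presheaf.germ ⊤ x (TopologicalSpace.Opens.mem_top x)) := by
    rw [Category.assoc, Scheme.toSpecΓ_naturality, Scheme.fromSpecStalk_toSpecΓ_assoc,
      Spec.map_comp]
  rw [← cancel_mono (Spec R).toSpecΓ]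
  refine h.trans ?_
  rw [baseToStalk, CommRingCat.ofHom_hom, Spec.map_comp (Scheme.ΓSpecIso R).inv,
    Category.assoc, SpecMap_ΓSpecIso_inv_toSpecΓ, Category.comp_id]

theorem comap_maximalIdeal_baseToStalk (x : X) :
    (maximalIdeal (X.presheaf.stalk x)).comap (baseToStalk g x) = (g x).asIdeal := by
  have h : g (X.fromSpecStalk x (closedPoint (X.presheaf.stalk x))) =
      Spec.map (CommRingCat.ofHom (baseToStalk g x)) (closedPoint (X.presheaf.stalk x)) := by
    rw [← fromSpecStalk_comp]; rfl
  rw [Scheme.fromSpecStalk_closedPoint] at h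
  rw [h]
  rfl

theorem stalkSpecializes_baseToStalk {x y : X} (h : x ⤳ y) (r : R) :
    X.presheaf.stalkSpecializes h (baseToStalk g y r) = baseToStalk g x r := by
  have := congr($(X.presheaf.germ_stalkSpecializes (U := ⊤) (TopologicalSpace.Opens.mem_top y) h) (g.appTop
    ((Scheme.ΓSpecIso R).inv r)))
  exact this

theorem germ_eq_baseToStalk {V : X.Opens} {x : X} (hx : x ∈ V) (r : R) :
    X.presheaf.germ V x hx ((X.presheaf.map (homOfLE le_top).op) (g.appTop
      ((Scheme.ΓSpecIso R).inv r))) = baseToStalk g x r := by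
  simp [baseToStalk]

/-- Elements of the local ring at a generization are fractions. -/
theorem exists_stalkSpecializes_mul_eq {x y : X} (h : x ⤳ y) (z : X.presheaf.stalk x) :
    ∃ c d : X.presheaf.stalk y, IsUnit (X.presheaf.stalkSpecializes h d) ∧
      z * X.presheaf.stalkSpecializes h d = X.presheaf.stalkSpecializes h c := by
  obtain ⟨V, hV, hy, -⟩ := TopologicalSpace.Opens.isBasis_iff_nbhd.mp X.isBasis_affineOpens
      (TopologicalSpace.Opens.mem_top y)
  have hx : x ∈ V := h.mem_open V.2 hy
  let := TopCat.Presheaf.algebra_section_stalk X.presheaf ⟨x, hx⟩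
  have := hV.isLocalization_stalk ⟨x, hx⟩
  obtain ⟨⟨a, s⟩, has⟩ := IsLocalization.surj (hV.primeIdealOf ⟨x, hx⟩).asIdeal.primeCompl z
  have hs := IsLocalization.map_units (X.presheaf.stalk x) s
  refine ⟨X.presheaf.germ V y hy a, X.presheaf.germ V y hy s, ?_, ?_⟩
  · rw [← CommRingCat.comp_apply, X.presheaf.germ_stalkSpecializes]
    exact hs
  · rw [← CommRingCat.comp_apply, ← CommRingCat.comp_apply, X.presheaf.germ_stalkSpecializes]
    exact has

/-- The prime ideals of a local ring are given by the generizations of the point. -/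
theorem exists_specializes_comap_eq (b : X) (P : Ideal (X.presheaf.stalk b)) [hP : P.IsPrime] :
    ∃ (y : X) (h : y ⤳ b), (maximalIdeal (X.presheaf.stalk y)).comap
      (X.presheaf.stalkSpecializes h).hom = P := by
  let yP : Spec (X.presheaf.stalk b) := (⟨P, hP⟩ : PrimeSpectrum _)
  have hy : X.fromSpecStalk b yP ⤳ b := by
    have : X.fromSpecStalk b yP ∈ Set.range (X.fromSpecStalk b) := ⟨_, rfl⟩
    rwa [Scheme.range_fromSpecStalk] at this
  refine ⟨_, hy, ?_⟩
  have h1 : X.fromSpecStalk b (Spec.map (X.presheaf.stalkSpecializes hy)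
      (closedPoint (X.presheaf.stalk _))) = X.fromSpecStalk b yP :=
    congr($(X.SpecMap_stalkSpecializes_fromSpecStalk hy) (closedPoint
      (X.presheaf.stalk _))).trans Scheme.fromSpecStalk_closedPoint
  exact congrArg PrimeSpectrum.asIdeal ((X.fromSpecStalk b).injective h1)

end StalkOfBase

/-! ### Function fields in one variable -/

section FunctionFields

open Polynomial

variable {K F : Type*} [Field K] [Field F] [Algebra K F]

theorem isIntegral_mem_valuationSubring (O : ValuationSubring F) (S : Subring F)
    (hS : ∀ a ∈ S, a ∈ O) {z : F} (hz : IsIntegral S z) : z ∈ O := by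
  have h : IsIntegral O z := by
    obtain ⟨p, hp, hp'⟩ := hz
    refine ⟨p.map (Subring.inclusion (T := O.toSubring) hS), hp.map _, ?_⟩
    rw [Polynomial.eval₂_map]
    exact hp'
  obtain ⟨y, hy⟩ := IsIntegrallyClosed.isIntegral_iff.mp h
  rw [← hy]
  exact y.2

theorem aeval_mem_valuationSubring (O : ValuationSubring F) (hO : ∀ a : K, algebraMap K F a ∈ O)
    {z : F} (hz : z ∈ O) (p : K[X]) : aeval z p ∈ O := by
  rw [aeval_eq_sum_range]
  exact sum_mem fun i _ ↦ by
    rw [Algebra.smul_def]; exact O.mul_mem _ _ (hO _) (pow_mem hz _)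

theorem mem_valuationSubring_of_isIntegral (O : ValuationSubring F)
    (hO : ∀ a : K, algebraMap K F a ∈ O) {g : F} (hg : g ∈ O) {z : F}
    (hz : IsIntegral (Algebra.adjoin K {g}) z) : z ∈ O := by
  refine isIntegral_mem_valuationSubring O (Algebra.adjoin K {g}).toSubring (fun a ha ↦ ?_) hz
  rw [Subalgebra.mem_toSubring, Algebra.adjoin_singleton_eq_range_aeval] at ha
  obtain ⟨p, rfl⟩ := ha
  exact aeval_mem_valuationSubring O hO hg p

theorem mem_valuationSubring_of_isAlgebraic (O : ValuationSubring F)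
    (hO : ∀ a : K, algebraMap K F a ∈ O) {z : F} (hz : IsAlgebraic K z) : z ∈ O := by
  refine mem_valuationSubring_of_isIntegral O hO (g := 0) O.zero_mem ?_
  exact hz.isIntegral.tower_top

/-- If `a` is integral over `K[g]`, then `a / g ^ N` is integral over `K[1 / g]` for large `N`. -/
theorem exists_isIntegral_inv {g a : F} (hg : g ≠ 0) (ha : IsIntegral (Algebra.adjoin K {g}) a) :
    ∃ N : ℕ, ∀ n, N ≤ n → IsIntegral (Algebra.adjoin K {g⁻¹}) (a * g⁻¹ ^ n) := by
  obtain ⟨f, hf, hf'⟩ := ha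
  have hpol : ∀ b : Algebra.adjoin K {g}, ∃ p : K[X], (b : F) = aeval g p := fun b ↦ by
    obtain ⟨p, hp⟩ := (Algebra.adjoin_singleton_eq_range_aeval K g).le b.2
    exact ⟨p, hp.symm⟩
  choose P hP using hpol
  -- The coefficient of index `i < d` will be multiplied by `g⁻¹ ^ (n * (d - i))`, where `n * (d -
  -- i) ≥ n`. Any common bound for the degrees of the coefficients in `g` does; the sum is one.
  let N := ∑ i ∈ Finset.range f.natDegree, (P (f.coeff i)).natDegree
  refine ⟨N, fun n hn ↦ ?_⟩
  have hmem : ∀ (p : K[X]) (m : ℕ), p.natDegree ≤ m →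
      aeval g p * g⁻¹ ^ m ∈ Algebra.adjoin K {g⁻¹} := by
    intro p m hm
    rw [aeval_eq_sum_range, Finset.sum_mul]
    refine sum_mem fun i hi ↦ ?_
    have him : i ≤ m := by rw [Finset.mem_range] at hi; omega
    have : p.coeff i • g ^ i * g⁻¹ ^ m = p.coeff i • g⁻¹ ^ (m - i) := by
      rw [smul_mul_assoc, inv_pow, inv_pow, pow_sub₀ g hg him]
      congr 1
      rw [mul_inv, inv_inv, mul_comm]
    rw [this]
    exact Subalgebra.smul_mem _ (pow_mem (Algebra.self_mem_adjoin_singleton K _) _) _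
  let B := Algebra.adjoin K {g⁻¹}
  -- the monic polynomial satisfied by `a * g⁻¹ ^ n`
  let d := f.natDegree
  have hc : ∀ i, i < d → (f.coeff i : F) * g⁻¹ ^ (n * (d - i)) ∈ B := by
    intro i hi
    rw [hP]
    apply hmem
    calc _ ≤ N := Finset.single_le_sum (f := fun i ↦ (P (f.coeff i)).natDegree)
              (fun _ _ ↦ Nat.zero_le _) (Finset.mem_range.mpr hi)
      _ ≤ n := hn
      _ ≤ _ := Nat.le_mul_of_pos_right _ (by omega)
  classical
  let q : B[X] := X ^ d + ∑ i : Fin d, C ⟨_, hc i i.2⟩ * X ^ (i : ℕ)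
  refine ⟨q, ?_, ?_⟩
  · refine monic_X_pow_add ?_
    refine lt_of_le_of_lt (degree_sum_le _ _) ?_
    refine (Finset.sup_lt_iff (WithBot.bot_lt_coe d)).mpr fun i _ ↦ ?_
    exact lt_of_le_of_lt (degree_C_mul_X_pow_le _ _) (WithBot.coe_lt_coe.mpr i.2)
  · have h1 : (a ^ d + ∑ i : Fin d, (f.coeff i : F) * a ^ (i : ℕ)) = 0 := by
      rw [← hf', eval₂_eq_sum_range, Finset.sum_range_succ, Finset.sum_range]
      rw [show f.coeff f.natDegree = 1 from hf]
      rw [add_comm]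
      simp [d]
    have h2 : eval₂ (algebraMap B F) (a * g⁻¹ ^ n) q =
        (a ^ d + ∑ i : Fin d, (f.coeff i : F) * a ^ (i : ℕ)) * g⁻¹ ^ (n * d) := by
      simp only [q, eval₂_add, eval₂_pow, eval₂_X, eval₂_finsetSum, eval₂_mul, eval₂_C]
      rw [add_mul, Finset.sum_mul]
      congr 1
      · rw [mul_pow, ← pow_mul]
      · refine Finset.sum_congr rfl fun i _ ↦ ?_
        change (f.coeff i : F) * g⁻¹ ^ (n * (d - i)) * _ = _
        rw [mul_pow, ← pow_mul]
        have : n * d = n * (d - i) + n * i := by rw [← mul_add, Nat.sub_add_cancel i.2.le]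
        rw [this, pow_add]; ring
    rw [h2, h1, zero_mul]

/-- A function field in one variable is finite over `K(g)` for `g` transcendental: the data of the
ring of functions integral over `K[g]`. -/
theorem exists_dedekind [CharZero K] [Algebra.EssFiniteType K F] {g : F} (hg : Transcendental K g)
    [Algebra.IsAlgebraic (Algebra.adjoin K {g}) F] :
    IsDedekindDomain (integralClosure (Algebra.adjoin K {g}) F) ∧
      Module.Finite (Algebra.adjoin K {g}) (integralClosure (Algebra.adjoin K {g}) F) ∧
      IsFractionRing (integralClosure (Algebra.adjoin K {g}) F) F := by
  let A := Algebra.adjoin K {g}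
  let e : K[X] ≃ₐ[K] A := (AlgEquiv.ofInjective (aeval g)
    ((transcendental_iff_injective).mp hg)).trans
      (Subalgebra.equivOfEq _ _ (Algebra.adjoin_singleton_eq_range_aeval K g).symm)
  have : IsDomain A := inferInstance
  have : IsPrincipalIdealRing A := IsPrincipalIdealRing.of_surjective (e : K[X] →+* A) e.surjective
  have : IsDedekindDomain A := inferInstance
  let := FractionRing.liftAlgebra A F
  have := FractionRing.isScalarTower_liftAlgebra A F
  have : CharZero A := charZero_of_injective_algebraMap (algebraMap K A).injective
  have : CharZero (FractionRing A) := inferInstance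
  have : Algebra.IsAlgebraic (FractionRing A) F := (IsFractionRing.comap_isAlgebraic_iff (A := A)).mp inferInstance
  have : IsScalarTower K (FractionRing A) F := inferInstance
  have : Algebra.EssFiniteType (FractionRing A) F := .of_comp K _ _
  -- Algebraic and essentially of finite type gives finite over `K(g)`; characteristic zero gives
  -- the separability behind the finiteness of the integral closure.
  have : FiniteDimensional (FractionRing A) F := by
    exact Algebra.finite_of_essFiniteType_of_isAlgebraic
  refine ⟨integralClosure.isDedekindDomain A (FractionRing A) F, ?_, ?_⟩
  · exact IsIntegralClosure.finite A (FractionRing A) F _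
  · exact IsIntegralClosure.isFractionRing_of_finite_extension A (FractionRing A) F _


/-- The localization of `B` at `p` is a discrete valuation ring with fraction field `F`. -/
theorem exists_eq_or_inv_eq {B : Type*} [CommRing B] [IsDedekindDomain B] [Algebra B F]
    [IsFractionRing B F] (p : Ideal B) (hp0 : p ≠ ⊥) [p.IsPrime] (z : F) :
    ∃ a b : B, b ∉ p ∧ (z = algebraMap B F a / algebraMap B F b ∨
      z⁻¹ = algebraMap B F a / algebraMap B F b) := by
  have := IsLocalization.AtPrime.isDiscreteValuationRing_of_dedekind_domain B hp0
    (Localization.AtPrime p)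
  have hle : p.primeCompl ≤ nonZeroDivisors B := Ideal.primeCompl_le_nonZeroDivisors p
  let : Algebra (Localization.AtPrime p) F := (IsLocalization.lift (M := p.primeCompl)
    (g := algebraMap B F) fun y ↦ by
      simpa using fun h : (y : B) = 0 ↦ y.2 (h ▸ p.zero_mem)).toAlgebra
  have : IsScalarTower B (Localization.AtPrime p) F := .of_algebraMap_eq fun x ↦
    (IsLocalization.lift_eq _ x).symm
  have : IsFractionRing (Localization.AtPrime p) F :=
    IsFractionRing.isFractionRing_of_isDomain_of_isLocalization p.primeCompl _ _
  have key : ∀ w : Localization.AtPrime p, ∃ a b : B, b ∉ p ∧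
      algebraMap _ F w = algebraMap B F a / algebraMap B F b := by
    intro w
    obtain ⟨a, b, rfl⟩ := IsLocalization.exists_mk'_eq p.primeCompl w
    refine ⟨a, b, b.2, ?_⟩
    have hb : algebraMap B F b ≠ 0 := by
      simpa using fun h : (b : B) = 0 ↦ b.2 (h ▸ p.zero_mem)
    rw [eq_div_iff hb, IsScalarTower.algebraMap_apply B (Localization.AtPrime p) F b, ← map_mul,
      IsLocalization.mk'_spec, ← IsScalarTower.algebraMap_apply]
  rcases ValuationRing.isInteger_or_isInteger (Localization.AtPrime p) z with ⟨w, hw⟩ | ⟨w, hw⟩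
  · obtain ⟨a, b, hb, h⟩ := key w
    exact ⟨a, b, hb, .inl (hw ▸ h)⟩
  · obtain ⟨a, b, hb, h⟩ := key w
    exact ⟨a, b, hb, .inr (hw ▸ h)⟩

/-- A valuation ring with centre `p` on `B` must be `B_p`. This is one inclusion between two such
rings; exchanging them gives equality. -/
theorem valuationSubring_le_of_forall_iff {B : Type*} [CommRing B] [IsDedekindDomain B]
    [Algebra B F] [IsFractionRing B F] (P O : ValuationSubring F)
    (hO : ∀ b : B, algebraMap B F b ∈ O) (p : Ideal B) (hp0 : p ≠ ⊥) [p.IsPrime]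
    (hPp : ∀ b, b ∈ p ↔ P.valuation (algebraMap B F b) < 1)
    (hOp : ∀ b, b ∈ p ↔ O.valuation (algebraMap B F b) < 1) : P ≤ O := by
  intro z hz
  obtain ⟨a, b, hb, h⟩ := exists_eq_or_inv_eq (F := F) p hp0 z
  have hOb : O.valuation (algebraMap B F b) = 1 :=
    le_antisymm ((O.valuation_le_one_iff _).mpr (hO b)) (not_lt.mp (mt (hOp b).mpr hb))
  rcases h with h | h
  · rw [← O.valuation_le_one_iff, h, map_div₀, hOb, div_one]
    exact (O.valuation_le_one_iff _).mpr (hO a)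
  · by_cases ha : a ∈ p
    · by_cases hz0 : z = 0
      · rw [hz0]; exact O.zero_mem
      have h1 := (hPp a).mp ha
      have h2 : algebraMap B F a = z⁻¹ * algebraMap B F b := by
        rw [h, div_mul_cancel₀]
        intro h0
        rw [h0, map_zero] at hOb
        exact zero_ne_one hOb
      exfalso
      refine hb ((hPp b).mpr ?_)
      have h3 : algebraMap B F b = z * algebraMap B F a := by
        rw [h2, mul_inv_cancel_left₀ hz0]
      rw [h3, map_mul]
      exact Right.mul_lt_one_of_le_of_lt ((P.valuation_le_one_iff _).mpr hz) h1
    · have hOa : O.valuation (algebraMap B F a) = 1 :=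
        le_antisymm ((O.valuation_le_one_iff _).mpr (hO a)) (not_lt.mp (mt (hOp a).mpr ha))
      rw [← O.valuation_le_one_iff, ← inv_inv z, h, map_inv₀, map_div₀, hOb, hOa]
      simp

/-- In a Dedekind domain `B` with fraction field `F`, let `g` be in the maximal ideal of a
valuation ring `P ⊇ B`. Then there is an `s` with `g * s ∈ B` that lies in all valuation rings
containing `B` except `P`. -/
theorem exists_mul_mem_of_dedekind {B : Type*} [CommRing B] [IsDedekindDomain B] [Algebra B F]
    [IsFractionRing B F] (P : ValuationSubring F) (hP : ∀ b : B, algebraMap B F b ∈ P)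
    (g : B) (hg0 : g ≠ 0) (hg : P.valuation (algebraMap B F g) < 1) :
    ∃ d : B, algebraMap B F d / algebraMap B F g ∉ P ∧
      ∀ O : ValuationSubring F, (∀ b : B, algebraMap B F b ∈ O) → O ≠ P →
        algebraMap B F d / algebraMap B F g ∈ O := by
  let c (O : ValuationSubring F) (hO : ∀ b : B, algebraMap B F b ∈ O) : Ideal B :=
    (IsLocalRing.maximalIdeal O).comap ((algebraMap B F).codRestrict O.toSubring hO)
  have hc (O : ValuationSubring F) (hO : ∀ b : B, algebraMap B F b ∈ O) (b : B) :
      b ∈ c O hO ↔ O.valuation (algebraMap B F b) < 1 := by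
    rw [Ideal.mem_comap, O.valuation_lt_one_iff]
    rfl
  have hcp (O : ValuationSubring F) (hO : ∀ b : B, algebraMap B F b ∈ O) : (c O hO).IsPrime :=
    Ideal.comap_isPrime _ _
  let p := c P hP
  have : p.IsPrime := hcp P hP
  have hgp : g ∈ p := (hc P hP g).mpr hg
  have hp0 : p ≠ ⊥ := fun h ↦ hg0 (by rw [h] at hgp; simpa using hgp)
  have hpm : p.IsMaximal := this.isMaximal hp0
  have hgF : algebraMap B F g ≠ 0 := by simpa using hg0
  have hpp : Prime p := Ideal.prime_of_isPrime hp0 this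
  have hfin : FiniteMultiplicity p (Ideal.span {g}) :=
    FiniteMultiplicity.of_prime_left hpp (by simpa using hg0)
  -- Split `(g) = p ^ m J` with `J` prime to `p`, and take `d` in `J` but not in `p`: dividing by
  -- `g` leaves the full pole at `p` and cancels all others.
  obtain ⟨J, hJ, hJp⟩ := hfin.exists_eq_pow_mul_and_not_dvd
  rw [Ideal.dvd_iff_le] at hJp
  obtain ⟨d, hdJ, hdp⟩ := SetLike.not_le_iff_exists.mp hJp
  refine ⟨d, fun hs ↦ hdp ?_, fun O hO hOP ↦ ?_⟩
  · rw [hc, ← div_mul_cancel₀ (algebraMap B F d) hgF, map_mul]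
    exact Right.mul_lt_one_of_le_of_lt ((P.valuation_le_one_iff _).mpr hs) hg
  · have := hcp O hO
    -- A centre containing the maximal ideal `p` would equal it, and then the two valuation rings
    -- would coincide.
    have hne : ¬ p ≤ c O hO := by
      intro h
      have heq : p = c O hO := hpm.eq_of_le (hcp O hO).ne_top h
      refine hOP (le_antisymm ?_ ?_)
      · exact valuationSubring_le_of_forall_iff O P hP p hp0 (fun b ↦ heq ▸ hc O hO b) (hc P hP)
      · exact valuationSubring_le_of_forall_iff P O hO p hp0 (hc P hP) (fun b ↦ heq ▸ hc O hO b)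
    have hne' : ¬ p ^ multiplicity p (Ideal.span {g}) ≤ c O hO := fun h ↦
      hne (Ideal.IsPrime.le_of_pow_le h)
    obtain ⟨y, hyp, hyO⟩ := SetLike.not_le_iff_exists.mp hne'
    have hmem : y * d ∈ Ideal.span {g} := hJ ▸ Ideal.mul_mem_mul hyp hdJ
    obtain ⟨z, hz⟩ := Ideal.mem_span_singleton'.mp hmem
    have hy : O.valuation (algebraMap B F y) = 1 :=
      le_antisymm ((O.valuation_le_one_iff _).mpr (hO y)) (not_lt.mp (mt (hc O hO y).mpr hyO))
    have hyF : algebraMap B F y ≠ 0 := fun h ↦ by simp [h] at hy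
    have : algebraMap B F d / algebraMap B F g = algebraMap B F z / algebraMap B F y := by
      rw [div_eq_div_iff hgF hyF, ← map_mul, ← map_mul, hz, mul_comm]
    rw [this, ← O.valuation_le_one_iff, map_div₀, hy, div_one]
    exact (O.valuation_le_one_iff _).mpr (hO z)

/-- A polynomial in `s` of positive degree, divided by its leading coefficient, exhibits `s` as
integral over `P`. So a polynomial in `s` keeps a pole wherever `s` has one. -/
theorem mem_valuationSubring_of_aeval (P : ValuationSubring F) (hP : ∀ a : K, algebraMap K F a ∈ P)
    {s : F} {q : K[X]} (hq : q.natDegree ≠ 0) (h : aeval s q ∈ P) : s ∈ P := by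
  have hq0 : q ≠ 0 := fun h ↦ hq (by simp [h])
  let : Algebra K P := ((algebraMap K F).codRestrict P.toSubring hP).toAlgebra
  have : IsScalarTower K P F := .of_algebraMap_eq fun _ ↦ rfl
  have hm : (q * C q.leadingCoeff⁻¹).Monic := monic_mul_leadingCoeff_inv hq0
  have hint : IsIntegral P s := by
    refine IsIntegral.of_aeval_monic (p := (q * C q.leadingCoeff⁻¹).map (algebraMap K P)) (hm.map _)
      ?_ ?_
    · rw [hm.natDegree_map, natDegree_mul_C (by simpa using hq0)]
      exact hq
    · rw [aeval_map_algebraMap, map_mul, aeval_C]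
      exact isIntegral_algebraMap (R := P) (A := F) (x := ⟨_, P.mul_mem _ _ h (hP _)⟩)
  obtain ⟨y, hy⟩ := IsIntegrallyClosed.isIntegral_iff.mp hint
  rw [← hy]
  exact y.2

/-- A spanning result: `B` is generated over `K[g]` by finitely many elements `a`, with
`a / g ^ n ∈ A` for large `n`. Then `B[1/g]` is finite-dimensional modulo `A + B`. -/
theorem exists_finiteDimensional_sup {g : F} (hg : g ≠ 0) (B A : Submodule K F) (s : Set F)
    (hs : s.Finite) (hsB : s ⊆ B) (hB : ∀ b ∈ B, b ∈ Submodule.span (Algebra.adjoin K {g}) s)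
    (hgB : ∀ b ∈ B, g * b ∈ B) (hA : ∀ a ∈ s, ∃ N : ℕ, ∀ n, N ≤ n → g⁻¹ ^ n * a ∈ A) :
    ∃ W : Submodule K F, FiniteDimensional K W ∧ ∀ b ∈ B, ∀ n : ℕ, g⁻¹ ^ n * b ∈ W ⊔ (B ⊔ A) := by
  choose! N hN using hA
  -- Only the finitely many products `g⁻¹ ^ k * a` with `k < N a` can fail to lie in `A`; positive
  -- powers of `g` times `a` are in `B`.
  let w : Set F := ⋃ a ∈ s, (fun k ↦ g⁻¹ ^ k * a) '' Set.Iio (N a)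
  refine ⟨Submodule.span K w, FiniteDimensional.span_of_finite K
    (hs.biUnion fun a _ ↦ (Set.finite_Iio _).image _), ?_⟩
  set T := Submodule.span K w ⊔ (B ⊔ A) with hT
  have h0 : B ≤ T := le_sup_left.trans le_sup_right
  have h1 : A ≤ T := le_sup_right.trans le_sup_right
  have hgB' : ∀ n : ℕ, ∀ b ∈ B, g ^ n * b ∈ B := by
    intro n b hb
    induction n with
    | zero => simpa
    | succ n ih => rw [pow_succ', mul_assoc]; exact hgB _ ih
  suffices ∀ x ∈ Submodule.span (Algebra.adjoin K {g}) s, x ∈ B ∧ ∀ n : ℕ, g⁻¹ ^ n * x ∈ T from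
    fun b hb ↦ (this b (hB b hb)).2
  intro x hx
  induction hx using Submodule.span_induction with
  | mem a ha =>
    refine ⟨hsB ha, fun n ↦ ?_⟩
    by_cases hn : n < N a
    · exact (le_sup_left : _ ≤ T) (Submodule.subset_span
        (Set.mem_biUnion ha (Set.mem_image_of_mem _ hn)))
    · exact h1 (hN a ha n (not_lt.mp hn))
  | zero => simp
  | add x y _ _ hx hy =>
    refine ⟨B.add_mem hx.1 hy.1, fun n ↦ ?_⟩
    rw [mul_add]
    exact T.add_mem (hx.2 n) (hy.2 n)
  | smul c x _ hx =>
    obtain ⟨p, hp⟩ := (Algebra.adjoin_singleton_eq_range_aeval K g).le c.2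
    have hc : c • x = ∑ i ∈ Finset.range (p.natDegree + 1), p.coeff i • (g ^ i * x) := by
      have h2 : c • x = aeval g p * x := by
        rw [show aeval g p = (c : F) from hp]; rfl
      rw [h2, aeval_eq_sum_range, Finset.sum_mul]
      exact Finset.sum_congr rfl fun i _ ↦ smul_mul_assoc _ _ _
    rw [hc]
    refine ⟨B.sum_mem fun i _ ↦ B.smul_mem _ (hgB' i x hx.1), fun n ↦ ?_⟩
    rw [Finset.mul_sum]
    refine T.sum_mem fun i _ ↦ ?_
    rw [mul_smul_comm, ← mul_assoc]
    refine T.smul_mem _ ?_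
    by_cases hi : i ≤ n
    · have : g⁻¹ ^ n * g ^ i = g⁻¹ ^ (n - i) := by
        rw [inv_pow, inv_pow, pow_sub₀ g hg hi, mul_inv, inv_inv]
      rw [this]
      exact hx.2 _
    · have : g⁻¹ ^ n * g ^ i = g ^ (i - n) := by
        rw [pow_sub₀ g hg (not_le.mp hi).le, inv_pow, mul_comm]
      rw [this]
      exact h0 (hgB' _ x hx.1)

/-- The transcendence degree is at most one, so a single transcendental element is already a
transcendence basis. -/
theorem isAlgebraic_adjoin_of_transcendental {t : F}
    (ht : Algebra.IsAlgebraic (Algebra.adjoin K {t}) F) {g : F} (hg : Transcendental K g) :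
    Algebra.IsAlgebraic (Algebra.adjoin K {g}) F := by
  have hi : AlgebraicIndependent K (fun _ : Unit ↦ g) :=
    (algebraicIndependent_singleton_iff ()).mpr hg
  have hle : Algebra.trdeg K F ≤ 1 := by
    simpa using Algebra.IsAlgebraic.trdeg_le_cardinalMk K {t} (alg := ht)
  have hb : IsTranscendenceBasis K (fun _ : Unit ↦ g) :=
    hi.isTranscendenceBasis_of_lift_trdeg_le_of_finite (by simpa using hle)
  have := hb.isAlgebraic
  rwa [Set.range_const] at this

/-- In a function field in one variable there is a function whose only pole is a given place. -/
theorem exists_notMem_forall_mem [CharZero K] [Algebra.EssFiniteType K F] {t : F}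
    (ht : Algebra.IsAlgebraic (Algebra.adjoin K {t}) F)
    (P : ValuationSubring F) (hP : ∀ a : K, algebraMap K F a ∈ P) (hPtop : P ≠ ⊤) :
    ∃ h ∉ P, ∀ O : ValuationSubring F, (∀ a : K, algebraMap K F a ∈ O) → O ≠ P → h ∈ O := by
  obtain ⟨y, hy⟩ : ∃ y, y ∉ P := by
    by_contra! h
    exact hPtop (eq_top_iff.mpr fun x _ ↦ h x)
  have hy0 : y ≠ 0 := fun h ↦ hy (h ▸ P.zero_mem)
  -- `g` vanishes at the place `P`. The places split into those where `g` is finite, which contain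
  -- the integral closure `B` of `K[g]`, and those where `g⁻¹` is finite, which contain the integral
  -- closure of `K[g⁻¹]`.
  let g := y⁻¹
  have hg0 : g ≠ 0 := inv_ne_zero hy0
  have hgv : P.valuation g < 1 := by
    rw [map_inv₀]
    have : 1 < P.valuation y := not_le.mp (mt (P.valuation_le_one_iff y).mp hy)
    exact inv_lt_one_of_one_lt₀ this
  have hgP : g ∈ P := (P.valuation_le_one_iff g).mp hgv.le
  have hgt : Transcendental K g := fun h ↦ hy <| by
    have := mem_valuationSubring_of_isAlgebraic P hP (h.inv)
    rwa [inv_inv] at this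
  have halg := isAlgebraic_adjoin_of_transcendental ht hgt
  obtain ⟨hded, hfin, hfrac⟩ := exists_dedekind hgt
  let B := integralClosure (Algebra.adjoin K {g}) F
  have hBO (O : ValuationSubring F) (hO : ∀ a : K, algebraMap K F a ∈ O) (hg : g ∈ O) (b : B) :
      algebraMap B F b ∈ O := mem_valuationSubring_of_isIntegral O hO hg b.2
  let gB : B := ⟨g, isIntegral_algebraMap
    (x := (⟨g, Algebra.self_mem_adjoin_singleton K g⟩ : Algebra.adjoin K {g}))⟩
  obtain ⟨d, hdP, hdO⟩ := exists_mul_mem_of_dedekind (F := F) P (hBO P hP hgP) gB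
    (fun h ↦ hg0 (congrArg Subtype.val h)) hgv
  -- Among the places where `g` is finite, `s` has a pole at `P` only; it may have further poles
  -- where `g` is infinite. Its powers lie in `B[1/g]`.
  set s : F := algebraMap B F d / algebraMap B F gB with hs
  have hsg : ∀ n, s ^ n = g⁻¹ ^ n * ((d ^ n : B) : F) := fun n ↦ by
    rw [hs, div_pow, div_eq_mul_inv, mul_comm, inv_pow]
    rfl
  let B' : Submodule K F := B.toSubmodule.restrictScalars K
  let A' : Submodule K F :=
    (integralClosure (Algebra.adjoin K {g⁻¹}) F).toSubmodule.restrictScalars K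
  obtain ⟨t, ht⟩ := hfin
  obtain ⟨W, hWfin, hW⟩ := exists_finiteDimensional_sup (K := K) hg0 B' A'
    (Subtype.val '' (t : Set B)) (t.finite_toSet.image _)
    (by rintro _ ⟨b, -, rfl⟩; exact b.2)
    (fun b hb ↦ by
      have h : Submodule.span (Algebra.adjoin K {g}) (Subtype.val '' (t : Set B)) =
          (⊤ : Submodule (Algebra.adjoin K {g}) B).map B.val.toLinearMap := by
        rw [← ht, Submodule.map_span]; rfl
      rw [h]
      exact ⟨⟨b, hb⟩, trivial, rfl⟩)
    (fun b hb ↦ B.mul_mem gB.2 hb)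
    (by
      rintro _ ⟨b, -, rfl⟩
      obtain ⟨N, hN⟩ := exists_isIntegral_inv hg0 b.2
      exact ⟨N, fun n hn ↦ by rw [mul_comm]; exact hN n hn⟩)
  set T := B' ⊔ A' with hT
  -- `B[1/g]` modulo `B' + A'` is finite-dimensional, which is the finiteness of the first
  -- cohomology of the structure sheaf. So a nonzero polynomial multiple of `X`, hence a nonconstant
  -- polynomial, takes `s` into `B' + A'`.
  obtain ⟨q, hq, hqs⟩ : ∃ q : K[X], q.natDegree ≠ 0 ∧ aeval s q ∈ T := by
    let ℓ : K[X] →ₗ[K] F ⧸ T := T.mkQ ∘ₗ (aeval s).toLinearMap ∘ₗ LinearMap.mulLeft K X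
    have hℓ : ∀ q, ℓ q ∈ W.map T.mkQ := by
      intro q
      have : aeval s (X * q) ∈ W ⊔ T := by
        rw [aeval_eq_sum_range]
        refine sum_mem fun i _ ↦ Submodule.smul_mem _ _ ?_
        rw [hsg]
        exact hW _ (d ^ i : B).2 i
      obtain ⟨w, hw, t, ht, h⟩ := Submodule.mem_sup.mp this
      refine ⟨w, hw, ?_⟩
      change T.mkQ w = T.mkQ (aeval s (X * q))
      rw [← h, map_add, (Submodule.Quotient.mk_eq_zero T (x := t)).mpr ht |> (fun h ↦ (h : T.mkQ t = 0)),
        add_zero]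
    have hni : ¬ Function.Injective (ℓ.codRestrict _ hℓ) := fun hinj ↦
      Polynomial.not_finite (R := K) (Module.Finite.of_injective _ hinj)
    rw [← LinearMap.ker_eq_bot, Submodule.eq_bot_iff] at hni
    push Not at hni
    obtain ⟨q, hq, hq0⟩ := hni
    refine ⟨X * q, ?_, ?_⟩
    · rw [natDegree_X_mul hq0]; omega
    · have : ℓ q = 0 := congrArg Subtype.val (LinearMap.mem_ker.mp hq)
      exact (Submodule.Quotient.mk_eq_zero T).mp this
  -- `α₁` is the required function: it is integral over `K[g⁻¹]`, so finite where `g⁻¹` is, and it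
  -- differs from the polynomial in `s` by `α₀`, which is finite where `g` is.
  obtain ⟨α₀, h₀, α₁, h₁, hα⟩ := Submodule.mem_sup.mp hqs
  refine ⟨α₁, fun hmem ↦ hdP ?_, fun O hO hOP ↦ ?_⟩
  · refine mem_valuationSubring_of_aeval P hP hq ?_
    rw [← hα]
    exact P.add_mem _ _ (hBO P hP hgP ⟨α₀, h₀⟩) hmem
  · rcases O.mem_or_inv_mem g with hgO | hgO
    · rw [eq_sub_of_add_eq' hα]
      exact O.toSubring.sub_mem (aeval_mem_valuationSubring O hO (hdO O (hBO O hO hgO) hOP) q)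
        (hBO O hO hgO ⟨α₀, h₀⟩)
    · exact mem_valuationSubring_of_isIntegral O hO hgO h₁

end FunctionFields

/-! ### Centres of valuation rings of residue fields -/

section ValuativeCriterion

variable {R : CommRingCat.{u}} {X : Scheme.{u}} (g : X ⟶ Spec R)

open IsLocalRing

/-- The valuative criterion, applied to valuation rings of fields over the residue field of a
point. -/
theorem exists_specializes_mem [UniversallyClosed g] (ξ : X) {E : Type u} [Field E]
    (ρ : X.presheaf.stalk ξ →+* E) [IsLocalHom ρ] (V : ValuationSubring E)
    (hV : ∀ r : R, ρ (baseToStalk g ξ r) ∈ V) :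
    ∃ (b : X) (h : ξ ⤳ b), ∀ a : X.presheaf.stalk b, ρ (X.presheaf.stalkSpecializes h a) ∈ V := by
  let ρV : R →+* V := (ρ.comp (baseToStalk g ξ)).codRestrict V.toSubring hV
  have hE : ValuativeCriterion.Existence g := by
    have : UniversallyClosed g := inferInstance
    rw [UniversallyClosed.eq_valuativeCriterion] at this
    exact this.1
  let ι : CommRingCat.of V ⟶ CommRingCat.of E := CommRingCat.ofHom (algebraMap V E)
  let ρ' : X.presheaf.stalk ξ ⟶ CommRingCat.of E := CommRingCat.ofHom ρ
  let i₁ : Spec (.of E) ⟶ X := Spec.map ρ' ≫ X.fromSpecStalk ξ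
  have hsq : CommSq i₁ (Spec.map ι) g (Spec.map (CommRingCat.ofHom ρV)) := by
    refine ⟨?_⟩
    rw [Category.assoc, fromSpecStalk_comp, ← Spec.map_comp, ← Spec.map_comp]
    rfl
  obtain ⟨⟨ℓ, hℓ₁, -⟩⟩ := (hE ⟨V, E, _, _, hsq⟩).exists_lift
  replace hℓ₁ : Spec.map ι ≫ ℓ = i₁ := hℓ₁
  change Spec (.of V) ⟶ X at ℓ
  let b := ℓ (closedPoint V)
  have hξ : ℓ (Spec.map ι (closedPoint E)) = ξ := by
    have h1 : i₁ (closedPoint E) = ξ := by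
      have : Spec.map (CommRingCat.ofHom ρ) (closedPoint E) = closedPoint (X.presheaf.stalk ξ) :=
        comap_closedPoint ρ
      exact (congrArg (X.fromSpecStalk ξ) this).trans Scheme.fromSpecStalk_closedPoint
    exact congr($hℓ₁ (closedPoint E)).trans h1
  have h : ξ ⤳ b := by
    rw [← hξ]
    exact (specializes_closedPoint _).map ℓ.continuous
  refine ⟨b, h, fun a ↦ ?_⟩
  have key : X.presheaf.stalkSpecializes h ≫ ρ' =
      Scheme.stalkClosedPointTo (R := .of V) ℓ ≫ ι := by
    apply Spec.map_injective
    rw [← cancel_mono (X.fromSpecStalk b), Spec.map_comp, Spec.map_comp, Category.assoc,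
      Category.assoc, Scheme.SpecMap_stalkSpecializes_fromSpecStalk]
    exact hℓ₁.symm.trans (congrArg (Spec.map ι ≫ ·)
      (Scheme.Spec_stalkClosedPointTo_fromSpecStalk (R := .of V) ℓ).symm)
  have := congr($key a)
  exact Set.mem_of_eq_of_mem (s := V) this (Scheme.stalkClosedPointTo (R := .of V) ℓ a : V).2

end ValuativeCriterion

/-! ### Local rings inside the function field -/

section SubringOfPoint

variable {X : Scheme.{u}} [IsIntegral X]

/-- The local ring at a point, as a subring of the function field. -/
def stalkSubring (x : X) : Subring X.functionField :=
  (algebraMap (X.presheaf.stalk x) X.functionField).range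

theorem algebraMap_stalkSpecializes {x y : X} (h : y ⤳ x) (a : X.presheaf.stalk x) :
    algebraMap _ X.functionField (X.presheaf.stalkSpecializes h a) =
      algebraMap (X.presheaf.stalk x) X.functionField a := by
  change (X.presheaf.stalkSpecializes h ≫ X.presheaf.stalkSpecializes _) a = _
  rw [TopCat.Presheaf.stalkSpecializes_comp]
  rfl

theorem algebraMap_stalk_injective (x : X) :
    Function.Injective (algebraMap (X.presheaf.stalk x) X.functionField) :=
  IsFractionRing.injective _ _

theorem exists_mul_mem_stalkSubring {x y : X} (h : y ⤳ x) {z : X.functionField}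
    (hz : z ∈ stalkSubring y) :
    ∃ c d : X.presheaf.stalk x, IsUnit (X.presheaf.stalkSpecializes h d) ∧
      z * algebraMap _ X.functionField d = algebraMap _ X.functionField c := by
  obtain ⟨w, rfl⟩ := hz
  obtain ⟨c, d, hd, hcd⟩ := exists_stalkSpecializes_mul_eq h w
  refine ⟨c, d, hd, ?_⟩
  rw [← algebraMap_stalkSpecializes h d, ← algebraMap_stalkSpecializes h c, ← map_mul, hcd]

variable {R : CommRingCat.{u}} (g : X ⟶ Spec R)

theorem algebraMap_baseToStalk (x : X) (r : R) :
    algebraMap _ X.functionField (baseToStalk g x r) = baseToStalk g (genericPoint X) r :=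
  stalkSpecializes_baseToStalk g _ r

/-- A function that is regular at all generizations of `b` outside the zero locus of `r` becomes
regular at `b` after multiplication by a power of `r`. -/
theorem exists_pow_mul_mem_stalkSubring (b : X) (r : R) (z : X.functionField)
    (hz : ∀ y, y ⤳ b → r ∉ (g y).asIdeal → z ∈ stalkSubring y) :
    ∃ n : ℕ, baseToStalk g (genericPoint X) r ^ n * z ∈ stalkSubring b := by
  -- The ideal of denominators of `z` at `b`. A prime containing it but not `r` would come from a
  -- generization `y` at which `z` is regular; writing `z` there as a fraction gives a denominator
  -- outside that prime. So `r` is in the radical of `D`.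
  let D : Ideal (X.presheaf.stalk b) :=
    { carrier := {a | algebraMap _ X.functionField a * z ∈ stalkSubring b}
      add_mem' := fun {a a'} ha ha' ↦ by
        rw [Set.mem_ofPred_eq, map_add, add_mul]; exact add_mem ha ha'
      zero_mem' := by simp [zero_mem]
      smul_mem' := fun c a ha ↦ by
        rw [Set.mem_ofPred_eq, smul_eq_mul, map_mul, mul_assoc]
        exact mul_mem ⟨c, rfl⟩ ha }
  suffices baseToStalk g b r ∈ D.radical by
    obtain ⟨n, hn⟩ := this
    refine ⟨n, ?_⟩
    have : algebraMap _ X.functionField (baseToStalk g b r ^ n) * z ∈ stalkSubring b := hn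
    rwa [map_pow, algebraMap_baseToStalk] at this
  rw [Ideal.radical_eq_sInf, Ideal.mem_sInf]
  rintro P ⟨hDP, hP⟩
  by_contra hr
  obtain ⟨y, hy, rfl⟩ := exists_specializes_comap_eq b P
  have hPy : ∀ d : X.presheaf.stalk b, IsUnit (X.presheaf.stalkSpecializes hy d) →
      d ∉ (IsLocalRing.maximalIdeal (X.presheaf.stalk y)).comap
        (X.presheaf.stalkSpecializes hy).hom := fun d hd h ↦ h hd
  have hgy : r ∉ (g y).asIdeal := by
    rw [← comap_maximalIdeal_baseToStalk, Ideal.mem_comap, ← stalkSpecializes_baseToStalk g hy]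
    exact hr
  obtain ⟨c, d, hd, hcd⟩ := exists_mul_mem_stalkSubring hy (hz y hy hgy)
  exact hPy d hd (hDP ⟨c, by rw [← hcd, mul_comm]⟩)

/-- A function regular at `ξ` is regular at `b`, if it is so up to a power of an element that is
prime at `b` and not invertible at `ξ`. -/
theorem mem_stalkSubring_of_pow_mul_mem {ξ b : X} (h : ξ ⤳ b) (r : R) (hr : r ∈ (g ξ).asIdeal)
    (hrb : Prime (baseToStalk g b r)) {z : X.functionField} (hz : z ∈ stalkSubring ξ) {n : ℕ}
    (hn : baseToStalk g (genericPoint X) r ^ n * z ∈ stalkSubring b) : z ∈ stalkSubring b := by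
  obtain ⟨c, d, hd, hcd⟩ := exists_mul_mem_stalkSubring h hz
  obtain ⟨w, hw⟩ := hn
  -- Write `z = c / d` with `d` invertible at `ξ`. Since `r` is not invertible there, it does not
  -- divide `d`, so in `d w = r ^ n c` the prime power `r ^ n` must divide `w`.
  have hrd : ¬ baseToStalk g b r ∣ d := by
    rintro ⟨e, rfl⟩
    rw [map_mul, stalkSpecializes_baseToStalk] at hd
    have h1 := isUnit_of_mul_isUnit_left hd
    rw [← comap_maximalIdeal_baseToStalk] at hr
    exact hr h1
  have hdw : d * w = baseToStalk g b r ^ n * c := by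
    apply algebraMap_stalk_injective b
    rw [map_mul, map_mul, map_pow, algebraMap_baseToStalk, hw, ← hcd]
    ring
  obtain ⟨w', rfl⟩ := hrb.pow_dvd_of_dvd_mul_left n hrd ⟨c, hdw⟩
  refine ⟨w', ?_⟩
  have h0 : baseToStalk g (genericPoint X) r ≠ 0 := by
    rw [← algebraMap_baseToStalk g b, ne_eq, map_eq_zero_iff _ (algebraMap_stalk_injective b)]
    exact hrb.ne_zero
  refine mul_left_cancel₀ (pow_ne_zero n h0) ?_
  rw [← hw, map_mul, map_pow, algebraMap_baseToStalk]

end SubringOfPoint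

/-! ### Points of the generic fibre and the function field -/

section LocalLineAlgebra

open IsLocalRing Polynomial

/-- Over the zero ideal all nonzero elements of `R` are invertible in `O`, so `R` may be replaced by
its fraction field and the case of a field applies. -/
theorem IsLocalLine.isDomain_and_valuationRing_of_comap_eq_bot {R O : Type*} [CommRing R]
    [IsDomain R] [CommRing O] [IsLocalRing O] {ψ : R →+* O} {φ : R[X] →+* O} (h : IsLocalLine ψ φ)
    (hb : (maximalIdeal O).comap ψ = ⊥) : ∃ _ : IsDomain O, ValuationRing O := by
  let K := FractionRing R
  have hu : ∀ y : nonZeroDivisors R, IsUnit (ψ y) := by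
    intro y
    by_contra hy
    have : (y : R) ∈ (maximalIdeal O).comap ψ := hy
    rw [hb] at this
    exact nonZeroDivisors.ne_zero y.2 this
  let ψ' : K →+* O := IsLocalization.lift (M := nonZeroDivisors R) hu
  have hψ' : ψ'.comp (algebraMap R K) = ψ := IsLocalization.lift_comp _
  let φ' : K[X] →+* O := eval₂RingHom ψ' (φ X)
  have hφ' : φ'.comp (mapRingHom (algebraMap R K)) = φ := by
    ext r
    · have : φ (C r) = ψ r := congr($(h.comp_C) r)
      simp only [φ', RingHom.comp_apply, coe_mapRingHom, map_C, coe_eval₂RingHom, eval₂_C, this]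
      exact congr($hψ' r)
    · simp [φ']
  refine IsLocalLine.isDomain_and_valuationRing (ψ := ψ') (φ := φ') ⟨h.noeth, ?_, ?_, ?_⟩
  · ext; simp [φ']
  · let := (mapRingHom (algebraMap R K)).toAlgebra
    let := φ'.toAlgebra
    let := φ.toAlgebra
    have : IsScalarTower R[X] K[X] O := .of_algebraMap_eq' hφ'.symm
    have : IsLocalization ((nonZeroDivisors R).map C) K[X] :=
      Polynomial.isLocalization (nonZeroDivisors R) K
    exact (Module.flat_iff_of_isLocalization K[X] ((nonZeroDivisors R).map C) (M := O)).mpr h.flat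
  · refine le_antisymm (Ideal.map_comap_le) ?_
    conv_lhs => rw [← h.map_comap]
    rw [Ideal.map_le_iff_le_comap]
    intro a ha
    have h1 : φ a = φ' (mapRingHom (algebraMap R K) a) := congr($(hφ'.symm) a)
    rw [Ideal.mem_comap, h1]
    refine Ideal.mem_map_of_mem _ ?_
    rw [Ideal.mem_comap, ← h1]
    exact ha

theorem injective_of_flat {R A : Type*} [CommRing R] [IsDomain R] [CommRing A] [Nontrivial A]
    (f : R →+* A) (hf : f.Flat) : Function.Injective f := by
  algebraize [f]
  rw [injective_iff_map_eq_zero]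
  intro r hr
  by_contra h0
  have : r • (1 : A) = r • 0 := by
    rw [smul_zero, Algebra.smul_def, mul_one]; exact hr
  exact one_ne_zero ((IsRegular.of_ne_zero h0).isSMulRegular this)

/-- The function field of an étale scheme over the affine line is algebraic over the rational
function field. -/
theorem isAlgebraic_of_etale {R A F : Type u} [CommRing R] [IsDomain R] [CommRing A] [Field F]
    (M : Submonoid A) [Algebra A F] [IsLocalization M F] (φ : R[X] →+* A) (hφ : φ.Etale)
    (K : Type u) [Field K] [Algebra R K] [IsFractionRing R K] [Algebra K F]
    (hK : (algebraMap K F).comp (algebraMap R K) = (algebraMap A F).comp (φ.comp C)) :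
    Algebra.EssFiniteType K F ∧
      ∃ t : F, Algebra.IsAlgebraic (Algebra.adjoin K {t}) F := by
  algebraize [φ, (algebraMap A F).comp φ, (algebraMap A F).comp (φ.comp C)]
  have : IsScalarTower R[X] A F := .of_algebraMap_eq' rfl
  have : IsScalarTower R R[X] F := .of_algebraMap_eq' rfl
  have : IsScalarTower R K F := .of_algebraMap_eq' hK.symm
  have : Algebra.EssFiniteType A F := .of_isLocalization F M
  have : Algebra.EssFiniteType R[X] F := .comp R[X] A F
  have : Algebra.EssFiniteType R F := .comp R R[X] F
  have hEK : Algebra.EssFiniteType K F := .of_comp R K F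
  have : Algebra.FormallyEtale A F := .of_isLocalization M
  have : Algebra.FormallyEtale R[X] F := .comp R[X] A F
  have : Module.Flat A F := IsLocalization.flat F M
  have hflat : Module.Flat R[X] F := .trans R[X] A F
  have hinj : Function.Injective (algebraMap R[X] F) := injective_of_flat _ hflat
  have : FaithfulSMul R[X] F := (faithfulSMul_iff_algebraMap_injective _ _).mpr hinj
  -- Over the field `L` the extension `F` is unramified and essentially of finite type, hence
  -- separable algebraic.
  let L := FractionRing R[X]
  let := FractionRing.liftAlgebra R[X] F
  have := FractionRing.isScalarTower_liftAlgebra R[X] F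
  have : Algebra.FormallyUnramified L F := .of_restrictScalars R[X] L F
  have : Algebra.EssFiniteType L F := .of_comp R[X] L F
  have : Algebra.IsSeparable L F := Algebra.FormallyUnramified.isSeparable L F
  have : Algebra.IsAlgebraic L F := inferInstance
  have hRX : Algebra.IsAlgebraic R[X] F := (IsFractionRing.comap_isAlgebraic_iff (K := L)).mpr this
  refine ⟨hEK, algebraMap R[X] F X, ?_⟩
  let ρ : R[X] →+* Algebra.adjoin K {algebraMap R[X] F X} :=
    (algebraMap R[X] F).codRestrict (Algebra.adjoin K {algebraMap R[X] F X}).toSubring (by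
      intro p
      induction p using Polynomial.induction_on' with
      | add p q hp hq => rw [map_add]; exact add_mem hp hq
      | monomial n a =>
        rw [← C_mul_X_pow_eq_monomial, map_mul, map_pow]
        refine mul_mem ?_ (pow_mem (Algebra.self_mem_adjoin_singleton K _) n)
        rw [show algebraMap R[X] F (C a) = algebraMap K F (algebraMap R K a) from congr($(hK.symm) a)]
        exact Subalgebra.algebraMap_mem _ _)
  let := ρ.toAlgebra
  have : IsScalarTower R[X] (Algebra.adjoin K {algebraMap R[X] F X}) F := .of_algebraMap_eq' rfl
  exact Algebra.IsAlgebraic.extendScalars (R := R[X]) (fun a b h ↦ hinj congr(Subtype.val $h))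

end LocalLineAlgebra

/-! ### Algebraicity of residue fields -/

section Residues

open IsLocalRing Polynomial

theorem exists_eq_unit_mul_zpow {O F : Type*} [CommRing O] [IsDomain O] [IsLocalRing O]
    [IsNoetherianRing O] [Field F] [Algebra O F] [IsFractionRing O F] {t : O} (ht0 : t ≠ 0)
    (ht : maximalIdeal O = Ideal.span {t}) {z : F} (hz : z ≠ 0) :
    ∃ (m : ℤ) (v : Oˣ), z = algebraMap O F v * algebraMap O F t ^ m := by
  obtain ⟨a, b, hb, rfl⟩ := IsFractionRing.div_surjective (A := O) z
  have ha0 : a ≠ 0 := by rintro rfl; simp at hz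
  obtain ⟨n, v, hv, rfl⟩ := exists_eq_unit_mul_pow ht ha0
  obtain ⟨m, w, hw, rfl⟩ := exists_eq_unit_mul_pow ht (nonZeroDivisors.ne_zero hb)
  obtain ⟨v, rfl⟩ := hv
  obtain ⟨w, rfl⟩ := hw
  have ht' : algebraMap O F t ≠ 0 := by simpa using ht0
  refine ⟨n - m, v * w⁻¹, ?_⟩
  have hw' : algebraMap O F w ≠ 0 := by simp
  have hww : algebraMap O F w * algebraMap O F (w⁻¹ : Oˣ) = 1 := by
    rw [← map_mul, Units.mul_inv, map_one]
  rw [zpow_sub₀ ht', zpow_natCast, zpow_natCast, map_mul, map_mul, map_pow, map_pow, Units.val_mul,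
    map_mul]
  field_simp
  linear_combination -hww

/-- If the residues of the elements of `O ∩ S` are algebraic over `k`, and `F = Frac O` is algebraic
over the subring `S`, then the residue field of `O` is algebraic over `k`. -/
theorem isAlgebraic_residue {O F k : Type*} [CommRing O] [IsDomain O] [IsLocalRing O]
    [IsNoetherianRing O] [Field F] [Algebra O F] [IsFractionRing O F] [Field k]
    [Algebra k (ResidueField O)] {t : O} (ht0 : t ≠ 0)
    (ht : maximalIdeal O = Ideal.span {t}) (S : Subring F) (htS : algebraMap O F t ∈ S)
    (htS' : (algebraMap O F t)⁻¹ ∈ S) [Algebra.IsAlgebraic S F]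
    (hS : ∀ a : O, algebraMap O F a ∈ S → IsAlgebraic k (residue O a)) (x : O) :
    IsAlgebraic k (residue O x) := by
  have hVR : ValuationRing O := valuationRing_of_maximalIdeal_eq_span ht
  obtain ⟨p, hp0, hp⟩ := Algebra.IsAlgebraic.isAlgebraic (R := S) (algebraMap O F x)
  let v := ValuationRing.valuation O F
  -- As in Gauss's lemma: scale the equation of `x` by the power of `t` matching the coefficient of
  -- largest valuation. The new coefficients lie in `O`, still in `S` because `t` and its inverse
  -- do, and one is a unit, so the reduced equation is nontrivial.
  obtain ⟨j, hj, hmax⟩ := Finset.exists_max_image p.support (fun i ↦ v (p.coeff i))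
    (by simpa using hp0)
  have hj0 : (p.coeff j : F) ≠ 0 := by simpa using hj
  obtain ⟨m, w, hw⟩ := exists_eq_unit_mul_zpow ht0 ht hj0
  have ht' : algebraMap O F t ≠ 0 := by simpa using ht0
  have hzS : ∀ m : ℤ, algebraMap O F t ^ m ∈ S := by
    intro m
    obtain ⟨n, rfl | rfl⟩ := m.eq_nat_or_neg
    · rw [zpow_natCast]; exact pow_mem htS n
    · rw [zpow_neg, zpow_natCast, ← inv_pow]; exact pow_mem htS' n
  have hO : ∀ i, ∃ a : O, algebraMap O F a = p.coeff i * algebraMap O F t ^ (-m) := by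
    intro i
    by_cases hi : i ∈ p.support
    · have h1 := hmax i hi
      have h2 : v (p.coeff i / p.coeff j) ≤ 1 := by
        rw [map_div₀]
        exact div_le_one_of_le₀ h1 zero_le
      obtain ⟨a, ha⟩ := (ValuationRing.mem_integer_iff O F _).mp h2
      refine ⟨a * w, ?_⟩
      rw [map_mul, ha, hw]
      have : algebraMap O F w ≠ 0 := by simp
      rw [zpow_neg]
      field_simp
    · refine ⟨0, ?_⟩
      have : p.coeff i = 0 := by simpa using hi
      simp [this]
  choose a ha using hO
  have haj : a j = w := by
    apply IsFractionRing.injective O F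
    rw [ha, hw, zpow_neg, mul_inv_cancel_right₀ (zpow_ne_zero _ ht')]
  have haS : ∀ i, IsAlgebraic k (residue O (a i)) := fun i ↦ hS _ (by
    rw [ha]; exact mul_mem (p.coeff i).2 (hzS _))
  have hsum : ∑ i ∈ Finset.range (p.natDegree + 1), a i * x ^ i = 0 := by
    apply IsFractionRing.injective O F
    have : algebraMap O F (∑ i ∈ Finset.range (p.natDegree + 1), a i * x ^ i) =
        aeval (algebraMap O F x) p * algebraMap O F t ^ (-m) := by
      rw [aeval_eq_sum_range, map_sum, Finset.sum_mul]
      refine Finset.sum_congr rfl fun i _ ↦ ?_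
      rw [map_mul, ha, map_pow, Subring.smul_def, smul_eq_mul]
      ring
    rw [this, hp, zero_mul, map_zero]
  let κ := ResidueField O
  let A := algebraicClosure k κ
  have hA : ∀ i, residue O (a i) ∈ A := fun i ↦ mem_algebraicClosure_iff.mpr (haS i)
  let P : A[X] := ∑ i ∈ Finset.range (p.natDegree + 1), C ⟨residue O (a i), hA i⟩ * X ^ i
  have hPj : P.coeff j = ⟨residue O (a j), hA j⟩ := by
    have hjr : j ∈ Finset.range (p.natDegree + 1) := by
      rw [Finset.mem_range, Nat.lt_succ_iff]
      exact le_natDegree_of_mem_supp _ hj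
    simp only [P, finsetSum_coeff, coeff_C_mul, coeff_X_pow, mul_ite, mul_one, mul_zero]
    rw [Finset.sum_ite_eq, if_pos hjr]
  have hP0 : P ≠ 0 := by
    intro h
    rw [h, coeff_zero] at hPj
    have : residue O (a j) = 0 := congrArg Subtype.val hPj.symm
    rw [haj, residue_eq_zero_iff] at this
    exact this w.isUnit
  have hx : IsAlgebraic A (residue O x) := by
    refine ⟨P, hP0, ?_⟩
    simp only [P, map_sum, map_mul, aeval_C, map_pow, aeval_X]
    have := congrArg (residue O) hsum
    rw [map_sum, map_zero] at this
    simp only [map_mul, map_pow] at this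
    exact this
  exact hx.restrictScalars k

/-- An element of an extension field that belongs to all valuation rings over the base field is
algebraic. -/
theorem isAlgebraic_of_forall_mem_valuationSubring {k E : Type*} [Field k] [Field E] [Algebra k E]
    {x : E} (h : ∀ V : ValuationSubring E, (∀ a : k, algebraMap k E a ∈ V) → x ∈ V) :
    IsAlgebraic k x := by
  by_contra hx
  -- The integral closure of `k` in `E` is the intersection of the valuation rings containing it.
  have hint : x ∉ (integralClosure k E).toSubring := fun h' ↦ hx (IsIntegral.isAlgebraic h')
  have : IsIntegrallyClosedIn (integralClosure k E).toSubring E :=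
    inferInstanceAs (IsIntegrallyClosedIn (integralClosure k E) E)
  obtain ⟨V, hV, hxV⟩ := Subring.exists_le_valuationSubring_of_isIntegrallyClosedIn hint
  exact hxV (h V fun a ↦ hV (Subalgebra.algebraMap_mem _ a))

end Residues

/-! ### Special fibres of smooth curves over a discrete valuation ring -/

section Sections

open IsLocalRing Polynomial

/-- Points of a separated scheme are determined by their local rings, if these are valuation
rings. -/
theorem eq_of_stalkSubring_eq {R : CommRingCat.{u}} {X : Scheme.{u}} [IsIntegral X] (g : X ⟶ Spec R)
    [IsSeparated g] (V : ValuationSubring X.functionField) {x y : X}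
    (hx : stalkSubring x = V.toSubring) (hy : stalkSubring y = V.toSubring) : x = y := by
  let ι : CommRingCat.of V ⟶ X.functionField := CommRingCat.ofHom (algebraMap V X.functionField)
  let ρ (z : X) (hz : stalkSubring z = V.toSubring) : X.presheaf.stalk z ⟶ CommRingCat.of V :=
    CommRingCat.ofHom ((algebraMap (X.presheaf.stalk z) X.functionField).codRestrict V.toSubring
      fun a ↦ hz ▸ ⟨a, rfl⟩)
  let ℓ (z : X) (hz : stalkSubring z = V.toSubring) : Spec (.of V) ⟶ X :=
    Spec.map (ρ z hz) ≫ X.fromSpecStalk z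
  have hρι (z : X) (hz : stalkSubring z = V.toSubring) : ρ z hz ≫ ι =
      X.presheaf.stalkSpecializes ((genericPoint_spec X).specializes trivial) := rfl
  have hℓ₁ (z : X) (hz : stalkSubring z = V.toSubring) :
      Spec.map ι ≫ ℓ z hz = X.fromSpecStalk (genericPoint X) := by
    rw [← Category.assoc, ← Spec.map_comp, hρι z hz, Scheme.SpecMap_stalkSpecializes_fromSpecStalk]
  have hℓ₂ : ℓ x hx ≫ g = ℓ y hy ≫ g := by
    simp only [ℓ, Category.assoc, fromSpecStalk_comp]
    rw [← Spec.map_comp, ← Spec.map_comp]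
    congr 1
    ext r
    exact (algebraMap_baseToStalk g x r).trans (algebraMap_baseToStalk g y r).symm
  -- Both points give lifts of the same valuative square; separatedness makes the lifts equal, and
  -- the closed point of the lift recovers the point.
  have hsq : CommSq (X.fromSpecStalk (genericPoint X)) (Spec.map ι) g (ℓ x hx ≫ g) :=
    ⟨by rw [← Category.assoc, hℓ₁ x hx]⟩
  have hsub := IsSeparated.valuativeCriterion g ⟨V, X.functionField, _, _, hsq⟩
  have heq : ℓ x hx = ℓ y hy := congrArg CommSq.LiftStruct.l
    (hsub.elim ⟨ℓ x hx, hℓ₁ x hx, rfl⟩ ⟨ℓ y hy, hℓ₁ y hy, hℓ₂.symm⟩)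
  have hcl (z : X) (hz : stalkSubring z = V.toSubring) : ℓ z hz (closedPoint V) = z := by
    have hsurj : Function.Surjective (ρ z hz) := fun v ↦ by
      have hv : (v : X.functionField) ∈ stalkSubring z := hz ▸ v.2
      obtain ⟨a, ha⟩ := hv
      exact ⟨a, Subtype.ext ha⟩
    have hloc : IsLocalHom (ρ z hz).hom := .of_surjective _ hsurj
    have : Spec.map (ρ z hz) (closedPoint V) = closedPoint (X.presheaf.stalk z) :=
      comap_closedPoint (ρ z hz).hom
    exact (congrArg (X.fromSpecStalk z) this).trans Scheme.fromSpecStalk_closedPoint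
  rw [← hcl x hx, ← hcl y hy, heq]

/-- A section of a separated morphism to the spectrum of a discrete valuation ring: the
specializations of its generic point. -/
theorem eq_section_of_specializes {R : Type u} [CommRing R] [IsDomain R]
    [IsDiscreteValuationRing R] {X : Scheme.{u}} (g : X ⟶ Spec (.of R)) [IsSeparated g]
    (σ : Spec (.of R) ⟶ X) (hσ : σ ≫ g = 𝟙 _) (s : Spec (.of R)) {b : X} (h : σ s ⤳ b) :
    b = σ (g b) := by
  have : IsClosedImmersion σ := by
    have : IsClosedImmersion (σ ≫ g) := by rw [hσ]; infer_instance
    exact .of_comp σ g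
  have hb : b ∈ Set.range σ := h.mem_closed σ.isClosedEmbedding.isClosed_range ⟨s, rfl⟩
  obtain ⟨t, rfl⟩ := hb
  exact congrArg σ congr($hσ t).symm

/-- The smooth locus over the generic point: the local rings are valuation rings. -/
theorem exists_valuationSubring {R : Type u} [CommRing R] [IsDomain R] [IsNoetherianRing R]
    {X : Scheme.{u}} [IsIntegral X] (g : X ⟶ Spec (.of R)) [SmoothOfRelativeDimension 1 g]
    {K : Type u} [Field K] [Algebra R K] [IsFractionRing R K] [Algebra K X.functionField]
    (hK : ∀ r, algebraMap K X.functionField (algebraMap R K r) = baseToStalk g (genericPoint X) r)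
    (x : X) (hx : (g x).asIdeal = ⊥) :
    ∃ V : ValuationSubring X.functionField, stalkSubring x = V.toSubring ∧
      ∀ a : K, algebraMap K X.functionField a ∈ V := by
  obtain ⟨φ, hφ⟩ := exists_isLocalLine g x
  have hb := comap_maximalIdeal_baseToStalk g x
  rw [hx] at hb
  obtain ⟨hdom, hVR⟩ := hφ.isDomain_and_valuationRing_of_comap_eq_bot hb
  have hint : ∀ z : X.functionField, IsLocalization.IsInteger (X.presheaf.stalk x) z ∨
      IsLocalization.IsInteger (X.presheaf.stalk x) z⁻¹ :=
    have := hVR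
    fun z ↦ ValuationRing.isInteger_or_isInteger (X.presheaf.stalk x) z
  let V : ValuationSubring X.functionField := ⟨stalkSubring x, fun z ↦ by
    rcases hint z with h | h
    · exact .inl h
    · exact .inr h⟩
  refine ⟨V, rfl, fun a ↦ ?_⟩
  obtain ⟨r, s, hs, rfl⟩ := IsFractionRing.div_surjective (A := R) a
  have hsu : IsUnit (baseToStalk g x s) := by
    by_contra h
    have : s ∈ (maximalIdeal (X.presheaf.stalk x)).comap (baseToStalk g x) := h
    rw [hb] at this
    exact nonZeroDivisors.ne_zero hs this
  obtain ⟨w, hw⟩ := hsu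
  refine ⟨baseToStalk g x r * (w⁻¹ : _ˣ), ?_⟩
  rw [map_div₀, hK, hK, map_mul, algebraMap_baseToStalk, ← algebraMap_baseToStalk g x s, ← hw,
    div_eq_mul_inv]
  congr 1
  refine eq_inv_of_mul_eq_one_left ?_
  rw [← map_mul, Units.inv_mul, map_one]

/-- The maximal ideal of the local ring at a maximal point of a special fibre. -/
theorem maximalIdeal_stalk_eq_map {R : CommRingCat.{u}} {X : Scheme.{u}} (g : X ⟶ Spec R) {x : X}
    {φ : Polynomial R →+* X.presheaf.stalk x} (hφ : IsLocalLine (baseToStalk g x) φ) (q : Ideal R)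
    [q.IsMaximal] (hq : (maximalIdeal (X.presheaf.stalk x)).comap (baseToStalk g x) = q)
    (hmax : ∀ y, y ⤳ x → (g y).asIdeal = q → y = x) :
    maximalIdeal (X.presheaf.stalk x) = q.map (baseToStalk g x) := by
  have hp := hφ.isPrime_map q hq
  -- The prime `q 𝒪_x` is a generization of `x` in the same fibre, so by maximality it is `x`
  -- itself.
  obtain ⟨y, hy, hyP⟩ := exists_specializes_comap_eq x (q.map (baseToStalk g x))
  have hgy : (g y).asIdeal = q := by
    refine (Ideal.IsMaximal.eq_of_le ‹_› (g y).2.ne_top fun r hr ↦ ?_).symm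
    rw [← comap_maximalIdeal_baseToStalk, Ideal.mem_comap, ← stalkSpecializes_baseToStalk g hy]
    change baseToStalk g x r ∈ (maximalIdeal (X.presheaf.stalk y)).comap
      (X.presheaf.stalkSpecializes hy).hom
    rw [hyP]
    exact Ideal.mem_map_of_mem _ hr
  obtain rfl := hmax y hy hgy
  rw [← hyP, X.presheaf.stalkSpecializes_refl]
  rfl

/-- Let `X` be an integral, proper and smooth curve over a discrete valuation ring. Each generic
point of the special fibre specializes to the closed point of any section of `X`. -/
theorem specializes_section {R : Type u} [CommRing R] [IsDomain R] [IsDiscreteValuationRing R]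
    [CharZero R] {X : Scheme.{u}} [IsIntegral X] (g : X ⟶ Spec (.of R)) [IsProper g]
    [SmoothOfRelativeDimension 1 g] (σ : Spec (.of R) ⟶ X) (hσ : σ ≫ g = 𝟙 _) (ξ : X)
    (hξ : g ξ = closedPoint R) (hmax : ∀ y, y ⤳ ξ → g y = closedPoint R → y = ξ) :
    ξ ⤳ σ (closedPoint R) := by
  by_contra hspec
  let η : X := genericPoint X
  let K := FractionRing R
  let F : Type u := X.functionField
  have : CharZero K := charZero_of_injective_algebraMap (IsFractionRing.injective R K)
  obtain ⟨φη, hφη⟩ := exists_isLocalLine g η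
  let : Algebra R X.functionField := (baseToStalk g η).toAlgebra
  have hRF : Function.Injective (algebraMap R X.functionField) :=
    injective_of_flat _ hφη.flat_base
  have : FaithfulSMul R X.functionField := (faithfulSMul_iff_algebraMap_injective _ _).mpr hRF
  let : Algebra K X.functionField := FractionRing.liftAlgebra R X.functionField
  have := FractionRing.isScalarTower_liftAlgebra R X.functionField
  have hK : ∀ r, algebraMap K X.functionField (algebraMap R K r) = baseToStalk g η r := fun r ↦
    (IsScalarTower.algebraMap_apply R K X.functionField r).symm
  -- the function field
  obtain ⟨hess, t, ht⟩ : Algebra.EssFiniteType K X.functionField ∧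
      ∃ t : X.functionField, Algebra.IsAlgebraic (Algebra.adjoin K {t}) X.functionField := by
    obtain ⟨V, hV, hx, φ, hφ, h⟩ := exists_etale_polynomial g η
    let := TopCat.Presheaf.algebra_section_stalk X.presheaf ⟨η, hx⟩
    have := hV.isLocalization_stalk ⟨η, hx⟩
    refine isAlgebraic_of_etale (F := X.functionField) (hV.primeIdealOf ⟨η, hx⟩).asIdeal.primeCompl
      φ hφ K ?_
    ext r
    exact (hK r).trans congr($h.symm r)
  -- points of the base
  obtain ⟨π, hπ⟩ := IsDiscreteValuationRing.exists_irreducible R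
  have hm : maximalIdeal R = Ideal.span {π} := hπ.maximalIdeal_eq
  have hcl : ∀ p : Spec (.of R), π ∈ p.asIdeal → p = closedPoint R := by
    intro p hp
    refine PrimeSpectrum.ext ?_
    refine ((maximalIdeal.isMaximal R).eq_of_le p.2.ne_top ?_).symm
    rw [hm, Ideal.span_singleton_le_iff_mem]
    exact hp
  have hbot : ∀ p : Spec (.of R), π ∉ p.asIdeal → p.asIdeal = ⊥ := by
    intro p hp
    by_contra h
    refine hp ?_
    have : p.asIdeal = maximalIdeal R := eq_maximalIdeal (p.2.isMaximal h)
    rw [this, hm]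
    exact Ideal.mem_span_singleton_self π
  have hclm : (closedPoint R).asIdeal = maximalIdeal R := rfl
  have hπξ : π ∈ (g ξ).asIdeal := by
    rw [hξ, hclm, hm]; exact Ideal.mem_span_singleton_self π
  -- the generic point of the section
  let ηR : Spec (.of R) := (⊥ : PrimeSpectrum R)
  let P : X := σ ηR
  have hgσ : ∀ s, g (σ s) = s := fun s ↦ congr($hσ s)
  have hgP : (g P).asIdeal = ⊥ := by rw [hgσ]; rfl
  -- The section is closed, so a common specialization of `P` and `ξ` would be its closed point,
  -- which the closure of `ξ` is assumed to avoid.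
  have hPb : ∀ b, ξ ⤳ b → ¬ P ⤳ b := by
    intro b hb hPb
    have h1 := eq_section_of_specializes g σ hσ ηR hPb
    have h2 : g ξ ⤳ g b := hb.map g.continuous
    have h3 : π ∈ (g b).asIdeal := (PrimeSpectrum.le_iff_specializes _ _).mpr h2 hπξ
    rw [hcl _ h3] at h1
    exact hspec (h1 ▸ hb)
  obtain ⟨VP, hVP, hKP⟩ := exists_valuationSubring g hK P hgP
  -- `P` is not the generic point of `X`, as that would specialize to `ξ`.
  have hVPtop : VP ≠ ⊤ := by
    intro h
    have hη : stalkSubring η = VP.toSubring := by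
      rw [h]
      refine eq_top_iff.mpr fun z _ ↦ ⟨z, ?_⟩
      have h1 := X.presheaf.stalkSpecializes_refl η
      exact congr($h1 z)
    have : P = η := eq_of_stalkSubring_eq g VP hVP hη
    exact hPb ξ specializes_rfl (this ▸ (genericPoint_spec X).specializes trivial)
  obtain ⟨h, hhP, hh⟩ := exists_notMem_forall_mem ht VP hKP hVPtop
  -- functions in `K[h]`
  let S : Subring X.functionField := (Algebra.adjoin K {h}).toSubring
  have hSx : ∀ x : X, x ≠ P → π ∉ (g x).asIdeal → S ≤ stalkSubring x := by
    intro x hxP hx z hz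
    obtain ⟨V, hV, hKV⟩ := exists_valuationSubring g hK x (hbot _ hx)
    have hhV : h ∈ V := hh V hKV fun hVV ↦ hxP (eq_of_stalkSubring_eq g VP (hVV ▸ hV) hVP)
    obtain ⟨q, rfl⟩ := (Algebra.adjoin_singleton_eq_range_aeval K h).le hz
    rw [hV]
    exact aeval_mem_valuationSubring V hKV hhV q
  -- All generizations of `b` in the generic fibre differ from `P`, so `z` is regular there and a
  -- power of `π` makes it regular at `b`. That power can be removed, because `π` is prime at `b`
  -- and `z` is regular at `ξ`.
  have hgood : ∀ b, ξ ⤳ b → ∀ z ∈ S, z ∈ stalkSubring ξ → z ∈ stalkSubring b := by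
    intro b hb z hz hzξ
    obtain ⟨n, hn⟩ := exists_pow_mul_mem_stalkSubring g b π z fun y hy hπy ↦
      hSx y (fun hyP ↦ hPb b hb (hyP ▸ hy)) hπy hz
    refine mem_stalkSubring_of_pow_mul_mem g hb π hπξ ?_ hzξ hn
    obtain ⟨φ, hφ⟩ := exists_isLocalLine g b
    have h2 : g ξ ⤳ g b := hb.map g.continuous
    have h3 : π ∈ (g b).asIdeal := (PrimeSpectrum.le_iff_specializes _ _).mpr h2 hπξ
    have h4 := hφ.isPrime_map (maximalIdeal R) (by
      rw [comap_maximalIdeal_baseToStalk, hcl _ h3]; rfl)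
    rw [hm, Ideal.map_span, Set.image_singleton] at h4
    refine (Ideal.span_singleton_prime ?_).mp h4
    intro h0
    have := algebraMap_baseToStalk g b π
    rw [h0, map_zero] at this
    exact hπ.ne_zero (hRF (this.symm.trans (map_zero _).symm))
  -- the local ring at `ξ`
  obtain ⟨φ, hφ⟩ := exists_isLocalLine g ξ
  have hcomap : (maximalIdeal (X.presheaf.stalk ξ)).comap (baseToStalk g ξ) = maximalIdeal R := by
    rw [comap_maximalIdeal_baseToStalk, hξ]; rfl
  have hmξ := maximalIdeal_stalk_eq_map g hφ (maximalIdeal R) hcomap fun y hy hgy ↦ hmax y hy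
    (PrimeSpectrum.ext hgy)
  have hmξ' : maximalIdeal (X.presheaf.stalk ξ) = Ideal.span {baseToStalk g ξ π} := by
    rw [hmξ, hm, Ideal.map_span, Set.image_singleton]
  have hπ0 : baseToStalk g ξ π ≠ 0 := by
    intro h0
    have := algebraMap_baseToStalk g ξ π
    rw [h0, map_zero] at this
    exact hπ.ne_zero (hRF (this.symm.trans (map_zero _).symm))
  have hlocal : IsLocalHom (baseToStalk g ξ) := ⟨fun a ha ↦ by
    by_contra h'
    have : a ∈ maximalIdeal R := h'
    rw [← hcomap] at this
    exact this ha⟩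
  let k := ResidueField R
  let : Algebra k (ResidueField (X.presheaf.stalk ξ)) :=
    (ResidueField.map (baseToStalk g ξ)).toAlgebra
  obtain ⟨x, hx⟩ := hφ.exists_not_isIntegral (maximalIdeal R) hmξ hcomap
  have hNoeth := hφ.noeth
  have hht : Transcendental K h := fun h' ↦ hhP (mem_valuationSubring_of_isAlgebraic VP hKP h')
  have halg : Algebra.IsAlgebraic S X.functionField := isAlgebraic_adjoin_of_transcendental ht hht
  have hπS : algebraMap K X.functionField (algebraMap R K π) ∈ S :=
    Subalgebra.algebraMap_mem _ _
  have hπS' : (algebraMap K X.functionField (algebraMap R K π))⁻¹ ∈ S := by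
    rw [← map_inv₀]; exact Subalgebra.algebraMap_mem _ _
  rw [hK, ← algebraMap_baseToStalk g ξ] at hπS hπS'
  -- Every valuation ring of the residue field of `ξ` over `k` is centred at some `b` in the closure
  -- of `ξ`. Elements of `S` regular at `ξ` are regular at `b`, so their residues lie in all these
  -- valuation rings and are algebraic over `k`.
  have hxalg : IsAlgebraic k (residue _ x) := by
    refine isAlgebraic_residue (F := X.functionField) hπ0 hmξ' S hπS hπS' (fun a ha ↦ ?_) x
    refine isAlgebraic_of_forall_mem_valuationSubring fun V hV ↦ ?_
    obtain ⟨b, hb, hbV⟩ := exists_specializes_mem g ξ (residue (X.presheaf.stalk ξ)) V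
      (fun r ↦ hV (residue R r))
    obtain ⟨a', ha'⟩ := hgood b hb _ ha ⟨a, rfl⟩
    rw [← algebraMap_stalkSpecializes hb] at ha'
    rw [← algebraMap_stalk_injective ξ ha']
    exact hbV a'
  apply hx
  let : Algebra R (ResidueField (X.presheaf.stalk ξ)) := ((residue _).comp (baseToStalk g ξ)).toAlgebra
  have : IsScalarTower R k (ResidueField (X.presheaf.stalk ξ)) := .of_algebraMap_eq' rfl
  have : Algebra.IsIntegral R k :=
    ⟨fun z ↦ by
      obtain ⟨r, rfl⟩ := residue_surjective z
      exact isIntegral_algebraMap⟩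
  exact isIntegral_trans (R := R) (A := k) _ hxalg.isIntegral

end Sections

/-! ### Connected schemes with integral local rings -/

section Integrality

open IsLocalRing Polynomial

/-- A minimal prime `p` below `(t)` does not contain `t`, so `p = t p`, and Nakayama's lemma gives
`p = 0`. -/
theorem isDomain_of_isPrime_span_singleton {O : Type*} [CommRing O] [IsLocalRing O]
    [IsNoetherianRing O] {t : O} (ht : t ∈ nonZeroDivisors O) (hp : (Ideal.span {t}).IsPrime) :
    IsDomain O := by
  obtain ⟨p, hpm, hpt⟩ := Ideal.exists_minimalPrimes_le (I := (⊥ : Ideal O)) (J := Ideal.span {t})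
    bot_le
  have htp : t ∉ p := fun h ↦ Set.disjoint_left.mp
    (Ideal.disjoint_nonZeroDivisors_of_mem_minimalPrimes hpm) h ht
  have hprime : p.IsPrime := hpm.1.1
  have hle : p ≤ maximalIdeal O • p := by
    intro a ha
    obtain ⟨b, rfl⟩ := Ideal.mem_span_singleton'.mp (hpt ha)
    have hb : b ∈ p := (hprime.mem_or_mem ha).resolve_right htp
    rw [mul_comm]
    refine Submodule.smul_mem_smul ?_ hb
    exact (le_maximalIdeal hp.ne_top) (Ideal.mem_span_singleton_self t)
  have hbot : p = ⊥ := Submodule.eq_bot_of_le_smul_of_le_jacobson_bot _ p (IsNoetherian.noetherian p)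
    hle (by rw [jacobson_eq_maximalIdeal _ bot_ne_top])
  rw [hbot] at hprime
  exact IsDomain.of_bot_isPrime O

theorem map_mem_nonZeroDivisors_of_flat {R O : Type*} [CommRing R] [IsDomain R] [CommRing O]
    (ψ : R →+* O) (hψ : ψ.Flat) {r : R} (hr : r ≠ 0) : ψ r ∈ nonZeroDivisors O := by
  algebraize [ψ]
  have hreg := Module.Flat.isSMulRegular_of_nonZeroDivisors (M := O)
    (mem_nonZeroDivisors_of_ne_zero hr)
  rw [mem_nonZeroDivisors_iff_right]
  intro a ha
  refine hreg ?_
  change r • a = r • (0 : O)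
  rw [smul_zero, Algebra.smul_def, mul_comm]
  exact ha

/-- The zero ideal of the stalk at `x` is a generic point for every component through `x`, so
distinct components are disjoint. There are finitely many, hence each is open and closed. -/
theorem irreducibleSpace_of_isDomain_stalk {X : Scheme.{u}} [ConnectedSpace X]
    [TopologicalSpace.NoetherianSpace X] (hX : ∀ x : X, IsDomain (X.presheaf.stalk x)) :
    IrreducibleSpace X := by
  have key : ∀ Z₁ ∈ irreducibleComponents X, ∀ Z₂ ∈ irreducibleComponents X,
      ∀ x ∈ Z₁, x ∈ Z₂ → Z₁ = Z₂ := by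
    intro Z₁ h₁ Z₂ h₂ x hx₁ hx₂
    have hX := hX x
    let y : X := X.fromSpecStalk x (⊥ : PrimeSpectrum (X.presheaf.stalk x))
    have hy : ∀ z, z ⤳ x → y ⤳ z := by
      intro z hz
      have : z ∈ Set.range (X.fromSpecStalk x) := by rwa [Scheme.range_fromSpecStalk]
      obtain ⟨w, rfl⟩ := this
      refine Specializes.map ?_ (X.fromSpecStalk x).continuous
      exact (PrimeSpectrum.le_iff_specializes _ _).mp bot_le
    have hZ : ∀ Z ∈ irreducibleComponents X, x ∈ Z → Z = closure {y} := by
      intro Z hZ hx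
      obtain ⟨z, hz⟩ := QuasiSober.sober hZ.1 (isClosed_of_mem_irreducibleComponents Z hZ)
      have h1 : y ⤳ z := hy z (hz.specializes hx)
      have h2 : Z ⊆ closure {y} := by
        rw [← hz.def]
        exact h1.closure_subset
      exact (h2.antisymm (hZ.2 isIrreducible_singleton.closure h2))
    rw [hZ Z₁ h₁ hx₁, hZ Z₂ h₂ hx₂]
  obtain ⟨x⟩ := (inferInstance : Nonempty X)
  let Z := irreducibleComponent x
  have hZ : Z ∈ irreducibleComponents X := irreducibleComponent_mem_irreducibleComponents x
  have hclosed : IsClosed Z := isClosed_of_mem_irreducibleComponents Z hZ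
  have hfin := TopologicalSpace.NoetherianSpace.finite_irreducibleComponents (α := X)
  have hopen : IsOpen Z := by
    have : Zᶜ = ⋃ W ∈ irreducibleComponents X \ {Z}, W := by
      ext y
      constructor
      · intro hy
        refine Set.mem_biUnion ⟨irreducibleComponent_mem_irreducibleComponents y, ?_⟩
          mem_irreducibleComponent
        rintro (h : irreducibleComponent y = Z)
        exact hy (h ▸ mem_irreducibleComponent)
      · intro hy hyZ
        obtain ⟨W, ⟨hW, hWZ⟩, hyW⟩ := Set.mem_iUnion₂.mp hy |>.imp fun W h ↦ h
        exact hWZ (key W hW Z hZ y hyW hyZ)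
    rw [← isClosed_compl_iff, this]
    exact (hfin.subset Set.sdiff_subset).isClosed_biUnion fun W hW ↦
      isClosed_of_mem_irreducibleComponents W hW.1
  have huniv : Z = Set.univ := IsClopen.eq_univ ⟨hclosed, hopen⟩ ⟨x, mem_irreducibleComponent⟩
  have : IsIrreducible (Set.univ : Set X) := huniv ▸ hZ.1
  exact (irreducibleSpace_def X).mpr this

/-- A smooth proper curve over a discrete valuation ring with connected generic fibre is
integral. -/
theorem isIntegral_of_isPreconnected {R : Type u} [CommRing R] [IsDomain R]
    [IsDiscreteValuationRing R] {X : Scheme.{u}} [Nonempty X] (g : X ⟶ Spec (.of R)) [IsProper g]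
    [SmoothOfRelativeDimension 1 g]
    (hconn : _root_.IsPreconnected (g ⁻¹' {(⊥ : PrimeSpectrum R)})) : IsIntegral X := by
  have hNoeth : IsNoetherianRing R := inferInstance
  have : IsLocallyNoetherian X := LocallyOfFiniteType.isLocallyNoetherian g
  have : CompactSpace X := QuasiCompact.compactSpace_of_compactSpace g
  have : IsNoetherian X := {}
  obtain ⟨π, hπ⟩ := IsDiscreteValuationRing.exists_irreducible R
  have hm : maximalIdeal R = Ideal.span {π} := hπ.maximalIdeal_eq
  have hdom : ∀ x : X, IsDomain (X.presheaf.stalk x) := by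
    intro x
    obtain ⟨φ, hφ⟩ := exists_isLocalLine g x
    have hc := comap_maximalIdeal_baseToStalk g x
    by_cases hx : (g x).asIdeal = ⊥
    · rw [hx] at hc
      exact (hφ.isDomain_and_valuationRing_of_comap_eq_bot hc).1
    · have hgx : (g x).asIdeal = maximalIdeal R := eq_maximalIdeal ((g x).2.isMaximal hx)
      have h4 := hφ.isPrime_map (maximalIdeal R) (hc.trans hgx)
      rw [hm, Ideal.map_span, Set.image_singleton] at h4
      have := hφ.noeth
      exact isDomain_of_isPrime_span_singleton
        (map_mem_nonZeroDivisors_of_flat _ hφ.flat_base hπ.ne_zero) h4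
  have : ConnectedSpace X := by
    -- By flatness every point is a specialization of one in the generic fibre, so an open and
    -- closed set is determined by its trace there.
    have hgen : ∀ x : X, ∃ y, y ⤳ x ∧ g y = (⊥ : PrimeSpectrum R) := by
      intro x
      have := hdom x
      obtain ⟨y, hy, hyP⟩ := exists_specializes_comap_eq x (⊥ : Ideal (X.presheaf.stalk x))
      refine ⟨y, hy, PrimeSpectrum.ext (eq_bot_iff.mpr fun r hr ↦ ?_)⟩
      rw [← comap_maximalIdeal_baseToStalk, Ideal.mem_comap, ← stalkSpecializes_baseToStalk g hy]
        at hr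
      have h0 : baseToStalk g x r ∈ (⊥ : Ideal (X.presheaf.stalk x)) := hyP ▸ hr
      obtain ⟨φ, hφ⟩ := exists_isLocalLine g x
      exact injective_of_flat _ hφ.flat_base (h0.trans (map_zero _).symm)
    have : PreconnectedSpace X := by
      rw [preconnectedSpace_iff_clopen]
      intro s hs
      by_contra! h
      obtain ⟨⟨x, hx⟩, h'⟩ := h
      obtain ⟨x', hx'⟩ := (Set.ne_univ_iff_exists_notMem s).mp h'
      obtain ⟨y, hy, hgy⟩ := hgen x
      obtain ⟨y', hy', hgy'⟩ := hgen x'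
      have hsub := hconn.subset_isClopen hs ⟨y, hgy, hy.mem_open hs.isOpen hx⟩
      exact hy'.mem_open hs.compl.isOpen hx' (hsub hgy')
    exact { toNonempty := ‹_› }
  have := irreducibleSpace_of_isDomain_stalk hdom
  have : IsReduced X := by
    have (x : X) : _root_.IsReduced (X.presheaf.stalk x) := by
      have := hdom x
      infer_instance
    exact isReduced_of_isReduced_stalk X
  exact isIntegral_of_irreducibleSpace_of_isReduced X

end Integrality

/-! ### The generic fibre of a model -/

section GenericFibre

open IsLocalRing

/-- A flat immersion induces isomorphisms of local rings. -/
theorem isIso_stalkMap_of_flat {X Y : Scheme.{u}} (i : X ⟶ Y) [Flat i] [IsPreimmersion i] (x : X) :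
    IsIso (i.stalkMap x) := by
  have hfl : (i.stalkMap x).hom.Flat := Flat.stalkMap i x
  have hsurj : Function.Surjective (i.stalkMap x).hom := i.stalkMap_surjective x
  have hloc : IsLocalHom (i.stalkMap x).hom := inferInstance
  have hinj : Function.Injective (i.stalkMap x).hom := by
    algebraize [(i.stalkMap x).hom]
    have : IsLocalHom (algebraMap (Y.presheaf.stalk (i x)) (X.presheaf.stalk x)) := hloc
    have : Module.FaithfullyFlat (Y.presheaf.stalk (i x)) (X.presheaf.stalk x) :=
      .of_flat_of_isLocalHom
    exact FaithfulSMul.algebraMap_injective _ _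
  exact (ConcreteCategory.isIso_iff_bijective _).mpr ⟨hinj, hsurj⟩

instance {R K : Type u} [CommRing R] [CommRing K] [Algebra R K] [IsDomain R] [IsFractionRing R K] :
    IsPreimmersion (Spec.map (CommRingCat.ofHom (algebraMap R K))) :=
  IsPreimmersion.mk_SpecMap
    (by exact PrimeSpectrum.localization_comap_isEmbedding K (nonZeroDivisors R))
    (by exact RingHom.surjectiveOnStalks_of_isLocalization (nonZeroDivisors R) K)

instance {R K : Type u} [CommRing R] [CommRing K] [Algebra R K] [IsDomain R] [IsFractionRing R K] :
    Flat (Spec.map (CommRingCat.ofHom (algebraMap R K))) := by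
  rw [Flat.SpecMap_iff]
  exact (RingHom.flat_algebraMap_iff).mpr (IsLocalization.flat K (nonZeroDivisors R))

theorem exists_generic_specializes {R : Type u} [CommRing R] [IsDomain R] {X : Scheme.{u}}
    (g : X ⟶ Spec (.of R)) [Flat g] (x : X) :
    ∃ y, y ⤳ x ∧ g y = (⊥ : PrimeSpectrum R) := by
  have h : (⊥ : PrimeSpectrum R) ⤳ g x := (PrimeSpectrum.le_iff_specializes _ _).mp bot_le
  exact Flat.generalizingMap g h

section

variable {R K : Type u} [CommRing R] [IsDomain R] [Field K] [Algebra R K] [IsFractionRing R K]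
  {X XK : Scheme.{u}} {p : XK ⟶ Spec (.of K)} {f : X ⟶ Spec (.of R)} {i : XK ⟶ X}

theorem specMap_fractionField (y : Spec (.of K)) :
    Spec.map (CommRingCat.ofHom (algebraMap R K)) y = (⊥ : PrimeSpectrum R) := by
  refine PrimeSpectrum.ext ?_
  change Ideal.comap (algebraMap R K) y.asIdeal = ⊥
  have h : y.asIdeal = ⊥ := (Ideal.eq_bot_or_top _).resolve_right y.2.ne_top
  rw [h, ← RingHom.ker_eq_comap_bot]
  exact (RingHom.injective_iff_ker_eq_bot _).mp (IsFractionRing.injective R K)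

theorem exists_of_map_eq_bot
    (h : IsPullback i p f (Spec.map (CommRingCat.ofHom (algebraMap R K)))) {c : X}
    (hc : f c = (⊥ : PrimeSpectrum R)) : ∃ y, i y = c := by
  obtain ⟨y, hy, -⟩ := Scheme.exists_preimage_of_isPullback h c _
    (hc.trans (specMap_fractionField (⊥ : PrimeSpectrum K)).symm)
  exact ⟨y, hy⟩

theorem map_genericFibre
    (h : IsPullback i p f (Spec.map (CommRingCat.ofHom (algebraMap R K)))) (y : XK) :
    f (i y) = (⊥ : PrimeSpectrum R) := by
  have h1 : f (i y) = Spec.map (CommRingCat.ofHom (algebraMap R K)) (p y) := congr($h.w y)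
  exact h1.trans (specMap_fractionField _)

theorem range_genericFibre
    (h : IsPullback i p f (Spec.map (CommRingCat.ofHom (algebraMap R K)))) :
    Set.range i = f ⁻¹' {(⊥ : PrimeSpectrum R)} :=
  Set.Subset.antisymm (Set.range_subset_iff.mpr fun y ↦ map_genericFibre h y)
    fun _ hc ↦ exists_of_map_eq_bot h hc

end

variable {K : Type u} [Field K] [NumberField K] {CK C : Scheme.{u}} {p : CK ⟶ Spec (.of K)}
  {f : C ⟶ Spec (.of (𝓞 K))} {i : CK ⟶ C}

/-- As a base change of the flat preimmersion `Spec K ⟶ Spec 𝓞 K`, the map `i` induces isomorphisms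
on stalks, and membership in the smooth locus is formal smoothness of the stalk map. -/
theorem mem_smoothLocus_of_isPullback [LocallyOfFinitePresentation f] [Smooth p]
    (h : IsPullback i p f (Spec.map (CommRingCat.ofHom (algebraMap (𝓞 K) K)))) (y : CK) :
    i y ∈ f.smoothLocus := by
  have : Flat i := MorphismProperty.of_isPullback h.flip inferInstance
  have : IsPreimmersion i := MorphismProperty.of_isPullback h.flip inferInstance
  have hy : y ∈ p.smoothLocus := by rw [p.smoothLocus_eq_top]; trivial
  have h1 := isIso_stalkMap_of_flat i y
  have h2 := isIso_stalkMap_of_flat (Spec.map (CommRingCat.ofHom (algebraMap (𝓞 K) K))) (p y)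
  have h3 : ((i ≫ f).stalkMap y).hom.FormallySmooth := by
    have h3 := RingHom.FormallySmooth.comp (.of_bijective
      ((ConcreteCategory.isIso_iff_bijective _).mp h2)) (show (p.stalkMap y).hom.FormallySmooth from hy)
    rw [h.w, Scheme.Hom.stalkMap_comp]
    exact h3
  rw [Scheme.Hom.stalkMap_comp] at h3
  rw [Scheme.Hom.mem_smoothLocus]
  have h4 : f.stalkMap (i y) = (f.stalkMap (i y) ≫ i.stalkMap y) ≫ inv (i.stalkMap y) := by simp
  rw [h4]
  have h5 : IsIso (inv (i.stalkMap y)) := inferInstance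
  exact RingHom.FormallySmooth.comp h3 (.of_bijective
      ((ConcreteCategory.isIso_iff_bijective _).mp h5))

/-- The relative dimension is the rank of the module of differentials on any nonempty chart. -/
theorem eq_of_smoothOfRelativeDimension {X : Scheme.{u}} [Nonempty X] {R : CommRingCat.{u}}
    (g : X ⟶ Spec R) (n m : ℕ) [SmoothOfRelativeDimension n g] [hm : SmoothOfRelativeDimension m g] :
    n = m := by
  obtain ⟨x⟩ := ‹Nonempty X›
  obtain ⟨V, hV, hx, hn⟩ := exists_isStandardSmooth_appLE g n x
  have := HasRingHomProperty.appLE (@SmoothOfRelativeDimension m) g hm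
    ⟨⊤, isAffineOpen_top _⟩ ⟨V, hV⟩ le_top
  rw [RingHom.locally_iff_isLocalization
    RingHom.isStandardSmoothOfRelativeDimension_respectsIso] at this
  obtain ⟨s, hs, hfs⟩ := this
  apply iSup_basicOpen_of_span_eq_top at hs
  have : x ∈ (⨆ i ∈ s, X.basicOpen i) := hs.symm ▸ hx
  obtain ⟨r, hr, hrs⟩ : ∃ r ∈ s, x ∈ X.basicOpen r := by simpa using this
  have : IsLocalization.Away r Γ(X, X.basicOpen r) := hV.isLocalization_basicOpen r
  have hm' := hfs r hr Γ(X, X.basicOpen r)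
  have hn' : ((algebraMap Γ(X, V) Γ(X, X.basicOpen r)).comp
      (g.appLE ⊤ V le_top).hom).IsStandardSmoothOfRelativeDimension (0 + n) :=
    RingHom.IsStandardSmoothOfRelativeDimension.comp
      (RingHom.IsStandardSmoothOfRelativeDimension.algebraMap_isLocalizationAway r) hn
  rw [zero_add] at hn'
  have : Nonempty (X.basicOpen r) := ⟨⟨x, hrs⟩⟩
  have : Nontrivial Γ(X, X.basicOpen r) := inferInstance
  let φ := (algebraMap Γ(X, V) Γ(X, X.basicOpen r)).comp (g.appLE ⊤ V le_top).hom
  let := φ.toAlgebra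
  have h1 : Algebra.IsStandardSmoothOfRelativeDimension n Γ(Spec R, ⊤) Γ(X, X.basicOpen r) := hn'
  have h2 : Algebra.IsStandardSmoothOfRelativeDimension m Γ(Spec R, ⊤) Γ(X, X.basicOpen r) := hm'
  have e1 := Algebra.IsStandardSmoothOfRelativeDimension.rank_kaehlerDifferential
    (R := Γ(Spec R, ⊤)) (S := Γ(X, X.basicOpen r)) n
  have e2 := Algebra.IsStandardSmoothOfRelativeDimension.rank_kaehlerDifferential
    (R := Γ(Spec R, ⊤)) (S := Γ(X, X.basicOpen r)) m
  exact_mod_cast e1.symm.trans e2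

/-- A smooth open part of a flat scheme over `𝓞 K` whose generic fibre is smooth of relative
dimension `1` is smooth of relative dimension `1`. -/
theorem smoothOfRelativeDimension_one [SmoothOfRelativeDimension 1 p]
    (h : IsPullback i p f (Spec.map (CommRingCat.ofHom (algebraMap (𝓞 K) K)))) {X : Scheme.{u}}
    (j : X ⟶ C) [IsOpenImmersion j] [Smooth (j ≫ f)] : SmoothOfRelativeDimension 1 (j ≫ f) := by
  refine ⟨fun x ↦ ?_⟩
  obtain ⟨U, hU, V, hV, hx, e, hsm⟩ := Smooth.exists_isStandardSmooth (j ≫ f) x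
  refine ⟨U, hU, V, hV, hx, e, ?_⟩
  obtain ⟨n, hn⟩ : ∃ n, ((j ≫ f).appLE U V e).hom.IsStandardSmoothOfRelativeDimension n := by
    let := ((j ≫ f).appLE U V e).hom.toAlgebra
    obtain ⟨_, _, _, _, ⟨P⟩⟩ := (hsm : Algebra.IsStandardSmooth _ _)
    exact ⟨P.dimension, _, _, _, ‹_›, P, rfl⟩
  let k : (V : Scheme.{u}) ⟶ C := V.ι ≫ j
  have : IsAffine V := hV
  have : IsAffine U := hU
  have hres : SmoothOfRelativeDimension n ((j ≫ f).resLE U V e) := by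
    rw [HasRingHomProperty.iff_of_isAffine (P := @SmoothOfRelativeDimension n)]
    refine RingHom.locally_of ?_ _ ?_
    · exact RingHom.isStandardSmoothOfRelativeDimension_respectsIso
    · exact (RingHom.isStandardSmoothOfRelativeDimension_respectsIso.arrow_mk_iso_iff
        (arrowResLEAppIso (j ≫ f) U V e)).mpr hn
  have hk : SmoothOfRelativeDimension n (k ≫ f) := by
    have h1 : k ≫ f = (j ≫ f).resLE U V e ≫ U.ι := by simp [k]
    rw [h1]
    exact smoothOfRelativeDimension_comp n 0 _ _
  have hks : Smooth (k ≫ f) := SmoothOfRelativeDimension.smooth n _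
  -- The generic fibre of the chart `V` is nonempty by flatness. It has relative dimension `n` by
  -- base change from `V`, and `1` as an open part of `CK`.
  have hsq : IsPullback (pullback.fst k i) (pullback.snd k i ≫ p) (k ≫ f)
      (Spec.map (CommRingCat.ofHom (algebraMap (𝓞 K) K))) :=
    ((IsPullback.of_hasPullback k i).flip.paste_horiz h.flip).flip
  have : Nonempty ↥(pullback k i) := by
    obtain ⟨y, -, hy⟩ := exists_generic_specializes (k ≫ f) ⟨x, hx⟩
    obtain ⟨z, hz⟩ := exists_of_map_eq_bot hsq hy
    exact ⟨z⟩
  have hn' : SmoothOfRelativeDimension n (pullback.snd k i ≫ p) :=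
    have := smoothOfRelativeDimension_isStableUnderBaseChange.{u} n
    MorphismProperty.of_isPullback (P := @SmoothOfRelativeDimension n) hsq hk
  have h1' : SmoothOfRelativeDimension 1 (pullback.snd k i ≫ p) :=
    smoothOfRelativeDimension_comp 0 1 _ _
  obtain rfl := eq_of_smoothOfRelativeDimension (pullback.snd k i ≫ p) n 1
  exact hn

end GenericFibre

/-! ### Irreducibility of the smooth fibres -/

section GoodFibres

open IsLocalRing

/-- Every point of a closed subset of a scheme is a specialization of a maximal point. -/
theorem exists_maximal_specializes {X : Scheme.{u}} {Z : Set X} (hZ : IsClosed Z) {x : X}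
    (hx : x ∈ Z) : ∃ z ∈ Z, z ⤳ x ∧ ∀ y ∈ Z, y ⤳ z → y = z := by
  have : QuasiSober Z := hZ.isClosedEmbedding_subtypeVal.quasiSober
  let T := irreducibleComponent (⟨x, hx⟩ : Z)
  have hT : T ∈ irreducibleComponents Z := irreducibleComponent_mem_irreducibleComponents _
  have hz := hT.1.isGenericPoint_genericPoint isClosed_irreducibleComponent
  refine ⟨hT.1.genericPoint, hT.1.genericPoint.2,
    (hz.specializes mem_irreducibleComponent).map continuous_subtype_val, fun y hy h ↦ ?_⟩
  have h' : (⟨y, hy⟩ : Z) ⤳ hT.1.genericPoint :=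
    hZ.isClosedEmbedding_subtypeVal.isInducing.specializes_iff.mp h
  have h1 : closure {hT.1.genericPoint} ⊆ closure {(⟨y, hy⟩ : Z)} := specializes_iff_closure_subset.mp h'
  rw [hz.def] at h1
  have h2 := hT.2 isIrreducible_singleton.closure h1
  have h3 : hT.1.genericPoint ⤳ (⟨y, hy⟩ : Z) := hz.specializes (h2 (subset_closure rfl))
  exact congrArg Subtype.val (h'.antisymm h3).eq

/-- A uniformizer at `q` can be taken in `R`. It generates the extension of `q` to any local ring
lying over `q`, since elements outside `q` become units there. -/
theorem exists_map_eq_span {R : Type*} [CommRing R] [IsDedekindDomain R]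
    (q : IsDedekindDomain.HeightOneSpectrum R) :
    ∃ x ∈ q.asIdeal, x ≠ 0 ∧ ∀ {O : Type*} [CommRing O] [IsLocalRing O] (ψ : R →+* O),
      (maximalIdeal O).comap ψ = q.asIdeal → q.asIdeal.map ψ = Ideal.span {ψ x} := by
  let A := Localization.AtPrime q.asIdeal
  have hA : IsDiscreteValuationRing A :=
    IsLocalization.AtPrime.isDiscreteValuationRing_of_dedekind_domain R q.ne_bot A
  have hcm : (maximalIdeal A).comap (algebraMap R A) = q.asIdeal :=
    IsLocalization.AtPrime.under_maximalIdeal A q.asIdeal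
  obtain ⟨a, ha⟩ := IsDiscreteValuationRing.exists_irreducible A
  obtain ⟨x, s, rfl⟩ := IsLocalization.exists_mk'_eq q.asIdeal.primeCompl a
  have hm : maximalIdeal A = Ideal.span {algebraMap R A x} := by
    rw [ha.maximalIdeal_eq, Ideal.span_singleton_eq_span_singleton]
    refine ⟨IsUnit.unit (IsLocalization.map_units A s), ?_⟩
    simp
  have hx : x ∈ q.asIdeal := by
    rw [← hcm, Ideal.mem_comap, hm]
    exact Ideal.mem_span_singleton_self _
  refine ⟨x, hx, ?_, fun {O} _ _ ψ hψ ↦ ?_⟩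
  · rintro rfl
    exact ha.ne_zero (by simp)
  · refine le_antisymm (Ideal.map_le_iff_le_comap.mpr fun r hr ↦ ?_)
      ((Ideal.span_singleton_le_iff_mem _).mpr (Ideal.mem_map_of_mem _ hx))
    have hr' : algebraMap R A r ∈ maximalIdeal A := by
      rw [← Ideal.mem_comap, hcm]
      exact hr
    rw [hm, Ideal.mem_span_singleton] at hr'
    obtain ⟨y, hy⟩ := hr'
    obtain ⟨y, s, rfl⟩ := IsLocalization.exists_mk'_eq q.asIdeal.primeCompl y
    rw [IsLocalization.mul_mk'_eq_mk'_of_mul, IsLocalization.eq_mk'_iff_mul_eq, ← map_mul] at hy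
    have hy' := IsLocalization.injective A q.asIdeal.primeCompl_le_nonZeroDivisors hy
    have hs : IsUnit (ψ s) := by
      by_contra h
      have : ψ s ∈ maximalIdeal O := h
      rw [← Ideal.mem_comap, hψ] at this
      exact s.2 this
    rw [Ideal.mem_comap, ← Ideal.mul_unit_mem_iff_mem _ hs, ← map_mul, hy', map_mul]
    exact Ideal.mul_mem_right _ _ (Ideal.mem_span_singleton_self _)

instance {X Y : Scheme.{u}} (f : X ⟶ Y) [LocallyOfFinitePresentation f] :
    Smooth (f.smoothLocus.ι ≫ f) := by
  rw [← Scheme.Hom.smoothLocus_eq_top_iff, ← Scheme.Hom.preimage_smoothLocus_eq]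
  exact Scheme.Opens.ι_preimage_self _

theorem isPullback_of_comp_mono {C : Type*} [Category C] {W X Y Z S : C} {l : W ⟶ X}
    {j : X ⟶ Y} [Mono j] {f : Y ⟶ S} {g : W ⟶ Z} {b : Z ⟶ S} (h : IsPullback (l ≫ j) g f b) :
    IsPullback l g (j ≫ f) b :=
  ⟨⟨by simpa using h.w⟩, ⟨PullbackCone.IsLimit.mk _
    (fun s ↦ h.lift (s.fst ≫ j) s.snd (by simpa using s.condition))
    (fun s ↦ by rw [← cancel_mono j]; simp) (fun s ↦ by simp)
    (fun s m h1 h2 ↦ by apply h.hom_ext <;> simp [reassoc_of% h1, h2])⟩⟩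

variable {K : Type u} [Field K] [NumberField K] {CK C : Scheme.{u}} {p : CK ⟶ Spec (.of K)}
  {f : C ⟶ Spec (.of (𝓞 K))} {i : CK ⟶ C}

/-- The generic fibre of `X` is the base change of `CK` along the field extension `K → L` induced by
`φ`. -/
theorem isConnected_of_isPullback [GeometricallyConnected p]
    (h : IsPullback i p f (Spec.map (CommRingCat.ofHom (algebraMap (𝓞 K) K))))
    {R : Type u} [CommRing R] [IsDomain R] (L : Type u) [Field L] [Algebra R L]
    [IsFractionRing R L] (φ : 𝓞 K →+* R) (hφ : Function.Injective φ) {X : Scheme.{u}} {t : X ⟶ C} {g : X ⟶ Spec (.of R)}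
    (hX : IsPullback t g f (Spec.map (CommRingCat.ofHom φ))) :
    _root_.IsConnected (g ⁻¹' {(⊥ : PrimeSpectrum R)}) := by
  let e := Spec.map (CommRingCat.ofHom (algebraMap R L))
  have hL : Function.Injective ((algebraMap R L).comp φ) := fun x y hxy ↦
    hφ (IsFractionRing.injective R L hxy)
  let d : K →+* L := IsFractionRing.lift hL
  have hd : d.comp (algebraMap (𝓞 K) K) = (algebraMap R L).comp φ :=
    RingHom.ext fun x ↦ IsFractionRing.lift_algebraMap hL x
  have h1 : IsPullback (pullback.fst g e) (pullback.snd g e) g e := .of_hasPullback g e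
  have h2 := (h1.flip.paste_vert hX.flip).flip
  have h3 : e ≫ Spec.map (CommRingCat.ofHom φ) = Spec.map (CommRingCat.ofHom d) ≫
      Spec.map (CommRingCat.ofHom (algebraMap (𝓞 K) K)) := by
    rw [← Spec.map_comp, ← Spec.map_comp, ← CommRingCat.ofHom_comp, ← CommRingCat.ofHom_comp, hd]
  rw [h3] at h2
  have h4 := IsPullback.of_bot' h2.flip h.flip
  have : ConnectedSpace ↥(pullback g e) :=
    GeometricallyConnected.geometrically_connectedSpace (f := p) _ _ _ h4.flip
  rw [← range_genericFibre h1]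
  exact isConnected_range (pullback.fst g e).continuous

/-- Over a prime where `C` is smooth, a maximal point of the fibre specializes to every
point that lies on a section over a discrete valuation ring. -/
theorem specializes_of_section [IsProper f] (hp : IsCurve p)
    (h : IsPullback i p f (Spec.map (CommRingCat.ofHom (algebraMap (𝓞 K) K))))
    {q : IsDedekindDomain.HeightOneSpectrum (𝓞 K)} (hq : ¬ IsBad f q)
    {R : Type u} [CommRing R] [IsDomain R] [IsDiscreteValuationRing R] (φ : 𝓞 K →+* R)
    (hφ : Function.Injective φ) (hφq : (maximalIdeal R).comap φ = q.asIdeal)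
    (τ : Spec (.of R) ⟶ C) (hτ : τ ≫ f = Spec.map (CommRingCat.ofHom φ)) {c : C}
    (hc : f c = point q) (hmax : ∀ y, y ⤳ c → f y = point q → y = c) :
    c ⤳ τ (closedPoint R) := by
  have := hp.geometricallyConnected
  have := hp.smooth
  have hps : Smooth p := SmoothOfRelativeDimension.smooth 1 p
  have : CharZero R := charZero_of_injective_ringHom hφ
  let b := Spec.map (CommRingCat.ofHom φ)
  let g := pullback.snd f b
  let t := pullback.fst f b
  have hX : IsPullback t g f b := .of_hasPullback f b
  have hbc : b (closedPoint R) = point q := PrimeSpectrum.ext hφq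
  have hbb : b (⊥ : PrimeSpectrum R) = (⊥ : PrimeSpectrum (𝓞 K)) := PrimeSpectrum.ext <| by
    change Ideal.comap φ ⊥ = ⊥
    rw [← RingHom.ker_eq_comap_bot]
    exact (RingHom.injective_iff_ker_eq_bot _).mp hφ
  have hw : ∀ x, f (t x) = b (g x) := fun x ↦ congr($hX.w x)
  -- `Spec R` only meets the generic point and `q`, and the model is smooth above both.
  have ht : ∀ x, t x ∈ f.smoothLocus := by
    intro x
    by_cases hx : (g x).asIdeal = ⊥
    · have h1 : f (t x) = (⊥ : PrimeSpectrum (𝓞 K)) := by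
        rw [hw, show g x = (⊥ : PrimeSpectrum R) from PrimeSpectrum.ext hx]
        exact hbb
      obtain ⟨y, hy⟩ := exists_of_map_eq_bot h h1
      rw [← hy]
      exact mem_smoothLocus_of_isPullback h y
    · have h1 : f (t x) = point q := by
        rw [hw, show g x = closedPoint R from
          PrimeSpectrum.ext (eq_maximalIdeal ((g x).2.isMaximal hx))]
        exact hbc
      by_contra h2
      exact hq ⟨_, h1, h2⟩
  let l : pullback f b ⟶ f.smoothLocus := IsOpenImmersion.lift f.smoothLocus.ι t (by
    rw [Scheme.Opens.range_ι]
    exact Set.range_subset_iff.mpr ht)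
  have hl : l ≫ f.smoothLocus.ι = t := IsOpenImmersion.lift_fac _ _ _
  have hX' : IsPullback l g (smoothPart f) b := isPullback_of_comp_mono (hl ▸ hX)
  have : SmoothOfRelativeDimension 1 (smoothPart f) :=
    smoothOfRelativeDimension_one h f.smoothLocus.ι
  have : SmoothOfRelativeDimension 1 g :=
    have := smoothOfRelativeDimension_isStableUnderBaseChange.{u} 1
    MorphismProperty.of_isPullback (P := @SmoothOfRelativeDimension 1) hX' (by assumption)
  let σ : Spec (.of R) ⟶ pullback f b := hX.lift τ (𝟙 _) (by simpa using hτ)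
  have hσ : σ ≫ g = 𝟙 _ := hX.lift_snd _ _ _
  have hσt : σ ≫ t = τ := hX.lift_fst _ _ _
  have : Nonempty ↥(pullback f b) := ⟨σ (closedPoint R)⟩
  have : IsIntegral (pullback f b) :=
    isIntegral_of_isPreconnected g (isConnected_of_isPullback h (FractionRing R) φ hφ hX).isPreconnected
  obtain ⟨x, hxt, hxg⟩ := Scheme.exists_preimage_of_isPullback hX c (closedPoint R)
    (hc.trans hbc.symm)
  -- A generic point of the special fibre above `x` still maps to `c`, because its image is a
  -- generization of `c` in the fibre over `q`.
  obtain ⟨ξ, hξ, hξx, hξm⟩ := exists_maximal_specializes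
    ((isClosed_singleton_closedPoint R).preimage g.continuous) (show x ∈ g ⁻¹' _ from hxg)
  have h1 : ξ ⤳ σ (closedPoint R) := specializes_section g σ hσ ξ hξ fun y hy hgy ↦ hξm y hgy hy
  have h2 : t ξ = c := by
    refine hmax _ (hxt ▸ hξx.map t.continuous) ?_
    rw [hw, show g ξ = closedPoint R from hξ]
    exact hbc
  have h3 : t (σ (closedPoint R)) = τ (closedPoint R) := congr($hσt (closedPoint R))
  rw [← h2, ← h3]
  exact h1.map t.continuous

/-- The fibre over a prime where `C` is smooth has only one maximal point. -/
theorem eq_of_maximal [IsProper f] [Flat f] (hp : IsCurve p)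
    (h : IsPullback i p f (Spec.map (CommRingCat.ofHom (algebraMap (𝓞 K) K))))
    {q : IsDedekindDomain.HeightOneSpectrum (𝓞 K)} (hq : ¬ IsBad f q) {c c' : C}
    (hc : f c = point q) (hmax : ∀ y, y ⤳ c → f y = point q → y = c)
    (hc' : f c' = point q) (hmax' : ∀ y, y ⤳ c' → f y = point q → y = c') : c = c' := by
  have := hp.smooth
  have : SmoothOfRelativeDimension 1 (smoothPart f) :=
    smoothOfRelativeDimension_one h f.smoothLocus.ι
  have hcs : c ∈ f.smoothLocus := by
    by_contra h2
    exact hq ⟨_, hc, h2⟩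
  obtain ⟨x, hxc⟩ : ∃ x : (f.smoothLocus : Scheme.{u}), f.smoothLocus.ι x = c := ⟨⟨c, hcs⟩, rfl⟩
  have hxq : (maximalIdeal _).comap (baseToStalk (smoothPart f) x) = q.asIdeal := by
    rw [comap_maximalIdeal_baseToStalk]
    rw [← hxc] at hc
    exact congr(($hc).asIdeal)
  obtain ⟨φ, hφ⟩ := exists_isLocalLine (R := .of (𝓞 K)) (smoothPart f) x
  have := hφ.noeth
  have hqm : q.asIdeal.IsMaximal := q.isMaximal
  have hpr := hφ.isPrime_map q.asIdeal hxq
  have hm := maximalIdeal_stalk_eq_map (smoothPart f) hφ q.asIdeal hxq fun y hy hgy ↦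
    f.smoothLocus.ι.injective ((hmax _ (hxc ▸ hy.map f.smoothLocus.ι.continuous)
      (PrimeSpectrum.ext hgy)).trans hxc.symm)
  obtain ⟨π, hπq, hπ0, hπ⟩ := exists_map_eq_span q
  rw [hπ _ hxq] at hpr hm
  have hfl := hφ.flat_base
  have hinj := injective_of_flat (R := 𝓞 K) _ hfl
  have : IsDomain ((f.smoothLocus : Scheme.{u}).presheaf.stalk x) :=
    isDomain_of_isPrime_span_singleton (map_mem_nonZeroDivisors_of_flat _ hfl hπ0) hpr
  have : IsDiscreteValuationRing ((f.smoothLocus : Scheme.{u}).presheaf.stalk x) := by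
    have hF : ¬ IsField ((f.smoothLocus : Scheme.{u}).presheaf.stalk x) := by
      rw [IsLocalRing.isField_iff_maximalIdeal_eq, hm, Ideal.span_singleton_eq_bot]
      exact fun h0 ↦ hπ0 (hinj (h0.trans (map_zero _).symm))
    have hT := (IsDiscreteValuationRing.TFAE _ hF).out 4 0
    exact hT.mp ⟨_, hm⟩
  -- The discrete valuation ring is the local ring at `c`, and its canonical map to `C` is the
  -- section: its closed point goes to `c`, to which `c'` must therefore specialize.
  have h1 := specializes_of_section hp h hq (baseToStalk (smoothPart f) x) hinj hxq
    ((f.smoothLocus : Scheme.{u}).fromSpecStalk x ≫ f.smoothLocus.ι)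
    (by rw [Category.assoc]; exact fromSpecStalk_comp (smoothPart f) x) hc' hmax'
  have h2 : ((f.smoothLocus : Scheme.{u}).fromSpecStalk x ≫ f.smoothLocus.ι) (closedPoint _) = c := by
    exact (congrArg f.smoothLocus.ι Scheme.fromSpecStalk_closedPoint).trans hxc
  rw [h2] at h1
  exact (hmax c' h1 hc').symm

end GoodFibres

/-! ### Fibres of an admissible open -/

section AdmissibleOpens

variable {K : Type u} [Field K]

theorem point_injective : Function.Injective (point (K := K)) := fun _ _ h ↦
  IsDedekindDomain.HeightOneSpectrum.ext congr(($h).asIdeal)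

theorem eq_bot_or_exists_eq_point (s : Spec (.of (𝓞 K))) :
    s = (⊥ : PrimeSpectrum (𝓞 K)) ∨ ∃ q, s = point q := by
  by_cases h : s.asIdeal = ⊥
  · exact .inl (PrimeSpectrum.ext h)
  · exact .inr ⟨⟨s.asIdeal, s.2, h⟩, rfl⟩

theorem point_ne_bot (q : IsDedekindDomain.HeightOneSpectrum (𝓞 K)) :
    point q ≠ (⊥ : PrimeSpectrum (𝓞 K)) := fun h ↦ q.ne_bot congr(($h).asIdeal)

variable [NumberField K] {CK C : Scheme.{u}} {p : CK ⟶ Spec (.of K)}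
  {f : C ⟶ Spec (.of (𝓞 K))} [IsProper f] {i : CK ⟶ C} {U : C.Opens}

theorem isClosed_point (q : IsDedekindDomain.HeightOneSpectrum (𝓞 K)) :
    IsClosed {point q} :=
  (PrimeSpectrum.isClosed_singleton_iff_isMaximal _).mpr q.isMaximal

/-- The image is closed and contains the generic point of the base. -/
theorem surjective_of_isPullback [GeometricallyConnected p]
    (h : IsPullback i p f (Spec.map (CommRingCat.ofHom (algebraMap (𝓞 K) K)))) :
    Function.Surjective f := by
  obtain ⟨y, -⟩ := p.surjective (⊥ : PrimeSpectrum K)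
  intro s
  have h1 : (⊥ : PrimeSpectrum (𝓞 K)) ⤳ s := (PrimeSpectrum.le_iff_specializes _ _).mp bot_le
  have h2 : IsClosed (Set.range f) := f.isClosedMap.isClosed_range
  exact h1.mem_closed h2 ⟨i y, map_genericFibre h y⟩

theorem map_smoothFibreι {q : IsDedekindDomain.HeightOneSpectrum (𝓞 K)} (w : smoothFibre f q) :
    f (smoothFibreι f q w) = point q := by
  have h1 : (smoothPart f).fiberι (point q) w ∈ smoothPart f ⁻¹' {point q} := by
    rw [← Scheme.Hom.range_fiberι]; exact ⟨w, rfl⟩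
  exact h1

theorem smoothFibreι_mem {q : IsDedekindDomain.HeightOneSpectrum (𝓞 K)} (w : smoothFibre f q) :
    smoothFibreι f q w ∈ f.smoothLocus :=
  ((smoothPart f).fiberι (point q) w).2

theorem exists_smoothFibreι_eq {q : IsDedekindDomain.HeightOneSpectrum (𝓞 K)} {c : C}
    (hc : c ∈ f.smoothLocus) (hcq : f c = point q) : ∃ w, smoothFibreι f q w = c := by
  have h1 : (⟨c, hc⟩ : f.smoothLocus) ∈ smoothPart f ⁻¹' {point q} := hcq
  rw [← Scheme.Hom.range_fiberι] at h1
  obtain ⟨w, hw⟩ := h1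
  exact ⟨w, congrArg f.smoothLocus.ι hw⟩

/-- The part of an admissible open away from the bad primes is the whole scheme. -/
theorem IsAdmissibleOpen.mem_of_forall_ne (hU : IsAdmissibleOpen f U) {c : C}
    (hc : c ∈ f.smoothLocus) (hq : ∀ q, IsBad f q → f c ≠ point q) : c ∈ U := by
  obtain ⟨Z, -, hU⟩ := hU
  rw [← SetLike.mem_coe, hU]
  refine ⟨hc, fun h ↦ ?_⟩
  simp only [Set.mem_iUnion] at h
  obtain ⟨q, hqb, W, -, w, -, rfl⟩ := h
  exact hq q hqb (map_smoothFibreι w)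

theorem IsAdmissibleOpen.le_smoothLocus (hU : IsAdmissibleOpen f U) : U ≤ f.smoothLocus := by
  obtain ⟨Z, -, hU⟩ := hU
  intro c hc
  rw [← SetLike.mem_coe, hU] at hc
  exact hc.1

/-- The fibres of an admissible open over the closed points are irreducible. -/
theorem IsAdmissibleOpen.exists_generic (hU : IsAdmissibleOpen f U) [Flat f] (hp : IsCurve p)
    (h : IsPullback i p f (Spec.map (CommRingCat.ofHom (algebraMap (𝓞 K) K))))
    (q : IsDedekindDomain.HeightOneSpectrum (𝓞 K)) :
    ∃ x ∈ U, f x = point q ∧ ∀ y ∈ U, f y = point q → x ⤳ y := by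
  by_cases hq : IsBad f q
  · obtain ⟨Z, hZ, hU⟩ := hU
    have hZq := (hZ q hq).1
    have hz := hZq.1.isGenericPoint_genericPoint (isClosed_of_mem_irreducibleComponents _ hZq)
    set z := hZq.1.genericPoint
    have hinj : Function.Injective (smoothFibreι f q) :=
      f.smoothLocus.ι.injective.comp ((smoothPart f).fiberι (point q)).injective
    refine ⟨smoothFibreι f q z, ?_, map_smoothFibreι z, fun y hy hyq ↦ ?_⟩
    · rw [← SetLike.mem_coe, hU]
      refine ⟨smoothFibreι_mem z, fun h ↦ ?_⟩
      simp only [Set.mem_iUnion] at h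
      obtain ⟨q', hqb, W, ⟨hW, hWZ⟩, w, hw, hwz⟩ := h
      obtain rfl : q' = q := point_injective (by
        exact (map_smoothFibreι w).symm.trans ((congrArg f hwz).trans (map_smoothFibreι z)))
      obtain rfl := hinj hwz
      have h1 : Z q' ⊆ W := by
        rw [← hz.def]
        exact (isClosed_of_mem_irreducibleComponents _ hW).closure_subset_iff.mpr
          (Set.singleton_subset_iff.mpr hw)
      exact hWZ ((hZq.2 hW.1 h1).antisymm h1)
    · rw [← SetLike.mem_coe, hU] at hy
      obtain ⟨w, rfl⟩ := exists_smoothFibreι_eq hy.1 hyq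
      -- A point of `U` over `q` lies on no other component, since those were removed.
      have hwZ : irreducibleComponent w = Z q := by
        by_contra hne
        apply hy.2
        simp only [Set.mem_iUnion]
        exact ⟨q, hq, _, ⟨irreducibleComponent_mem_irreducibleComponents w, hne⟩, w,
          mem_irreducibleComponent, rfl⟩
      have hw : w ∈ Z q := hwZ ▸ mem_irreducibleComponent
      exact (hz.specializes hw).map (smoothFibreι f q).continuous
  · have := hp.geometricallyConnected
    -- Over a good prime nothing is removed, so the fibre of `U` is that of `C`.
    have hfU : ∀ c, f c = point q → c ∈ U := fun c hc ↦ hU.mem_of_forall_ne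
      (by by_contra h'; exact hq ⟨c, hc, h'⟩)
      (fun q' hq' hcq ↦ hq (point_injective (hc.symm.trans hcq) ▸ hq'))
    obtain ⟨c, hc⟩ := surjective_of_isPullback h (point q)
    have hcl : IsClosed (f ⁻¹' {point q}) := (isClosed_point q).preimage f.continuous
    obtain ⟨x, hx, -, hxm⟩ := exists_maximal_specializes hcl (show c ∈ _ from hc)
    refine ⟨x, hfU x hx, hx, fun y hy hyq ↦ ?_⟩
    obtain ⟨x', hx', hxy, hxm'⟩ := exists_maximal_specializes hcl (show y ∈ _ from hyq)
    rwa [eq_of_maximal hp h hq hx (fun y hy hyq ↦ hxm y hyq hy) hx'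
      (fun y hy hyq ↦ hxm' y hyq hy)]

theorem IsAdmissibleOpen.range_subset (hU : IsAdmissibleOpen f U) [Smooth p]
    (h : IsPullback i p f (Spec.map (CommRingCat.ofHom (algebraMap (𝓞 K) K)))) :
    Set.range i ⊆ U := by
  rintro _ ⟨y, rfl⟩
  refine hU.mem_of_forall_ne (mem_smoothLocus_of_isPullback h y) fun q _ hq ↦ ?_
  exact point_ne_bot q (hq.symm.trans (map_genericFibre h y))

end AdmissibleOpens

/-! ### Constants of the generic fibre -/

section GlobalFunctions

open scoped TensorProduct
open IsLocalRing

/-- As `E / K` is separable, the kernel of `E ⊗ E → E` is generated by an idempotent. Connectedness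
makes it `0` or `1`, and it is not `1` since the kernel is proper. So `E ⊗ E` embeds in `E`, and
comparing dimensions gives `[E : K] = 1`. -/
theorem bijective_algebraMap_of_preconnectedSpace {K E : Type*} [Field K] [Field E] [Algebra K E]
    [CharZero K] [Module.Finite K E] [PreconnectedSpace (PrimeSpectrum (E ⊗[K] E))] :
    Function.Bijective (algebraMap K E) := by
  have : Algebra.IsSeparable K E := inferInstance
  have : Algebra.FormallyUnramified K E := .of_isSeparable K E
  obtain ⟨e, he, hI⟩ := (Ideal.isIdempotentElem_iff_of_fg _ (KaehlerDifferential.ideal_fg K E)).mp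
    ((Ideal.cotangent_subsingleton_iff _).mp
      (Algebra.FormallyUnramified.subsingleton_kaehlerDifferential (R := K) (A := E)))
  have hI0 : KaehlerDifferential.ideal K E = ⊥ := by
    have hc : IsClopen (PrimeSpectrum.basicOpen e : Set (PrimeSpectrum (E ⊗[K] E))) :=
      PrimeSpectrum.isClopen_iff.mpr ⟨e, he, rfl⟩
    rcases isClopen_iff.mp hc with h | h
    · have h1 : IsNilpotent e := (PrimeSpectrum.basicOpen_eq_bot_iff e).mp
        (TopologicalSpace.Opens.ext h)
      obtain ⟨n, hn⟩ := h1
      have h2 : e = 0 := by rw [← he.pow_succ_eq n, pow_succ, hn, zero_mul]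
      rw [hI, h2, Ideal.submodule_span_eq, Ideal.span_singleton_eq_bot]
    · exfalso
      have h1 : IsUnit e := by
        by_contra hu
        obtain ⟨m, hm, hem⟩ := exists_max_ideal_of_mem_nonunits hu
        have h2 : (⟨m, hm.isPrime⟩ : PrimeSpectrum _) ∈
          (PrimeSpectrum.basicOpen e : Set (PrimeSpectrum (E ⊗[K] E))) := h ▸ trivial
        exact h2 hem
      have h2 : e ∈ KaehlerDifferential.ideal K E := hI ▸ Ideal.mem_span_singleton_self e
      have h3 := Ideal.eq_top_of_isUnit_mem _ h2 h1
      have h4 : (1 : E ⊗[K] E) ∈ KaehlerDifferential.ideal K E := h3 ▸ trivial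
      rw [RingHom.mem_ker, map_one] at h4
      exact one_ne_zero h4
  have hinj : Function.Injective (Algebra.TensorProduct.lmul' K (S := E)) :=
    (RingHom.injective_iff_ker_eq_bot _).mpr hI0
  have h1 := LinearMap.finrank_le_finrank_of_injective
    (f := (Algebra.TensorProduct.lmul' K (S := E)).toLinearMap) hinj
  rw [Module.finrank_tensorProduct] at h1
  have h2 : 0 < Module.finrank K E := Module.finrank_pos
  have h3 : Module.finrank K E = 1 := by nlinarith
  refine ⟨(algebraMap K E).injective, fun x ↦ ?_⟩
  have h4 := Subalgebra.bot_eq_top_of_finrank_eq_one h3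
  have h5 : x ∈ (⊥ : Subalgebra K E) := h4 ▸ trivial
  exact Algebra.mem_bot.mp h5

theorem isIntegral_of_smooth {K : Type u} [Field K] {X : Scheme.{u}} (p : X ⟶ Spec (.of K))
    [SmoothOfRelativeDimension 1 p] [QuasiCompact p] [ConnectedSpace X] : IsIntegral X := by
  have : Smooth p := SmoothOfRelativeDimension.smooth 1 p
  have : IsLocallyNoetherian X := LocallyOfFiniteType.isLocallyNoetherian p
  have : CompactSpace X := QuasiCompact.compactSpace_of_compactSpace p
  have : IsNoetherian X := {}
  have hdom : ∀ x : X, IsDomain (X.presheaf.stalk x) := by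
    intro x
    obtain ⟨φ, hφ⟩ := exists_isLocalLine (R := .of K) p x
    exact (hφ.isDomain_and_valuationRing (k := K)).1
  have := irreducibleSpace_of_isDomain_stalk hdom
  have : IsReduced X := by
    have (x : X) : _root_.IsReduced (X.presheaf.stalk x) := by
      have := hdom x
      infer_instance
    exact isReduced_of_isReduced_stalk X
  exact isIntegral_of_irreducibleSpace_of_isReduced X

/-- The global functions on a smooth proper geometrically connected curve are constant. -/
theorem bijective_globalFunctions {K : Type u} [Field K] [CharZero K] {X : Scheme.{u}}
    (p : X ⟶ Spec (.of K)) [SmoothOfRelativeDimension 1 p] [IsProper p] [GeometricallyConnected p] :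
    Function.Bijective ((Scheme.ΓSpecIso (.of K)).inv ≫ p.appTop).hom := by
  have : ConnectedSpace X := GeometricallyConnected.connectedSpace_of_subsingleton (f := p)
  have := isIntegral_of_smooth p
  let := (isField_of_universallyClosed K p).toField
  let F : K →+* Γ(X, ⊤) := ((Scheme.ΓSpecIso (.of K)).inv ≫ p.appTop).hom
  let : Algebra K Γ(X, ⊤) := F.toAlgebra
  have hfin : Module.Finite K Γ(X, ⊤) := by
    have h1 := finite_appTop_of_universallyClosed K p
    have h2 : ((Scheme.ΓSpecIso (.of K)).inv).hom.Finite :=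
      RingHom.Finite.of_surjective _
        ((ConcreteCategory.isIso_iff_bijective (Scheme.ΓSpecIso (.of K)).inv).mp inferInstance).2
    exact h1.comp h2
  let E : CommRingCat := Γ(X, ⊤)
  let F' : CommRingCat.of K ⟶ E := CommRingCat.ofHom F
  have hF : X.toSpecΓ ≫ Spec.map F' = p := by
    rw [show F' = (Scheme.ΓSpecIso (.of K)).inv ≫ p.appTop from rfl, Spec.map_comp, ← Category.assoc, ← Scheme.toSpecΓ_naturality,
      ← SpecMap_ΓSpecIso_hom, Category.assoc, ← Spec.map_comp, Iso.inv_hom_id, Spec.map_id,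
      Category.comp_id]
  -- The functions form a finite field extension `E` of `K`. The base change `X_E → Spec (E ⊗ E)` of
  -- this surjection is surjective with connected source, so the target is connected.
  have hsurj : Surjective X.toSpecΓ :=
    ⟨fun s ↦ ⟨Nonempty.some inferInstance, Subsingleton.elim (α := PrimeSpectrum Γ(X, ⊤)) _ _⟩⟩
  have hP : IsPullback _ _ (Spec.map F') (Spec.map F') :=
    isPullback_SpecMap_of_isPushout _ _ _ _ (CommRingCat.isPushout_tensorProduct K Γ(X, ⊤) Γ(X, ⊤))
  obtain ⟨Y, y₁, y₂, hY⟩ : ∃ (Y : Scheme.{u}) (y₁ : Y ⟶ X) (y₂ : Y ⟶ Spec E),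
    IsPullback y₁ y₂ p (Spec.map F') := ⟨_, _, _, .of_hasPullback _ _⟩
  have hconn : ConnectedSpace Y :=
    GeometricallyConnected.geometrically_connectedSpace (f := p) (K := Γ(X, ⊤)) _ _ _ hY
  have hF' : p = X.toSpecΓ ≫ Spec.map F' := hF.symm
  have h4 := IsPullback.of_bot' (v₁₂ := X.toSpecΓ) (v₂₂ := Spec.map F') (hF' ▸ hY) hP
  have h5 : Surjective (hP.lift _ _ _) := MorphismProperty.of_isPullback h4 hsurj
  have h6 : ConnectedSpace (PrimeSpectrum (Γ(X, ⊤) ⊗[K] Γ(X, ⊤))) :=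
    h5.surj.connectedSpace (Scheme.Hom.continuous _)
  exact bijective_algebraMap_of_preconnectedSpace

end GlobalFunctions

/-! ### Local divisibility in a Dedekind domain -/

section Divisibility

open IsLocalRing IsDedekindDomain

variable {R : Type*} [CommRing R] [IsDedekindDomain R]

/-- In the discrete valuation ring at `q` either `m` divides `r`, or `r` divides `m` with quotient
in the maximal ideal; `d` clears the denominator. -/
theorem exists_mul_eq_or (q : HeightOneSpectrum R) (r m : R) :
    ∃ t, ∃ d ∉ q.asIdeal, r * d = m * t ∨ m * d = r * t ∧ t ∈ q.asIdeal := by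
  let A := Localization.AtPrime q.asIdeal
  have hA : IsDiscreteValuationRing A :=
    IsLocalization.AtPrime.isDiscreteValuationRing_of_dedekind_domain R q.ne_bot A
  have key : ∀ r m : R, algebraMap R A m ∣ algebraMap R A r →
      ∃ z, ∃ t, ∃ d : q.asIdeal.primeCompl, z = IsLocalization.mk' A t d ∧
        algebraMap R A r = algebraMap R A m * z ∧ r * d = m * t := by
    rintro r m ⟨z, hz⟩
    obtain ⟨t, d, rfl⟩ := IsLocalization.exists_mk'_eq q.asIdeal.primeCompl z
    refine ⟨_, t, d, rfl, hz, ?_⟩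
    rw [IsLocalization.mul_mk'_eq_mk'_of_mul, IsLocalization.eq_mk'_iff_mul_eq, ← map_mul] at hz
    exact IsLocalization.injective A q.asIdeal.primeCompl_le_nonZeroDivisors hz
  by_cases h : algebraMap R A m ∣ algebraMap R A r
  · obtain ⟨-, t, d, -, -, h⟩ := key r m h
    exact ⟨t, d, d.2, .inl h⟩
  · obtain ⟨z, t, d, rfl, hz, h'⟩ := key m r ((ValuationRing.dvd_total _ _).resolve_right h)
    refine ⟨t, d, d.2, .inr ⟨h', ?_⟩⟩
    by_contra ht
    refine h ?_
    have hu : IsUnit (IsLocalization.mk' A t d) :=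
      (IsLocalization.AtPrime.isUnit_mk'_iff A q.asIdeal t d).mpr ht
    rw [hz]
    exact (hu.mul_right_dvd).mpr dvd_rfl

/-- Divisibility descends along a flat local extension: otherwise `r` divides `m` strictly at `q`,
and combined with `ψ m ∣ ψ r` this makes a unit times `ψ m` vanish. -/
theorem exists_mul_eq_of_map_dvd (q : HeightOneSpectrum R) {O : Type*} [CommRing O] [IsLocalRing O]
    (ψ : R →+* O) (hψ : ψ.Flat) (hq : (maximalIdeal O).comap ψ = q.asIdeal) {r m : R} (hm : m ≠ 0)
    (h : ψ m ∣ ψ r) : ∃ t, ∃ d ∉ q.asIdeal, r * d = m * t := by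
  obtain ⟨t, d, hd, h1 | ⟨h1, ht⟩⟩ := exists_mul_eq_or q r m
  · exact ⟨t, d, hd, h1⟩
  · exfalso
    obtain ⟨z, hz⟩ := h
    have hud : IsUnit (ψ d) := by
      by_contra h'
      have : ψ d ∈ maximalIdeal O := h'
      rw [← Ideal.mem_comap, hq] at this
      exact hd this
    have ht' : ψ t ∈ maximalIdeal O := by rwa [← Ideal.mem_comap, hq]
    have h2 : (ψ d - z * ψ t) * ψ m = 0 := by
      have := congrArg ψ h1
      rw [map_mul, map_mul, hz] at this
      linear_combination this
    have hu : IsUnit (ψ d - z * ψ t) := by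
      by_contra h'
      have h3 : ψ d - z * ψ t ∈ maximalIdeal O := h'
      have h4 : ψ d ∈ maximalIdeal O := by
        simpa using add_mem h3 (Ideal.mul_mem_left _ z ht')
      exact h4 hud
    exact hm (injective_of_flat ψ hψ ((hu.mul_right_eq_zero.mp h2).trans (map_zero ψ).symm))

/-- The ideal of all `d` with `m ∣ r d` lies in no maximal ideal. It contains `m ≠ 0`, so only
nonzero primes need checking. -/
theorem dvd_of_forall_exists {R : Type*} [CommRing R] [IsDomain R] (r : R) {m : R} (hm : m ≠ 0)
    (h : ∀ q : HeightOneSpectrum R, ∃ t, ∃ d ∉ q.asIdeal, r * d = m * t) : m ∣ r := by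
  let J : Ideal R := Submodule.comap (LinearMap.mulLeft R r) (Ideal.span {m})
  have hJ : ∀ d, d ∈ J ↔ m ∣ r * d := fun d ↦ Ideal.mem_span_singleton
  suffices J = ⊤ by
    have h1 := (hJ 1).mp (this ▸ trivial)
    rwa [mul_one] at h1
  by_contra hne
  obtain ⟨M, hM, hJM⟩ := Ideal.exists_le_maximal J hne
  have hmM : m ∈ M := hJM ((hJ m).mpr (dvd_mul_left _ _))
  obtain ⟨t, d, hd, hdt⟩ := h ⟨M, hM.isPrime, fun h0 ↦ hm (by simpa [h0] using hmM)⟩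
  exact hd (hJM ((hJ d).mpr ⟨t, hdt⟩))

end Divisibility

/-! ### Global functions on a smooth model -/

section GlobalFunctionsModel

open IsLocalRing

variable {K : Type u} [Field K] [NumberField K] {CK X : Scheme.{u}} {p : CK ⟶ Spec (.of K)}
  {g : X ⟶ Spec (.of (𝓞 K))} [SmoothOfRelativeDimension 1 g] {j : CK ⟶ X}

variable (g) in
theorem baseToStalk_flat (x : X) : (baseToStalk g x).Flat := by
  obtain ⟨φ, hφ⟩ := exists_isLocalLine (R := .of (𝓞 K)) g x
  exact hφ.flat_base

theorem comap_baseToStalk_eq {K : Type u} [Field K] (g : X ⟶ Spec (.of (𝓞 K))) {x : X} {q : IsDedekindDomain.HeightOneSpectrum (𝓞 K)}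
    (hx : g x = point q) : (maximalIdeal _).comap (baseToStalk g x) = q.asIdeal :=
  (comap_maximalIdeal_baseToStalk g x).trans congr(($hx).asIdeal)

variable (g) in
theorem isPrime_map_baseToStalk {x : X} {q : IsDedekindDomain.HeightOneSpectrum (𝓞 K)}
    (hx : g x = point q) : (q.asIdeal.map (baseToStalk g x)).IsPrime := by
  obtain ⟨φ, hφ⟩ := exists_isLocalLine (R := .of (𝓞 K)) g x
  have hqm : q.asIdeal.IsMaximal := q.isMaximal
  exact hφ.isPrime_map q.asIdeal (comap_baseToStalk_eq g hx)

theorem isDomain_stalk (g : X ⟶ Spec (.of (𝓞 K))) [SmoothOfRelativeDimension 1 g] (x : X) : IsDomain (X.presheaf.stalk x) := by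
  obtain ⟨φ, hφ⟩ := exists_isLocalLine (R := .of (𝓞 K)) g x
  rcases eq_bot_or_exists_eq_point (g x) with hx | ⟨q, hx⟩
  · exact (hφ.isDomain_and_valuationRing_of_comap_eq_bot (R := 𝓞 K)
      ((comap_maximalIdeal_baseToStalk g x).trans congr(($hx).asIdeal))).1
  · have hpr := isPrime_map_baseToStalk g hx
    have := hφ.noeth
    obtain ⟨π, -, hπ0, hπ⟩ := exists_map_eq_span q
    rw [hπ _ (comap_baseToStalk_eq g hx)] at hpr
    exact isDomain_of_isPrime_span_singleton
      (map_mem_nonZeroDivisors_of_flat (R := 𝓞 K) _ hφ.flat_base hπ0) hpr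

/-- Sections of a smooth curve over `𝓞 K` are determined by their restrictions to the generic
fibre. -/
theorem app_injective
    (h : IsPullback j p g (Spec.map (CommRingCat.ofHom (algebraMap (𝓞 K) K)))) (W : X.Opens) :
    Function.Injective (j.app W) := by
  have : Flat j := MorphismProperty.of_isPullback h.flip inferInstance
  have : IsPreimmersion j := MorphismProperty.of_isPullback h.flip inferInstance
  refine (injective_iff_map_eq_zero (j.app W).hom).mpr fun r hr ↦ ?_
  refine TopCat.Presheaf.section_ext X.sheaf W r 0 fun x hx ↦ ?_
  have := isDomain_stalk g x
  -- The zero ideal of the domain `𝒪_x` is a point of the generic fibre, where the stalks of `CK`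
  -- and `X` agree; a germ vanishing there is zero.
  obtain ⟨y, hy, hyP⟩ := exists_specializes_comap_eq x (⊥ : Ideal (X.presheaf.stalk x))
  have hgy : g y = (⊥ : PrimeSpectrum (𝓞 K)) := by
    refine PrimeSpectrum.ext (eq_bot_iff.mpr fun r hr ↦ ?_)
    rw [← comap_maximalIdeal_baseToStalk, Ideal.mem_comap, ← stalkSpecializes_baseToStalk g hy]
      at hr
    have h0 : baseToStalk g x r ∈ (⊥ : Ideal (X.presheaf.stalk x)) := hyP ▸ hr
    exact injective_of_flat (R := 𝓞 K) _ (baseToStalk_flat g x) (h0.trans (map_zero _).symm)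
  obtain ⟨z, rfl⟩ := exists_of_map_eq_bot h hgy
  have hzW : j z ∈ W := hy.mem_open W.2 hx
  have h1 : j.stalkMap z (X.presheaf.germ W (j z) hzW r) = 0 := by
    rw [Scheme.Hom.germ_stalkMap_apply, hr, map_zero]
  have h2 : X.presheaf.germ W (j z) hzW r = 0 := by
    have h3 := ((ConcreteCategory.isIso_iff_bijective _).mp (isIso_stalkMap_of_flat j z)).1
    exact h3 (h1.trans (map_zero _).symm)
  have h4 : X.presheaf.stalkSpecializes hy (X.presheaf.germ W x hx r) = 0 := by
    rw [← h2]
    exact TopCat.Presheaf.germ_stalkSpecializes_apply _ _ _ _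
  have h5 : X.presheaf.germ W x hx r ∈ (⊥ : Ideal (X.presheaf.stalk x)) := by
    rw [← hyP, Ideal.mem_comap]
    exact h4 ▸ zero_mem _
  exact h5.trans (map_zero _).symm

/-- The canonical map to the global functions. -/
def toGlobal {K : Type u} [Field K] (g : X ⟶ Spec (.of (𝓞 K))) : 𝓞 K →+* Γ(X, ⊤) :=
  ((Scheme.ΓSpecIso (.of (𝓞 K))).inv ≫ g.appTop).hom

theorem germ_toGlobal {K : Type u} [Field K] (g : X ⟶ Spec (.of (𝓞 K))) (x : X) (r : 𝓞 K) :
    X.presheaf.germ ⊤ x trivial (toGlobal g r) = baseToStalk g x r := by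
  rw [← germ_eq_baseToStalk g (V := ⊤) trivial]
  exact (TopCat.Presheaf.germ_res_apply X.presheaf (homOfLE (le_refl (⊤ : X.Opens))) x trivial
    (toGlobal g r)).symm

theorem appTop_toGlobal {K : Type u} [Field K] {CK X : Scheme.{u}} {p : CK ⟶ Spec (.of K)}
    {g : X ⟶ Spec (.of (𝓞 K))} {j : CK ⟶ X}
    (h : IsPullback j p g (Spec.map (CommRingCat.ofHom (algebraMap (𝓞 K) K)))) (r : 𝓞 K) :
    j.appTop (toGlobal g r) =
      ((Scheme.ΓSpecIso (.of K)).inv ≫ p.appTop).hom (algebraMap (𝓞 K) K r) := by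
  have h1 : ((Scheme.ΓSpecIso (.of (𝓞 K))).inv ≫ g.appTop) ≫ j.appTop =
      CommRingCat.ofHom (algebraMap (𝓞 K) K) ≫ (Scheme.ΓSpecIso (.of K)).inv ≫ p.appTop := by
    rw [Category.assoc, ← Scheme.Hom.comp_appTop, h.w, Scheme.Hom.comp_appTop,
      ← Scheme.ΓSpecIso_inv_naturality_assoc]
  exact congr($h1 r)

/-- On the generic fibre a global function is some `r / m`. Hence `m` divides `r` in the local ring
of a point over each `q`, so also locally at `q`, and therefore in `𝓞 K`. -/
theorem bijective_toGlobal
    (h : IsPullback j p g (Spec.map (CommRingCat.ofHom (algebraMap (𝓞 K) K))))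
    [SmoothOfRelativeDimension 1 p] [IsProper p] [GeometricallyConnected p]
    (hg : ∀ q, ∃ x, g x = point q) : Function.Bijective (toGlobal g) := by
  have hK := bijective_globalFunctions p
  set FK := ((Scheme.ΓSpecIso (.of K)).inv ≫ p.appTop).hom
  have hinj : Function.Injective (toGlobal g) := by
    intro a b hab
    have h1 := congrArg j.appTop hab
    rw [appTop_toGlobal h, appTop_toGlobal h] at h1
    exact IsFractionRing.injective (𝓞 K) K (hK.1 h1)
  refine ⟨hinj, fun s ↦ ?_⟩
  obtain ⟨a, ha⟩ := hK.2 (j.appTop s)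
  obtain ⟨r, m, hm, rfl⟩ := IsFractionRing.div_surjective (A := 𝓞 K) a
  have hm0 : m ≠ 0 := nonZeroDivisors.ne_zero hm
  have hmK : algebraMap (𝓞 K) K m ≠ 0 := by simpa using hm0
  have h1 : toGlobal g m * s = toGlobal g r := by
    apply app_injective h ⊤
    rw [map_mul]
    refine (congrArg₂ (· * ·) (appTop_toGlobal h m) ha.symm).trans
      (Eq.trans ?_ (appTop_toGlobal h r).symm)
    change FK _ * FK _ = FK _
    rw [← map_mul, mul_div_cancel₀ _ hmK]
  obtain ⟨c, rfl⟩ : m ∣ r := by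
    refine dvd_of_forall_exists r hm0 fun q ↦ ?_
    obtain ⟨x, hx⟩ := hg q
    refine exists_mul_eq_of_map_dvd q _ (baseToStalk_flat g x) (comap_baseToStalk_eq g hx) hm0
      ⟨X.presheaf.germ ⊤ x trivial s, ?_⟩
    rw [← germ_toGlobal, ← germ_toGlobal, ← h1, map_mul]
  refine ⟨c, app_injective h ⊤ ((appTop_toGlobal h c).trans (Eq.trans ?_ ha))⟩
  congr 1
  rw [map_mul, mul_div_cancel_left₀ _ hmK]

end GlobalFunctionsModel

/-! ### Frames of modules -/

section Frames

open Scheme.Modules TopologicalSpace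

variable {X : Scheme.{u}}

/-- The restriction of a section of an `𝒪_X`-module. -/
def res (M : X.Modules) {V W : X.Opens} (h : W ≤ V) (e : Γ(M, V)) : Γ(M, W) :=
  M.presheaf.map (homOfLE h).op e

/-- The restriction of a function. -/
abbrev resFun {V W : X.Opens} (h : W ≤ V) : Γ(X, V) →+* Γ(X, W) :=
  (X.presheaf.map (homOfLE h).op).hom

theorem res_smul (M : X.Modules) {V W : X.Opens} (h : W ≤ V) (r : Γ(X, V)) (e : Γ(M, V)) :
    res M h (r • e) = resFun h r • res M h e :=
  Scheme.Modules.map_smul M (homOfLE h) r e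

theorem res_res (M : X.Modules) {V W T : X.Opens} (h : W ≤ V) (h' : T ≤ W) (e : Γ(M, V)) :
    res M h' (res M h e) = res M (h'.trans h) e := by
  have : M.presheaf.map (homOfLE h).op ≫ M.presheaf.map (homOfLE h').op =
    M.presheaf.map (homOfLE (h'.trans h)).op := (M.presheaf.map_comp _ _).symm
  exact congr($this e)

theorem resFun_resFun {V W T : X.Opens} (h : W ≤ V) (h' : T ≤ W) (r : Γ(X, V)) :
    resFun h' (resFun h r) = resFun (h'.trans h) r := by
  have : X.presheaf.map (homOfLE h).op ≫ X.presheaf.map (homOfLE h').op =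
    X.presheaf.map (homOfLE (h'.trans h)).op := (X.presheaf.map_comp _ _).symm
  exact congr($this r)

theorem resFun_self {V : X.Opens} (h : V ≤ V) (r : Γ(X, V)) : resFun h r = r := by
  have : X.presheaf.map (homOfLE h).op = 𝟙 _ := X.presheaf.map_id _
  exact congr($this r)

theorem app_res {M N : X.Modules} (φ : M ⟶ N) {V W : X.Opens} (h : W ≤ V) (e : Γ(M, V)) :
    φ.app W (res M h e) = res N h (φ.app V e) := by
  have := φ.mapPresheaf.naturality (homOfLE h).op
  exact congr($this e)

/-- A section generating `M` freely over an open. -/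
def IsFrame (M : X.Modules) (V : X.Opens) (e : Γ(M, V)) : Prop :=
  ∀ (W : X.Opens) (h : W ≤ V), Function.Bijective fun r : Γ(X, W) ↦ r • res M h e

theorem IsFrame.res {M : X.Modules} {V W : X.Opens} {e : Γ(M, V)} (he : IsFrame M V e) (h : W ≤ V) :
    IsFrame M W (res M h e) := by
  intro T hT
  simp only [res_res]
  exact he T (hT.trans h)

/-- The frame is the image of `1` under a local trivialization, shrunk to an affine open. -/
theorem exists_isFrame {L : X.Modules} (hL : IsLineBundle L) (x : X) :
    ∃ (V : X.Opens) (_ : IsAffineOpen V) (_ : x ∈ V) (e : Γ(L, V)), IsFrame L V e := by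
  obtain ⟨V, hx, ⟨ε⟩⟩ := hL x
  let e : Γ(L, V.ι ''ᵁ ⊤) := ε.inv.app ⊤ (1 : Γ((V : Scheme.{u}), ⊤))
  have he : IsFrame L (V.ι ''ᵁ ⊤) e := by
    intro W hW
    obtain ⟨W, rfl⟩ : ∃ W', W = V.ι ''ᵁ W' := ⟨V.ι ⁻¹ᵁ W, by
      rw [Scheme.Hom.image_preimage_eq_opensRange_inf, eq_comm, inf_eq_right]
      exact hW.trans (Scheme.Hom.image_le_opensRange _ _)⟩
    have h1 : (fun r : Γ(X, V.ι ''ᵁ W) ↦ r • PicU.res L hW e) =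
        ε.inv.app W ∘ (V.ι.appIso W).hom := by
      funext r
      have h2 : PicU.res L hW e = ε.inv.app W (1 : Γ((V : Scheme.{u}), W)) := by
        refine (app_res ε.inv (le_top : W ≤ ⊤) (1 : Γ((V : Scheme.{u}), ⊤))).symm.trans ?_
        exact congrArg (ε.inv.app W) (map_one (resFun (le_top : W ≤ ⊤)))
      let r' : Γ((V : Scheme.{u}), W) := (V.ι.appIso W).hom r
      have h3 := Scheme.Modules.Hom.app_smul ε.inv (U := W) r' (1 : Γ((V : Scheme.{u}), W))
      have h4 : r = (V.ι.appIso W).inv r' := (congr($((V.ι.appIso W).hom_inv_id) r)).symm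
      refine Eq.trans ?_ (h3.symm.trans (congrArg (ε.inv.app W) (mul_one r')))
      conv_lhs => rw [h4, h2]
      rfl
    rw [h1]
    exact ((ConcreteCategory.isIso_iff_bijective (ε.inv.app W)).mp inferInstance).comp
      ((ConcreteCategory.isIso_iff_bijective (V.ι.appIso W).hom).mp inferInstance)
  have hxV : x ∈ V.ι ''ᵁ ⊤ := by simpa using hx
  obtain ⟨_, ⟨W, hW, rfl⟩, hxW, hWV⟩ := X.isBasis_affineOpens.exists_subset_of_mem_open hxV
    (V.ι ''ᵁ ⊤).isOpen
  exact ⟨W, hW, hxW, _, he.res hWV⟩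

/-- Injectivity on every smaller open makes local coefficients unique, so they agree on overlaps and
glue. -/
theorem isFrame_of_locally {M : X.Modules} {V : X.Opens} {e : Γ(M, V)}
    (hinj : ∀ (W : X.Opens) (h : W ≤ V) (r : Γ(X, W)), r • res M h e = 0 → r = 0)
    (hsurj : ∀ (W : X.Opens) (h : W ≤ V) (t : Γ(M, W)), ∀ x ∈ W, ∃ (T : X.Opens) (hT : T ≤ W)
      (_ : x ∈ T) (r : Γ(X, T)), r • res M (hT.trans h) e = res M hT t) : IsFrame M V e := by
  intro W hW
  have hinj' : ∀ (T : X.Opens) (h : T ≤ V) (r r' : Γ(X, T)), r • res M h e = r' • res M h e →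
      r = r' := fun T h r r' hr ↦ sub_eq_zero.mp (hinj T h _ (by rw [sub_smul, hr, sub_self]))
  refine ⟨fun r r' ↦ hinj' W hW r r', fun t ↦ ?_⟩
  choose T hT hxT r hr using fun x : W ↦ hsurj W hW t x x.2
  have hcov : W ≤ iSup T := fun x hx ↦ Opens.mem_iSup.mpr ⟨⟨x, hx⟩, hxT ⟨x, hx⟩⟩
  obtain ⟨(s : Γ(X, W)), hs, -⟩ := X.sheaf.existsUnique_gluing' T W (fun x ↦ homOfLE (hT x)) hcov r
    fun x y ↦ by
      refine hinj' (T x ⊓ T y) (inf_le_left.trans ((hT x).trans hW)) _ _ ?_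
      have h1 := congrArg (res M (inf_le_left : T x ⊓ T y ≤ T x)) (hr x)
      have h2 := congrArg (res M (inf_le_right : T x ⊓ T y ≤ T y)) (hr y)
      rw [res_smul, res_res, res_res] at h1 h2
      exact h1.trans h2.symm
  refine ⟨s, TopCat.Sheaf.eq_of_locally_eq' ⟨M.presheaf, M.isSheaf⟩ T W (fun x ↦ homOfLE (hT x))
    hcov _ _ fun x ↦ ?_⟩
  change res M (hT x) (s • res M hW e) = res M (hT x) t
  rw [res_smul, res_res, ← hr x]
  congr 1
  exact hs x

theorem IsFrame.isTrivial {M : X.Modules} {e : Γ(M, ⊤)} (he : IsFrame M ⊤ e) : IsTrivial M := by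
  let σ : SheafOfModules.sections M := PresheafOfModules.sectionsMk
    (fun V ↦ PicU.res M (le_top : V.unop ≤ ⊤) e) fun V W i ↦ res_res M le_top i.unop.le e
  let φ : structureSheaf X ⟶ M := (SheafOfModules.unitHomEquiv M).symm σ
  have hφ : ∀ (V : X.Opens) (r : Γ(X, V)), φ.app V r = r • PicU.res M le_top e := fun V r ↦ rfl
  have : IsIso φ := by
    rw [Scheme.Modules.Hom.isIso_iff_isIso_app]
    intro V
    refine (ConcreteCategory.isIso_iff_bijective _).mpr ?_
    exact he V le_top
  exact ⟨(asIso φ).symm⟩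

theorem exists_res_eq (M : X.Modules) {ι : Type*} (V : ι → X.Opens) (hV : ∀ x, ∃ i, x ∈ V i)
    (e : ∀ i, Γ(M, V i))
    (he : ∀ i j, res M inf_le_left (e i) = res M (inf_le_right : V i ⊓ V j ≤ V j) (e j)) :
    ∃ s : Γ(M, ⊤), ∀ i, res M le_top s = e i := by
  obtain ⟨s, hs, -⟩ := TopCat.Sheaf.existsUnique_gluing' ⟨M.presheaf, M.isSheaf⟩ V ⊤
    (fun i ↦ homOfLE le_top) (fun x _ ↦ Opens.mem_iSup.mpr (hV x)) e he
  exact ⟨s, hs⟩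

/-- A section which is a frame locally is a frame. -/
theorem isFrame_of_forall_exists {M : X.Modules} {V : X.Opens} {e : Γ(M, V)}
    (h : ∀ x ∈ V, ∃ (W : X.Opens) (hW : W ≤ V), x ∈ W ∧ IsFrame M W (res M hW e)) :
    IsFrame M V e := by
  refine isFrame_of_locally (fun W hW r hr ↦ ?_) fun W hW t x hx ↦ ?_
  · choose T hT hxT hfr using fun x : W ↦ h x (hW x.2)
    refine X.sheaf.eq_of_locally_eq' (fun x ↦ T x ⊓ W) W (fun x ↦ homOfLE inf_le_right)
      (fun x hx ↦ Opens.mem_iSup.mpr ⟨⟨x, hx⟩, hxT ⟨x, hx⟩, hx⟩) _ _ fun x ↦ ?_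
    refine (hfr x (T x ⊓ W) inf_le_left).1 ?_
    have h1 := congrArg (res M (inf_le_right : T x ⊓ W ≤ W)) hr
    rw [res_smul, res_res] at h1
    simp only [res_res]
    refine h1.trans ?_
    change res M _ 0 = resFun _ 0 • _
    rw [map_zero, zero_smul]
    exact map_zero (M.presheaf.map _).hom
  · obtain ⟨T, hT, hxT, hfr⟩ := h x (hW hx)
    obtain ⟨r, hr⟩ := (hfr (T ⊓ W) inf_le_left).2 (res M inf_le_right t)
    refine ⟨T ⊓ W, inf_le_right, ⟨hxT, hx⟩, r, ?_⟩
    rw [← hr]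
    simp only [res_res]

end Frames

/-! ### Tensor powers of sections through the sheafification -/

section TensorPowers

open Scheme.Modules TopologicalSpace Opposite
open scoped TensorProduct

variable {X : Scheme.{u}}

/-- The presheaf tensor product of two `𝒪_X`-modules. -/
def preTensor (M N : X.Modules) : PresheafOfModules (X.presheaf ⋙ forget₂ CommRingCat RingCat) :=
  PresheafOfModules.Monoidal.tensorObj (R := X.presheaf)
      ((Scheme.Modules.toPresheafOfModules X).obj M) ((Scheme.Modules.toPresheafOfModules X).obj N)

/-- The map from the presheaf tensor product to its sheafification. -/
def preTensorUnit (M N : X.Modules) :=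
  (PresheafOfModules.sheafificationAdjunction (𝟙 X.ringCatSheaf.obj)).unit.app (preTensor M N)

/-- The underlying additive map is that of the sheafification of abelian presheaves, so its local
injectivity and surjectivity are available. -/
def toTensor (M N : X.Modules) (V : X.Opens) :
    Γ(M, V) ⊗[Γ(X, V)] Γ(N, V) →ₗ[Γ(X, V)] Γ(tensorObj M N, V) where
  toFun t := (CategoryTheory.toSheafify (Opens.grothendieckTopology X) (preTensor M N).presheaf).app
    (op V) t
  map_add' s t := map_add ((CategoryTheory.toSheafify (Opens.grothendieckTopology X)
    (preTensor M N).presheaf).app (op V)).hom s t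
  map_smul' r t := ((preTensorUnit M N).app (op V)).hom.map_smul r t

def preRes (M N : X.Modules) {V W : X.Opens} (h : W ≤ V) :
    Γ(M, V) ⊗[Γ(X, V)] Γ(N, V) →+ Γ(M, W) ⊗[Γ(X, W)] Γ(N, W) :=
  ((preTensor M N).presheaf.map (homOfLE h).op).hom

theorem preRes_tmul (M N : X.Modules) {V W : X.Opens} (h : W ≤ V) (m : Γ(M, V)) (n : Γ(N, V)) :
    preRes M N h (m ⊗ₜ n) = res M h m ⊗ₜ res N h n := rfl

theorem res_toTensor (M N : X.Modules) {V W : X.Opens} (h : W ≤ V)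
    (t : Γ(M, V) ⊗[Γ(X, V)] Γ(N, V)) :
    res (tensorObj M N) h (toTensor M N V t) = toTensor M N W (preRes M N h t) := by
  have := (CategoryTheory.toSheafify (Opens.grothendieckTopology X)
    (preTensor M N).presheaf).naturality (homOfLE h).op
  exact (congr($this t)).symm

theorem toTensor_injective_locally (M N : X.Modules) {V : X.Opens}
    {t : Γ(M, V) ⊗[Γ(X, V)] Γ(N, V)} (ht : toTensor M N V t = 0) {x : X} (hx : x ∈ V) :
    ∃ (W : X.Opens) (h : W ≤ V), x ∈ W ∧ preRes M N h t = 0 := by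
  have h1 := Presheaf.equalizerSieve_mem (Opens.grothendieckTopology X)
    (CategoryTheory.toSheafify (Opens.grothendieckTopology X) (preTensor M N).presheaf)
    (X := op V) t 0 (by exact ht.trans (map_zero (toTensor M N V)).symm)
  obtain ⟨W, i, hi, hxW⟩ := h1 x hx
  exact ⟨W, i.le, hxW, hi.trans (map_zero (preRes M N i.le))⟩

theorem toTensor_surjective_locally (M N : X.Modules) {V : X.Opens}
    (t : Γ(tensorObj M N, V)) {x : X} (hx : x ∈ V) :
    ∃ (W : X.Opens) (h : W ≤ V), x ∈ W ∧ ∃ s, toTensor M N W s = res _ h t := by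
  have h1 := Presheaf.imageSieve_mem (Opens.grothendieckTopology X)
    (CategoryTheory.toSheafify (Opens.grothendieckTopology X) (preTensor M N).presheaf)
    (U := op V) t
  obtain ⟨W, i, ⟨s, hs⟩, hxW⟩ := h1 x hx
  exact ⟨W, i.le, hxW, s, hs⟩

/-- The tensor product of two sections. -/
def tmul {M N : X.Modules} {V : X.Opens} (m : Γ(M, V)) (n : Γ(N, V)) : Γ(tensorObj M N, V) :=
  toTensor M N V (m ⊗ₜ n)

theorem res_tmul {M N : X.Modules} {V W : X.Opens} (h : W ≤ V) (m : Γ(M, V)) (n : Γ(N, V)) :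
    res _ h (tmul m n) = tmul (res M h m) (res N h n) :=
  res_toTensor M N h (m ⊗ₜ n)

theorem smul_tmul_smul {M N : X.Modules} {V : X.Opens} (r s : Γ(X, V)) (m : Γ(M, V))
    (n : Γ(N, V)) : tmul (r • m) (s • n) = (r * s) • tmul m n := by
  rw [tmul, TensorProduct.smul_tmul_smul, _root_.map_smul, tmul]

theorem bijective_smul_tmul {R M N : Type*} [CommRing R] [AddCommGroup M] [Module R M]
    [AddCommGroup N] [Module R N] {m : M} {n : N} (hm : Function.Bijective fun r : R ↦ r • m)
    (hn : Function.Bijective fun r : R ↦ r • n) :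
    Function.Bijective fun r : R ↦ r • (m ⊗ₜ[R] n) := by
  let em := LinearEquiv.ofBijective (LinearMap.toSpanSingleton R M m) hm
  let en := LinearEquiv.ofBijective (LinearMap.toSpanSingleton R N n) hn
  let E := (TensorProduct.lid R R).symm.trans (TensorProduct.congr em en)
  have hE : (fun r : R ↦ r • (m ⊗ₜ[R] n)) = E := by
    funext r
    change r • (m ⊗ₜ[R] n) = ((1 : R) • m) ⊗ₜ[R] (r • n)
    rw [one_smul, TensorProduct.tmul_smul]
  rw [hE]
  exact E.bijective

/-- Before sheafification the tensor of two frames generates freely over every smaller open. This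
survives because the sheafification map is locally injective and locally surjective. -/
theorem IsFrame.tmul {M N : X.Modules} {V : X.Opens} {m : Γ(M, V)} {n : Γ(N, V)}
    (hm : IsFrame M V m) (hn : IsFrame N V n) : IsFrame (tensorObj M N) V (tmul m n) := by
  have hb : ∀ (W : X.Opens) (h : W ≤ V), Function.Bijective fun r : Γ(X, W) ↦
      r • (PicU.res M h m ⊗ₜ[Γ(X, W)] PicU.res N h n) := fun W h ↦
    bijective_smul_tmul (hm W h) (hn W h)
  refine isFrame_of_locally (fun W hW r hr ↦ ?_) fun W hW t x hx ↦ ?_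
  · rw [res_tmul, PicU.tmul, ← _root_.map_smul] at hr
    choose T hT hxT hr using fun x : W ↦ toTensor_injective_locally M N hr x.2
    refine X.sheaf.eq_of_locally_eq' T W (fun x ↦ homOfLE (hT x))
      (fun x hx ↦ Opens.mem_iSup.mpr ⟨⟨x, hx⟩, hxT ⟨x, hx⟩⟩) _ _ fun x ↦ ?_
    refine (hb (T x) ((hT x).trans hW)).1 ?_
    have h1 := hr x
    rw [TensorProduct.smul_tmul', preRes_tmul, res_smul, ← TensorProduct.smul_tmul',
      res_res, res_res] at h1
    refine h1.trans ?_
    change 0 = resFun _ 0 • _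
    rw [map_zero, zero_smul]
  · obtain ⟨T, hT, hxT, s, hs⟩ := toTensor_surjective_locally M N t hx
    obtain ⟨r, rfl⟩ := (hb T (hT.trans hW)).2 s
    refine ⟨T, hT, hxT, r, ?_⟩
    rw [← hs, res_tmul, PicU.tmul, ← _root_.map_smul]

/-- The tensor power of a section. -/
def tpow {M : X.Modules} {V : X.Opens} (m : Γ(M, V)) : (n : ℕ) → Γ(tensorPow M n, V)
  | 0 => (1 : Γ(X, V))
  | n + 1 => tmul (tpow m n) m

theorem res_tpow {M : X.Modules} {V W : X.Opens} (h : W ≤ V) (m : Γ(M, V)) (n : ℕ) :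
    res _ h (tpow m n) = tpow (res M h m) n := by
  induction n with
  | zero => exact map_one (resFun h)
  | succ n ih => exact (res_tmul h _ _).trans (by rw [ih]; rfl)

theorem tpow_smul {M : X.Modules} {V : X.Opens} (r : Γ(X, V)) (m : Γ(M, V)) (n : ℕ) :
    tpow (r • m) n = r ^ n • tpow m n := by
  induction n with
  | zero =>
    rw [pow_zero, one_smul]
    rfl
  | succ n ih =>
    change PicU.tmul _ _ = _
    rw [ih, smul_tmul_smul, ← pow_succ]
    rfl

theorem IsFrame.tpow {M : X.Modules} {V : X.Opens} {m : Γ(M, V)} (hm : IsFrame M V m) (n : ℕ) :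
    IsFrame (tensorPow M n) V (tpow m n) := by
  induction n with
  | zero =>
    intro W hW
    have h1 : (fun r : Γ(X, W) ↦ r • PicU.res (tensorPow M 0) hW (PicU.tpow m 0)) = fun r ↦ r := by
      funext r
      exact (congrArg (r * ·) (map_one (resFun hW))).trans (mul_one r)
    rw [h1]
    exact Function.bijective_id
  | succ n ih => exact ih.tmul hm

theorem IsFrame.smul {M : X.Modules} {V : X.Opens} {m : Γ(M, V)} (hm : IsFrame M V m)
    {r : Γ(X, V)} (hr : IsUnit r) : IsFrame M V (r • m) := by
  intro W hW
  have h1 : (fun s : Γ(X, W) ↦ s • PicU.res M hW (r • m)) =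
      (fun s ↦ s • PicU.res M hW m) ∘ fun s ↦ s * resFun hW r := by
    funext s
    rw [res_smul, smul_smul]
    rfl
  rw [h1]
  exact (hm W hW).comp (IsUnit.isUnit_iff_mulRight_bijective.mp (hr.map (resFun hW)))

end TensorPowers

/-! ### Units attached to a trivialization on the generic fibre -/

section Trivializations

open Scheme.Modules TopologicalSpace

variable {Y X : Scheme.{u}} (j : Y ⟶ X)

/-- The map `𝒪_X ⟶ j_* 𝒪_Y`. -/
def unitToPushforward : structureSheaf X ⟶ (Scheme.Modules.pushforward j).obj (structureSheaf Y) :=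
  SheafOfModules.unitToPushforwardObjUnit j.toRingCatSheafHom

theorem unitToPushforward_app (V : X.Opens) (r : Γ(X, V)) :
    (unitToPushforward j).app V r = j.app V r := rfl

theorem app_resFun {V W : X.Opens} (h : W ≤ V) (r : Γ(X, V)) :
    j.app W (resFun h r) = resFun (j.preimage_mono h) (j.app V r) :=
  congr($(j.naturality (homOfLE h).op) r)

variable {j} {L : X.Modules} (Φ : L ⟶ (Scheme.Modules.pushforward j).obj (structureSheaf Y))

/-- The function attached to a section by a map to `j_* 𝒪_Y`. -/
def toFun (V : X.Opens) (e : Γ(L, V)) : Γ(Y, j ⁻¹ᵁ V) := Φ.app V e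

theorem toFun_smul {V : X.Opens} (r : Γ(X, V)) (e : Γ(L, V)) :
    toFun Φ V (r • e) = j.app V r * toFun Φ V e :=
  Scheme.Modules.Hom.app_smul Φ r e

theorem toFun_res {V W : X.Opens} (h : W ≤ V) (e : Γ(L, V)) :
    toFun Φ W (res L h e) = resFun (j.preimage_mono h) (toFun Φ V e) :=
  app_res Φ h e

/-- A trivialization of the pull-back of `L` takes frames of `L` to units. -/
theorem isUnit_toFun (θ : (Scheme.Modules.pullback j).obj L ≅ structureSheaf Y) {V : X.Opens}
    {e : Γ(L, V)} (he : IsFrame L V e) :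
    IsUnit (toFun ((pullbackPushforwardAdjunction j).homEquiv _ _ θ.hom) V e) := by
  set Φ := (pullbackPushforwardAdjunction j).homEquiv _ _ θ.hom with hΦ
  refine Y.toRingedSpace.isUnit_of_isUnit_germ _ _ fun y hy ↦ ?_
  by_contra hu
  -- If the function vanished at `y`, the composite `L ⟶ j_* 𝒪_Y ⟶ j_* k_* κ(y)` would be zero,
  -- because `e` generates `L` near `j y`. By adjunction and invertibility of `θ` the evaluation
  -- `𝒪_Y ⟶ k_* κ(y)` would vanish, although it sends `1` to `1 ≠ 0`.
  let k := Y.fromSpecResidueField y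
  have hk : ∀ x, k x = y := fun x ↦ by
    have h1 : k x ∈ Set.range k := ⟨x, rfl⟩
    rwa [Scheme.range_fromSpecResidueField] at h1
  have ha : k.app (j ⁻¹ᵁ V) (toFun Φ V e) = 0 := by
    rw [← basicOpen_eq_bot_iff, ← Scheme.preimage_basicOpen]
    refine Opens.ext (Set.eq_empty_of_forall_notMem fun x hx ↦ hu ?_)
    have h1 : k x ∈ Y.basicOpen (toFun Φ V e) := hx
    rw [hk] at h1
    exact (Scheme.mem_basicOpen _ _ _ hy).mp h1
  have h0 : Φ ≫ (Scheme.Modules.pushforward j).map (unitToPushforward k) = 0 := by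
    apply Scheme.Modules.hom_ext
    intro W
    ext s
    change k.app (j ⁻¹ᵁ W) (toFun Φ W s) = 0
    have hle : k ⁻¹ᵁ j ⁻¹ᵁ W ≤ k ⁻¹ᵁ j ⁻¹ᵁ (W ⊓ V) := fun x hx ↦
      ⟨hx, by change j (k x) ∈ V; rw [hk]; exact hy⟩
    rw [← resFun_self le_rfl (k.app (j ⁻¹ᵁ W) (toFun Φ W s)),
      ← resFun_resFun (k.preimage_mono (j.preimage_mono (inf_le_left : W ⊓ V ≤ W))) hle]
    obtain ⟨r, hr⟩ := (he (W ⊓ V) inf_le_right).2 (res L inf_le_left s)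
    have h1 : resFun (k.preimage_mono (j.preimage_mono (inf_le_left : W ⊓ V ≤ W)))
        (k.app (j ⁻¹ᵁ W) (toFun Φ W s)) = 0 := by
      refine (app_resFun k (j.preimage_mono (inf_le_left : W ⊓ V ≤ W)) _).symm.trans ?_
      rw [← toFun_res Φ (inf_le_left : W ⊓ V ≤ W), ← hr, toFun_smul, toFun_res, map_mul]
      refine (congrArg (_ * ·) ((app_resFun k _ _).trans (congrArg _ ha))).trans ?_
      rw [map_zero, mul_zero]
    rw [h1, map_zero]
  have h1 : θ.hom ≫ unitToPushforward k = 0 := by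
    apply ((pullbackPushforwardAdjunction j).homEquiv _ _).injective
    rw [Adjunction.homEquiv_naturality_right, ← hΦ, h0, Adjunction.homEquiv_unit, Functor.map_zero, comp_zero]
  have h2 : unitToPushforward k = 0 := by
    rw [← cancel_epi θ.hom, h1, comp_zero]
  have h3 : (unitToPushforward k).app ⊤ (1 : Γ(Y, ⊤)) = (0 : structureSheaf Y ⟶ _).app ⊤ (1 : Γ(Y, ⊤)) := by
    rw [h2]
  rw [unitToPushforward_app, map_one] at h3
  have h4 : (1 : Γ(Spec (Y.residueField y), k ⁻¹ᵁ ⊤)) = 0 := h3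
  have : Nonempty (k ⁻¹ᵁ ⊤) := ⟨⟨IsLocalRing.closedPoint _, trivial⟩⟩
  have := Scheme.component_nontrivial (Spec (Y.residueField y)) (k ⁻¹ᵁ ⊤)
  exact one_ne_zero h4

end Trivializations

/-! ### Denominators of functions on the generic fibre -/

section Denominators

/-- If `K'` consists of fractions of `R` with denominators in `S`, so does `K' ⊗ A` over `A`. -/
theorem exists_eq_mul_of_isPushout {R A K' B : CommRingCat.{u}} {a : R ⟶ A} {k : R ⟶ K'}
    {b : A ⟶ B} {c : K' ⟶ B} (h : IsPushout a k b c) (S : Submonoid R)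
    (hk : ∀ z, ∃ s ∈ S, ∃ r, k r = k s * z) (x : B) : ∃ s ∈ S, ∃ α, b α = b (a s) * x := by
  -- The elements with a denominator form a subring through which both structure maps factor, so by
  -- the universal property of the pushout it is all of `B`.
  let T : Subring B :=
    { carrier := {x | ∃ s ∈ S, ∃ α, b α = b (a s) * x}
      mul_mem' := fun {x y} ⟨s, hs, α, hα⟩ ⟨t, ht, β, hβ⟩ ↦
        ⟨s * t, mul_mem hs ht, α * β, by simp only [map_mul, hα, hβ]; ring⟩
      one_mem' := ⟨1, S.one_mem, 1, by simp⟩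
      add_mem' := fun {x y} ⟨s, hs, α, hα⟩ ⟨t, ht, β, hβ⟩ ↦
        ⟨s * t, mul_mem hs ht, a t * α + a s * β, by simp only [map_mul, map_add, hα, hβ]; ring⟩
      zero_mem' := ⟨1, S.one_mem, 0, by simp⟩
      neg_mem' := fun {x} ⟨s, hs, α, hα⟩ ↦ ⟨s, hs, -α, by simp [hα]⟩ }
  let b' : A ⟶ CommRingCat.of T :=
    CommRingCat.ofHom (b.hom.codRestrict T fun α ↦ ⟨1, S.one_mem, α, by simp⟩)
  let c' : K' ⟶ CommRingCat.of T := CommRingCat.ofHom (c.hom.codRestrict T fun z ↦ by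
    obtain ⟨s, hs, r, hr⟩ := hk z
    refine ⟨s, hs, a r, ?_⟩
    have h1 : ∀ r, b (a r) = c (k r) := fun r ↦ congr($(h.w) r)
    rw [h1, h1, hr, map_mul])
  let ι : CommRingCat.of T ⟶ B := CommRingCat.ofHom T.subtype
  have hb : b' ≫ ι = b := rfl
  have hc : c' ≫ ι = c := rfl
  have hw : a ≫ b' = k ≫ c' := by
    exact CommRingCat.hom_ext (RingHom.ext fun r ↦ Subtype.ext congr($(h.w) r))
  have h1 : h.desc b' c' hw ≫ ι = 𝟙 _ := by
    apply h.hom_ext <;> simp [hb, hc]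
  have h2 : ι (h.desc b' c' hw x) = x := congr($h1 x)
  rw [← h2]
  exact (h.desc b' c' hw x).2

variable {K : Type u} [Field K] {CK X : Scheme.{u}} {p : CK ⟶ Spec (.of K)}
  {g : X ⟶ Spec (.of (𝓞 K))} {j : CK ⟶ X}

/-- The canonical map to the functions on an open. -/
def toSections (g : X ⟶ Spec (.of (𝓞 K))) (V : X.Opens) : 𝓞 K →+* Γ(X, V) :=
  (resFun le_top).comp (toGlobal g)

theorem germ_toSections (g : X ⟶ Spec (.of (𝓞 K))) {V : X.Opens} {x : X} (hx : x ∈ V) (r : 𝓞 K) :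
    X.presheaf.germ V x hx (toSections g V r) = baseToStalk g x r :=
  germ_eq_baseToStalk g hx r

theorem resFun_toSections (g : X ⟶ Spec (.of (𝓞 K))) {V W : X.Opens} (h : W ≤ V) (r : 𝓞 K) :
    resFun h (toSections g V r) = toSections g W r :=
  resFun_resFun le_top h (toGlobal g r)

/-- A function on the generic fibre of an affine open has a denominator in `𝓞 K`. -/
theorem exists_app_eq_mul [NumberField K]
    (h : IsPullback j p g (Spec.map (CommRingCat.ofHom (algebraMap (𝓞 K) K))))
    {V : X.Opens} (hV : IsAffineOpen V) (a : Γ(CK, j ⁻¹ᵁ V)) :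
    ∃ m : 𝓞 K, m ≠ 0 ∧ ∃ α, j.app V α = j.app V (toSections g V m) * a := by
  have hP := (isIso_pushoutSection_iff h (US := ⊤) (UT := ⊤) (UX := V) (UY := j ⁻¹ᵁ V) le_top le_top
    (by simp)).mp (isIso_pushoutSection_of_isAffineOpen _ _ _ _ (isAffineOpen_top _)
      (isAffineOpen_top _) hV)
  let e := (Scheme.ΓSpecIso (.of (𝓞 K))).commRingCatIsoToRingEquiv
  let e' := (Scheme.ΓSpecIso (.of K)).commRingCatIsoToRingEquiv
  obtain ⟨s, hs, α, hα⟩ := exists_eq_mul_of_isPushout hP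
    ((nonZeroDivisors (𝓞 K)).comap e) (fun z ↦ by
      obtain ⟨r, m, hm, hrm⟩ := IsFractionRing.div_surjective (A := 𝓞 K) (e' z)
      refine ⟨e.symm m, by simpa using hm, e.symm r, ?_⟩
      have h1 : ∀ r : 𝓞 K, (Spec.map (CommRingCat.ofHom (algebraMap (𝓞 K) K))).appLE ⊤ ⊤ le_top
          (e.symm r) = e'.symm (algebraMap _ K r) := fun r ↦ by
        have h2 := Scheme.ΓSpecIso_inv_naturality (CommRingCat.ofHom (algebraMap (𝓞 K) K))
        exact congr($(Scheme.Hom.appLE_eq_app (f := Spec.map (CommRingCat.ofHom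
          (algebraMap (𝓞 K) K))) (U := ⊤)) (e.symm r)).trans congr($h2 r).symm
      rw [h1, h1, eq_comm, e'.eq_symm_apply, map_mul, e'.apply_symm_apply, ← hrm,
        mul_div_cancel₀]
      simpa using hm) a
  refine ⟨e s, nonZeroDivisors.ne_zero hs, α, ?_⟩
  have h2 : toSections g V (e s) = g.appLE ⊤ V le_top s := by
    have h3 : (Scheme.ΓSpecIso (.of (𝓞 K))).inv (e s) = s := e.symm_apply_apply s
    change resFun le_top (g.appTop ((Scheme.ΓSpecIso (.of (𝓞 K))).inv (e s))) = _
    rw [h3]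
    rfl
  rw [h2]
  simpa only [Scheme.Hom.appLE_eq_app] using hα

end Denominators

/-! ### Divisors supported in fibres, and the class number -/

section VerticalDivisors

open IsLocalRing IsDedekindDomain

theorem map_eq_top_of_not_le {R O : Type*} [CommRing R] [CommRing O] [IsLocalRing O] {ψ : R →+* O} {P : Ideal R} (hP : (maximalIdeal O).comap ψ = P)
    {I : Ideal R} (hI : ¬ I ≤ P) : I.map ψ = ⊤ := by
  by_contra h
  exact hI (hP ▸ Ideal.le_comap_of_map_le (le_maximalIdeal h))

variable {R : Type u} [CommRing R] [IsDedekindDomain R] {O : Type u} [CommRing O] [IsLocalRing O]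

/-- A divisor of a nonzero element of `R` generates a power of the prime above `q`. -/
theorem exists_span_eq_map_pow [IsDomain O] {ψ : R →+* O} (q : HeightOneSpectrum R)
    (hq : (maximalIdeal O).comap ψ = q.asIdeal) (hP : (q.asIdeal.map ψ).IsPrime)
    (hinj : Function.Injective ψ) {M : R} (hM : M ≠ 0) {α β : O} (h : α * β = ψ M) :
    ∃ n : ℕ, Ideal.span {α} = q.asIdeal.map ψ ^ n := by
  obtain ⟨x, -, hx0, hx⟩ := exists_map_eq_span q
  have hx := hx ψ hq
  have hπ : Prime (ψ x) := (Ideal.span_singleton_prime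
    (by rw [map_ne_zero_iff _ hinj]; exact hx0)).mp (hx ▸ hP)
  have hfin : FiniteMultiplicity q.asIdeal (Ideal.span {M}) :=
    FiniteMultiplicity.of_prime_left q.prime (by simpa using hM)
  obtain ⟨J, hJ, hJq⟩ := hfin.exists_eq_pow_mul_and_not_dvd
  -- Factor `(M)` as a power of `q` times an ideal prime to `q`, which becomes the unit ideal in
  -- `O`. So `M` is a unit times a power of the prime element `ψ x`, and so is its divisor `α`, with
  -- a smaller or equal exponent.
  have h1 : Ideal.span {ψ M} = Ideal.span {ψ x} ^ (multiplicity q.asIdeal (Ideal.span {M})) := by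
    have h2 := congrArg (Ideal.map ψ) hJ
    rwa [Ideal.map_span, Set.image_singleton, Ideal.map_mul, Ideal.map_pow, hx,
      map_eq_top_of_not_le hq (mt Ideal.dvd_iff_le.mpr hJq), Ideal.mul_top] at h2
  rw [Ideal.span_singleton_pow, Ideal.span_singleton_eq_span_singleton] at h1
  obtain ⟨n, -, hn⟩ := (dvd_prime_pow hπ _).mp ((Dvd.intro β h).trans h1.dvd)
  exact ⟨n, by rw [hx, Ideal.span_singleton_pow, Ideal.span_singleton_eq_span_singleton]; exact hn⟩

theorem map_pow_injective [IsDomain O] {ψ : R →+* O} (q : HeightOneSpectrum R)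
    (hq : (maximalIdeal O).comap ψ = q.asIdeal)
    (hinj : Function.Injective ψ) {m n : ℕ} (h : q.asIdeal.map ψ ^ m = q.asIdeal.map ψ ^ n) :
    m = n := by
  obtain ⟨x, hxq, hx0, hx⟩ := exists_map_eq_span q
  have hx0 : ψ x ≠ 0 := by rw [map_ne_zero_iff _ hinj]; exact hx0
  have hxu : ¬ IsUnit (ψ x) := by
    have : ψ x ∈ maximalIdeal O := by rwa [← Ideal.mem_comap, hq]
    exact this
  rw [hx ψ hq, Ideal.span_singleton_pow, Ideal.span_singleton_pow,
    Ideal.span_singleton_eq_span_singleton] at h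
  exact le_antisymm ((pow_dvd_pow_iff hx0 hxu).mp h.dvd) ((pow_dvd_pow_iff hx0 hxu).mp h.symm.dvd)

variable (K : Type u) [Field K] [NumberField K]

theorem exists_span_eq_pow_classNumber (q : HeightOneSpectrum (𝓞 K)) :
    ∃ c, q.asIdeal ^ NumberField.classNumber K = Ideal.span {c} := by
  let q' : nonZeroDivisors (Ideal (𝓞 K)) := ⟨q.asIdeal, mem_nonZeroDivisors_of_ne_zero q.ne_bot⟩
  have h1 : ClassGroup.mk0 (q' ^ NumberField.classNumber K) = 1 := by
    rw [map_pow]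
    exact pow_card_eq_one
  rw [ClassGroup.mk0_eq_one_iff] at h1
  exact h1.principal

variable {K}

/-- The product of prime powers becomes principal after raising it to the class number. -/
theorem exists_forall_span_eq (Q : Finset (HeightOneSpectrum (𝓞 K)))
    (n : HeightOneSpectrum (𝓞 K) → ℕ) : ∃ c : 𝓞 K, c ≠ 0 ∧
      ∀ {O : Type u} [CommRing O] [IsLocalRing O] (ψ : 𝓞 K →+* O),
        (∀ q ∈ Q, (maximalIdeal O).comap ψ = q.asIdeal →
          Ideal.span {ψ c} = (q.asIdeal.map ψ ^ n q) ^ NumberField.classNumber K) ∧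
        ((∀ q ∈ Q, ¬ q.asIdeal ≤ (maximalIdeal O).comap ψ) → Ideal.span {ψ c} = ⊤) := by
  classical
  choose c hc using exists_span_eq_pow_classNumber K
  have hc0 : ∀ q, c q ≠ 0 := fun q hq ↦ pow_ne_zero _ q.ne_bot ((hc q).trans (by simp [hq]))
  -- Here `c q` generates `q ^ h`, so the product generates the `h`-th power of the ideal `∏ q ^ n
  -- q`.
  refine ⟨∏ q ∈ Q, c q ^ n q, Finset.prod_ne_zero_iff.mpr fun q _ ↦ pow_ne_zero _ (hc0 q),
    fun {O} _ _ ψ ↦ ?_⟩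
  have key : Ideal.span {ψ (∏ q ∈ Q, c q ^ n q)} =
      ∏ q ∈ Q, (q.asIdeal.map ψ ^ n q) ^ NumberField.classNumber K := by
    rw [map_prod, ← Ideal.prod_span_singleton]
    refine Finset.prod_congr rfl fun q _ ↦ ?_
    rw [map_pow, ← Ideal.span_singleton_pow, pow_right_comm, ← Ideal.map_pow, hc, Ideal.map_span,
      Set.image_singleton]
  rw [key]
  refine ⟨fun q hqQ hq ↦ ?_, fun h ↦ ?_⟩
  · refine Finset.prod_eq_single_of_mem q hqQ fun q' _ hne ↦ ?_
    rw [map_eq_top_of_not_le hq fun hle ↦ hne (HeightOneSpectrum.ext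
      (q'.isMaximal.eq_of_le q.isPrime.ne_top hle))]
    simp [← Ideal.one_eq_top]
  · rw [← Ideal.one_eq_top]
    refine Finset.prod_eq_one fun q hq ↦ ?_
    rw [map_eq_top_of_not_le rfl (h q hq)]
    simp [← Ideal.one_eq_top]

end VerticalDivisors

/-! ### Vertical Cartier divisors on a model with irreducible fibres -/

section KernelTorsion

open IsLocalRing IsDedekindDomain TopologicalSpace

variable {K : Type u} [Field K] [NumberField K] {CK X : Scheme.{u}} {p : CK ⟶ Spec (.of K)}
  {g : X ⟶ Spec (.of (𝓞 K))} [SmoothOfRelativeDimension 1 g] {j : CK ⟶ X}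

theorem baseToStalk_injective {K : Type u} [Field K] [NumberField K] {X : Scheme.{u}}
    (g : X ⟶ Spec (.of (𝓞 K))) [SmoothOfRelativeDimension 1 g] (x : X) :
    Function.Injective (baseToStalk g x) :=
  injective_of_flat (R := 𝓞 K) _ (baseToStalk_flat g x)

/-- An effective Cartier divisor supported in fibres which are irreducible becomes the divisor of
an element of `𝓞 K` after multiplication by the class number. -/
theorem exists_forall_span_germ_eq
    (hgen : ∀ q, ∃ x, g x = point q ∧ ∀ y, g y = point q → x ⤳ y)
    {ι : Type*} {V : ι → X.Opens} (hV : ∀ x, ∃ i, x ∈ V i) (α β : ∀ i, Γ(X, V i)) {M : 𝓞 K}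
    (hM : M ≠ 0) (hαβ : ∀ i, α i * β i = toSections g (V i) M)
    (hα : ∀ i k x (hi : x ∈ V i) (hk : x ∈ V k),
      X.presheaf.germ (V i) x hi (α i) ∣ X.presheaf.germ (V k) x hk (α k)) :
    ∃ c : 𝓞 K, c ≠ 0 ∧ ∀ i x (hx : x ∈ V i),
      Associated (X.presheaf.germ (V i) x hx (α i) ^ NumberField.classNumber K)
        (baseToStalk g x c) := by
  have hgerm : ∀ i x (hx : x ∈ V i), X.presheaf.germ (V i) x hx (α i) *
      X.presheaf.germ (V i) x hx (β i) = baseToStalk g x M := fun i x hx ↦ by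
    rw [← map_mul, hαβ, germ_toSections]
  -- The multiplicity along the fibre over `q` is read off at its generic point `ξ`. Passing from
  -- the local ring at any point of the fibre to that at `ξ` keeps the exponent, and `hα` makes it
  -- independent of the chart.
  have hspan : ∀ q, ∃ n : ℕ, ∀ i x (hx : x ∈ V i), g x = point q →
      Ideal.span {X.presheaf.germ (V i) x hx (α i)} = q.asIdeal.map (baseToStalk g x) ^ n := by
    intro q
    have h1 : ∀ i x (hx : x ∈ V i), g x = point q → ∃ n : ℕ,
        Ideal.span {X.presheaf.germ (V i) x hx (α i)} = q.asIdeal.map (baseToStalk g x) ^ n :=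
      fun i x hx hxq ↦ by
        have := isDomain_stalk g x
        exact exists_span_eq_map_pow q (comap_baseToStalk_eq g hxq) (isPrime_map_baseToStalk g hxq)
          (baseToStalk_injective g x) hM (hgerm i x hx)
    obtain ⟨ξ, hξ, hξs⟩ := hgen q
    obtain ⟨k, hk⟩ := hV ξ
    obtain ⟨n, hn⟩ := h1 k ξ hk hξ
    refine ⟨n, fun i x hx hxq ↦ ?_⟩
    obtain ⟨m, hm⟩ := h1 i x hx hxq
    have hs := hξs x hxq
    have hi : ξ ∈ V i := hs.mem_open (V i).2 hx
    have h2 : Ideal.span {X.presheaf.germ (V i) ξ hi (α i)} =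
        q.asIdeal.map (baseToStalk g ξ) ^ m := by
      have h3 := congrArg (Ideal.map (X.presheaf.stalkSpecializes hs).hom) hm
      rw [Ideal.map_span, Set.image_singleton, Ideal.map_pow, Ideal.map_map] at h3
      have h4 : (X.presheaf.stalkSpecializes hs).hom.comp (baseToStalk g x) = baseToStalk g ξ :=
        RingHom.ext (stalkSpecializes_baseToStalk g hs)
      rw [h4] at h3
      refine Eq.trans ?_ h3
      exact congrArg (fun a ↦ Ideal.span {a})
        (TopCat.Presheaf.germ_stalkSpecializes_apply X.presheaf hx hs (α i)).symm
    have h3 : Ideal.span {X.presheaf.germ (V i) ξ hi (α i)} =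
        Ideal.span {X.presheaf.germ (V k) ξ hk (α k)} :=
      le_antisymm (Ideal.span_singleton_le_span_singleton.mpr (hα k i ξ hk hi))
        (Ideal.span_singleton_le_span_singleton.mpr (hα i k ξ hi hk))
    have := isDomain_stalk g ξ
    rw [hm, map_pow_injective q (comap_baseToStalk_eq g hξ) (baseToStalk_injective g ξ)
      (h2.symm.trans (h3.trans hn))]
  choose n hn using hspan
  have hfin : {q : HeightOneSpectrum (𝓞 K) | q.asIdeal ∣ Ideal.span {M}}.Finite :=
    Ideal.finite_factors (by simpa using hM)
  obtain ⟨c, hc0, hc⟩ := exists_forall_span_eq hfin.toFinset n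
  refine ⟨c, hc0, fun i x hx ↦ ?_⟩
  have := isDomain_stalk g x
  rw [← Ideal.span_singleton_eq_span_singleton, ← Ideal.span_singleton_pow]
  have hcx := hc (baseToStalk g x)
  -- `α` divides `M`, so it is a unit wherever `M` is: on the generic fibre and over primes not
  -- dividing `M`.
  have hu : M ∉ (maximalIdeal _).comap (baseToStalk g x) →
      Ideal.span {X.presheaf.germ (V i) x hx (α i)} = ⊤ := fun h ↦
    Ideal.span_singleton_eq_top.mpr (isUnit_of_mul_isUnit_left
      ((hgerm i x hx).symm ▸ not_not.mp h : IsUnit (_ * X.presheaf.germ (V i) x hx (β i))))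
  rcases eq_bot_or_exists_eq_point (g x) with hgx | ⟨q, hgx⟩
  · have hbot : (maximalIdeal _).comap (baseToStalk g x) = ⊥ :=
      (comap_maximalIdeal_baseToStalk g x).trans congr(($hgx).asIdeal)
    rw [hcx.2 fun q _ hle ↦ q.ne_bot (eq_bot_iff.mpr (hbot ▸ hle)), hu (by rw [hbot]; exact hM),
      ← Ideal.one_eq_top, one_pow]
  · have hq := comap_baseToStalk_eq g hgx
    by_cases hqM : q ∈ hfin.toFinset
    · rw [hcx.1 q hqM hq, hn q i x hx hgx]
    · have hMq : M ∉ q.asIdeal := fun h ↦ hqM (hfin.mem_toFinset.mpr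
        (Ideal.dvd_span_singleton.mpr h))
      rw [hu (by rwa [hq]), hcx.2, ← Ideal.one_eq_top, one_pow]
      intro q' hq' hle
      rw [hq] at hle
      exact hqM (HeightOneSpectrum.ext (q'.isMaximal.eq_of_le q.isPrime.ne_top hle) ▸ hq')

/-- A function on an affine open divisible by another one at all points is divisible by it. -/
theorem dvd_of_forall_germ_dvd {X : Scheme.{u}} {V : X.Opens} (hV : IsAffineOpen V)
    {a b : Γ(X, V)} (h : ∀ x (hx : x ∈ V),
      X.presheaf.germ V x hx a ∣ X.presheaf.germ V x hx b) : a ∣ b := by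
  rw [← Ideal.mem_span_singleton, hV.mem_ideal_iff]
  intro x hx
  rw [Ideal.map_span, Set.image_singleton, Ideal.mem_span_singleton]
  exact h x hx

theorem toSections_mul_cancel (g : X ⟶ Spec (.of (𝓞 K))) [SmoothOfRelativeDimension 1 g]
    {V : X.Opens} {c : 𝓞 K} (hc : c ≠ 0) {a b : Γ(X, V)}
    (h : toSections g V c * a = toSections g V c * b) : a = b := by
  refine TopCat.Presheaf.section_ext X.sheaf V a b fun x hx ↦ ?_
  have := isDomain_stalk g x
  have h1 := congrArg (X.presheaf.germ V x hx) h
  rw [map_mul, map_mul, germ_toSections] at h1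
  change X.presheaf.germ V x hx a = X.presheaf.germ V x hx b
  exact mul_left_cancel₀ ((map_ne_zero_iff _ (baseToStalk_injective g x)).mpr hc) h1

end KernelTorsion

/-! ### Triviality of the `h`-th power -/

section KernelTorsionBundles

open IsLocalRing IsDedekindDomain TopologicalSpace

variable {K : Type u} [Field K] [NumberField K] {CK X : Scheme.{u}} {p : CK ⟶ Spec (.of K)}
  {g : X ⟶ Spec (.of (𝓞 K))} {j : CK ⟶ X}

/-- A line bundle on a quasi-compact scheme has a finite affine cover with frames. -/
theorem exists_finite_isFrame {X : Scheme.{u}} [CompactSpace X] {L : X.Modules}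
    (hL : IsLineBundle L) : ∃ (ι : Type u) (_ : Finite ι) (V : ι → X.Opens)
      (e : ∀ i, Γ(L, V i)), (∀ x, ∃ i, x ∈ V i) ∧ (∀ i, IsAffineOpen (V i)) ∧
        ∀ i, IsFrame L (V i) (e i) := by
  choose V hV hx e he using exists_isFrame hL
  obtain ⟨t, ht⟩ := CompactSpace.elim_nhds_subcover (fun x ↦ (V x : Set X))
    fun x ↦ (V x).2.mem_nhds (hx x)
  refine ⟨t, inferInstance, fun i ↦ V i, fun i ↦ e i, fun x ↦ ?_, fun i ↦ hV i, fun i ↦ he i⟩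
  have h1 : x ∈ ⋃ y ∈ t, (V y : Set X) := ht ▸ trivial
  obtain ⟨y, hy, hxy⟩ := Set.mem_iUnion₂.mp h1
  exact ⟨⟨y, hy⟩, hxy⟩

/-- Finitely many units on the generic fibres of affine opens have a common denominator. -/
theorem exists_common_denominator
    (h : IsPullback j p g (Spec.map (CommRingCat.ofHom (algebraMap (𝓞 K) K))))
    {ι : Type*} [Finite ι] {V : ι → X.Opens} (hV : ∀ i, IsAffineOpen (V i))
    (a : ∀ i, Γ(CK, j ⁻¹ᵁ V i)) :
    ∃ m : 𝓞 K, m ≠ 0 ∧ ∀ i, ∃ α, j.app (V i) α = j.app (V i) (toSections g (V i) m) * a i := by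
  cases nonempty_fintype ι
  choose m hm0 α hα using fun i ↦ exists_app_eq_mul h (hV i) (a i)
  refine ⟨∏ i, m i, Finset.prod_ne_zero_iff.mpr fun i _ ↦ hm0 i, fun i ↦ ?_⟩
  obtain ⟨r, hr⟩ := Finset.dvd_prod_of_mem m (Finset.mem_univ i)
  refine ⟨toSections g (V i) r * α i, ?_⟩
  rw [hr, map_mul, map_mul, map_mul, hα]
  ring

/-- The kernel of restriction to the generic fibre is killed by the class number. -/
theorem isTrivial_tensorPow [SmoothOfRelativeDimension 1 g] [CompactSpace X]
    (h : IsPullback j p g (Spec.map (CommRingCat.ofHom (algebraMap (𝓞 K) K))))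
    (hgen : ∀ q, ∃ x, g x = point q ∧ ∀ y, g y = point q → x ⤳ y) {L : X.Modules}
    (hL : IsLineBundle L) (hLj : IsTrivial ((Scheme.Modules.pullback j).obj L)) :
    IsTrivial (tensorPow L (NumberField.classNumber K)) := by
  obtain ⟨θ⟩ := hLj
  obtain ⟨ι, _, V, e, hV, hVa, he⟩ := exists_finite_isFrame hL
  choose u hu using fun i ↦ isUnit_toFun θ (he i)
  set Φ := ((Scheme.Modules.pullbackPushforwardAdjunction j).homEquiv _ _ θ.hom)
  -- Extend `m u` and `m' u⁻¹` from the generic fibre to functions `α` and `β` with `α β = m m'`.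
  -- The common denominators for all charts let the `α i` change like the frames, and `β` bounds the
  -- divisor of `α`.
  obtain ⟨m, hm, α, hα⟩ : ∃ m : 𝓞 K, m ≠ 0 ∧ ∃ α : ∀ i, Γ(X, V i), ∀ i,
      j.app (V i) (α i) = j.app (V i) (toSections g (V i) m) * u i := by
    obtain ⟨m, hm, hα⟩ := exists_common_denominator h hVa fun i ↦ u i
    choose α hα using hα
    exact ⟨m, hm, α, hα⟩
  obtain ⟨m', hm', β, hβ⟩ : ∃ m : 𝓞 K, m ≠ 0 ∧ ∃ β : ∀ i, Γ(X, V i), ∀ i,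
      j.app (V i) (β i) = j.app (V i) (toSections g (V i) m) * ((u i)⁻¹ : _ˣ) := by
    obtain ⟨m, hm, hα⟩ := exists_common_denominator h hVa fun i ↦ ((u i)⁻¹ : _ˣ)
    choose α hα using hα
    exact ⟨m, hm, α, hα⟩
  have hαβ : ∀ i, α i * β i = toSections g (V i) (m * m') := fun i ↦ by
    apply app_injective h
    rw [map_mul, hα, hβ, map_mul, map_mul, mul_mul_mul_comm, Units.mul_inv, mul_one]
  have hw : ∀ i k, ∃ w : Γ(X, V i ⊓ V k),
      w • res L (inf_le_right : V i ⊓ V k ≤ V k) (e k) = res L inf_le_left (e i) := fun i k ↦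
    (he k _ inf_le_right).2 _
  choose w hw using hw
  have hwα : ∀ i k, resFun (inf_le_left : V i ⊓ V k ≤ V i) (α i) =
      w i k * resFun (inf_le_right : V i ⊓ V k ≤ V k) (α k) := fun i k ↦ by
    have h1 := congrArg (toFun Φ _) (hw i k)
    rw [toFun_smul, toFun_res, toFun_res] at h1
    apply app_injective h
    rw [map_mul, app_resFun, app_resFun, hα, hα, map_mul, map_mul,
      ← app_resFun j (inf_le_left : V i ⊓ V k ≤ V i), ← app_resFun j (inf_le_right : V i ⊓ V k ≤ V k),
      resFun_toSections, resFun_toSections, hu, hu, ← h1]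
    ring
  have hdvd : ∀ i k x (hi : x ∈ V i) (hk : x ∈ V k),
      X.presheaf.germ (V i) x hi (α i) ∣ X.presheaf.germ (V k) x hk (α k) := fun i k x hi hk ↦ by
    have h1 := congrArg (X.presheaf.germ (V k ⊓ V i) x ⟨hk, hi⟩) (hwα k i)
    rw [map_mul] at h1
    exact Dvd.intro_left _ ((congrArg (_ * ·) (TopCat.Presheaf.germ_res_apply X.presheaf _ _ _
      (α i)).symm).trans (h1.symm.trans (TopCat.Presheaf.germ_res_apply X.presheaf _ _ _ (α k))))
  obtain ⟨c, hc0, hc⟩ := exists_forall_span_germ_eq hgen hV α β (mul_ne_zero hm hm') hαβ hdvd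
  set n := NumberField.classNumber K
  -- Being associated at every point of an affine open means dividing each other on it; cancelling
  -- the nonzero constant `c` shows the quotient is a unit.
  have hb : ∀ i, ∃ b : (Γ(X, V i))ˣ, α i ^ n = toSections g (V i) c * b := fun i ↦ by
    obtain ⟨b, hb⟩ := dvd_of_forall_germ_dvd (hVa i) (a := toSections g (V i) c) (b := α i ^ n)
      fun x hx ↦ by rw [germ_toSections, map_pow]; exact (hc i x hx).symm.dvd
    obtain ⟨b', hb'⟩ := dvd_of_forall_germ_dvd (hVa i) (a := α i ^ n) (b := toSections g (V i) c)
      fun x hx ↦ by rw [germ_toSections, map_pow]; exact (hc i x hx).dvd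
    have hbb : b * b' = 1 := toSections_mul_cancel g hc0 (by rw [← mul_assoc, ← hb, ← hb', mul_one])
    exact ⟨⟨b, b', hbb, by rw [mul_comm, hbb]⟩, hb⟩
  choose b hb using hb
  -- With `e i = w (e k)` also `α i = w (α k)`, hence `b i = w ^ n (b k)`. So these normalized
  -- powers agree on overlaps.
  let t : ∀ i, Γ(tensorPow L n, V i) := fun i ↦ ((b i)⁻¹ : (Γ(X, V i))ˣ).val • tpow (e i) n
  have hres : ∀ {i} {W : X.Opens} (hW : W ≤ V i), res _ hW (t i) =
      resFun hW ((b i)⁻¹ : (Γ(X, V i))ˣ).val • tpow (res L hW (e i)) n := fun hW ↦ by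
    rw [res_smul, res_tpow]
  obtain ⟨s, hs⟩ := exists_res_eq (tensorPow L n) V hV t fun i k ↦ by
    rw [hres, hres, ← hw, tpow_smul, smul_smul]
    congr 1
    have h1 : resFun (inf_le_left : V i ⊓ V k ≤ V i) (b i).val =
        w i k ^ n * resFun (inf_le_right : V i ⊓ V k ≤ V k) (b k).val := by
      apply toSections_mul_cancel g hc0
      have h2 := congrArg (resFun (inf_le_left : V i ⊓ V k ≤ V i)) (hb i)
      have h3 := congrArg (resFun (inf_le_right : V i ⊓ V k ≤ V k)) (hb k)
      rw [map_mul, map_pow, resFun_toSections] at h2 h3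
      rw [← h2, hwα, mul_pow, h3]
      ring
    have h2 : resFun (inf_le_left : V i ⊓ V k ≤ V i) (b i).val *
        resFun (inf_le_left : V i ⊓ V k ≤ V i) ((b i)⁻¹ : (Γ(X, V i))ˣ).val = 1 := by
      rw [← map_mul, Units.mul_inv, map_one]
    have h3 : resFun (inf_le_right : V i ⊓ V k ≤ V k) (b k).val *
        resFun (inf_le_right : V i ⊓ V k ≤ V k) ((b k)⁻¹ : (Γ(X, V k))ˣ).val = 1 := by
      rw [← map_mul, Units.mul_inv, map_one]
    rw [h1] at h2
    linear_combination (exp := 1) resFun inf_le_right ((b k)⁻¹ : (Γ(X, V k))ˣ).val * h2 -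
      resFun inf_le_left ((b i)⁻¹ : (Γ(X, V i))ˣ).val * w i k ^ n * h3
  refine IsFrame.isTrivial (e := s) (isFrame_of_forall_exists fun x _ ↦ ?_)
  obtain ⟨i, hi⟩ := hV x
  refine ⟨V i, le_top, hi, ?_⟩
  rw [hs]
  exact ((he i).tpow n).smul ((b i)⁻¹).isUnit

end KernelTorsionBundles

end PicU

end

theorem mainTheorem10 {K : Type u} [Field K] [NumberField K] {CK C : Scheme.{u}}
    (p : CK ⟶ Spec (.of K)) (hp : PicU.IsCurve p)
    (f : C ⟶ Spec (.of (𝓞 K))) [IsProper f] (i : CK ⟶ C)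
    (hmodel : PicU.IsRegularProperModel p f i)
    (U : C.Opens) (hU : PicU.IsAdmissibleOpen f U) :
    Function.Bijective (PicU.toGlobalFunctions f U) ∧
      ∃ j : CK ⟶ (U : Scheme.{u}), j ≫ U.ι = i ∧
        ∀ L : (U : Scheme.{u}).Modules, PicU.IsLineBundle L →
          PicU.IsTrivial ((Scheme.Modules.pullback j).obj L) →
            PicU.IsTrivial (PicU.tensorPow L (NumberField.classNumber K)) := by
  have := hp.smooth
  have := hp.proper
  have := hp.geometricallyConnected
  have := hmodel.flat
  have h := hmodel.genericFibre
  have : Smooth p := SmoothOfRelativeDimension.smooth 1 p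
  have : Smooth (U.ι ≫ f) := by
    rw [← C.homOfLE_ι hU.le_smoothLocus, Category.assoc]
    infer_instance
  have := PicU.smoothOfRelativeDimension_one h U.ι
  have hr : Set.range i ⊆ Set.range U.ι := by
    rw [Scheme.Opens.range_ι]
    exact hU.range_subset h
  have hj := IsOpenImmersion.lift_fac U.ι i hr
  set j := IsOpenImmersion.lift U.ι i hr
  have hjp : IsPullback j p (U.ι ≫ f) (Spec.map (CommRingCat.ofHom (algebraMap (𝓞 K) K))) :=
    PicU.isPullback_of_comp_mono (hj.symm ▸ h)
  -- Nonempty irreducible closed fibres: nonemptiness gives the global functions, the generic point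
  -- gives the torsion statement.
  have hgen : ∀ q, ∃ x : U, (U.ι ≫ f) x = PicU.point q ∧
      ∀ y : U, (U.ι ≫ f) y = PicU.point q → x ⤳ y := fun q ↦ by
    obtain ⟨x, hxU, hx, hxs⟩ := hU.exists_generic hp h q
    exact ⟨⟨x, hxU⟩, hx, fun y hy ↦ Topology.IsInducing.subtypeVal.specializes_iff.mp (hxs y y.2 hy)⟩
  have : IsLocallyNoetherian C := LocallyOfFiniteType.isLocallyNoetherian f
  have : CompactSpace C := QuasiCompact.compactSpace_of_compactSpace f
  have : IsNoetherian C := {}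
  have : CompactSpace U := isCompact_iff_compactSpace.mp
    (TopologicalSpace.NoetherianSpace.isCompact (U : Set C))
  refine ⟨PicU.bijective_toGlobal hjp fun q ↦ (hgen q).imp fun x hx ↦ hx.1, j, hj,
    fun L hL hLj ↦ PicU.isTrivial_tensorPow hjp hgen hL hLj⟩
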